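/- Let $\mathscr{S}=(\mathscr{S}_{n,\pm})_{n\ge 0}$ be a subfactor planar algebra, that is, a spherical shaded planar $*$-algebra over $\mathbb{C}$ with $\dim\mathscr{S}_{n,\pm}<\infty$ for all $n$ and $\dim\mathscr{S}_{0,\pm}=1$, such that the Markov trace induces a positive definite inner product on every $\mathscr{S}_{n,\pm}$. Write $\mathscr{S}_n=\mathscr{S}_{n,+}$ and regard $\mathscr{S}_n$ as a subalgebra of $\mathscr{S}_{n+1}$ by adding a string on the right. For 2-boxes $a,b\in\mathscr{S}_2$ (drawn with the distinguished interval on the left) let $a'$ be the contragredient of $a$ (its rotation by a half turn), and let $a*b$ be the coproduct (put $a$ to the left of $b$ and connect the two right boundary points of $a$ with the two left boundary points of $b$). If $X=\sum_{i=1}^k C_iR_i$ with mutually orthogonal minimal projections $R_i\in\mathscr{S}_2$ and $C_i>0$, then $k$ is called the rank $r(X)$ of $X$. **Lemma.** Let $P$ and $Q$ be projections in $\mathscr{S}_2$. Then $P'*Q$ has such a decomposition, and $$r(P'*Q)\le \dim(Q\mathscr{S}_3P),\qquad\text{where } Q\mathscr{S}_3P=\{QxP \mid x\in\mathscr{S}_3\}.$$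 If moreover $P$ and $Q$ are minimal projections in $\mathscr{S}_2$, then they correspond to vertices $v$ and $w$ of the principal graph of $\mathscr{S}$, and $\dim(Q\mathscr{S}_3P)$ is the number of paths of length $2$ between $v$ and $w$; in particular $r(P'*Q)$ is at most this number. Here the principal graph is described as follows. Let $e_{n}\in\mathscr{S}_{n+1}$ be the Jones projections, let $\mathscr{I}_{n+1}$ be the two-sided ideal of $\mathscr{S}_{n+1}$ generated by $e_n$ (for $n\ge1$), and let $\mathscr{I}_0=\mathscr{I}_1=0$. The vertices of depth $n$ are the equivalence classes of the minimal projections of $\mathscr{S}_n$ that are orthogonal to $\mathscr{I}_n$; a vertex $[p]$ of depth $n$ and a vertex $[q]$ of depth $n+1$ are connected by $\dim(q\mathscr{S}_{n+1}p)$ edges, and there are no other edges. A minimal projection $p$ of $\mathscr{S}_n$ that is orthogonal to $\mathscr{I}_n$ corresponds to the vertex $[p]$, and a minimal projection of $\mathscr{S}_{n+2}$ that is equivalent to $q\,e_{n+1}$, for a minimal projection $q$ of $\mathscr{S}_n$, corresponds to the same vertex as $q$. (So a minimal projection of $\mathscr{S}_2$ corresponds to a vertex of depth $2$, or to the marked vertex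 of depth $0$ if it is equivalent to $e_1$.) -/

import Mathlib

/-! Planar tangles, planar algebras, subfactor planar algebras, and the principal graph. -/

/-- The type of a disc of a shaded planar tangle: it has `2 * n` boundary points, and its
distinguished boundary interval meets a shaded (`true`) or an unshaded (`false`) region.  The
colours `⟨n, false⟩` and `⟨n, true⟩` are usually written `(n, +)` and `(n, -)`. -/
structure Colour where
  n : ℕ
  shaded : Bool

/-- The shading of the `j`-th boundary interval of a disc (counted clockwise from the distinguished
interval, which is number `0`): the shading alternates. -/
def Colour.shadeAt (c : Colour) (j : ℕ) : Bool := xor c.shaded (decide (j % 2 = 1))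

/-- The discs of a tangle: `none` is the outer disc, `some i` are the input discs. -/
abbrev discColour {ι : Type} (col : ι → Colour) (out : Colour) (d : Option ι) : Colour :=
  Option.elim d out col

/-- The combinatorial data of a diagram on an oriented surface: strings and regions.
For every disc, the boundary points are numbered `0, …, 2n-1` clockwise, starting at the
distinguished interval, and the boundary intervals are numbered `0, …, 2n`, where the point `p`
lies between the intervals `p` and `p + 1`; number `0` and number `2n` are both the distinguished
interval.
* `str d p` is the string that ends at the point `p` of the disc `d` (a string without end
  points is a closed loop);
* `reg d j` is the region that meets the interval `j` of the disc `d`;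
* `side b s` is the region of shading `b` along the string `s`;
* `shade r` is the shading of the region `r`. -/
structure PreTangle {ι : Type} (col : ι → Colour) (out : Colour) where
  Str : Type
  Reg : Type
  str : ∀ d : Option ι, Fin (2 * (discColour col out d).n) → Str
  reg : ∀ d : Option ι, Fin (2 * (discColour col out d).n + 1) → Reg
  side : Bool → Str → Reg
  shade : Reg → Bool

namespace PreTangle

variable {ι : Type} {col : ι → Colour} {out : Colour}

/-- Incidence between discs, strings and regions. -/
inductive Incident (T : PreTangle col out) :
    Option ι ⊕ (T.Str ⊕ T.Reg) → Option ι ⊕ (T.Str ⊕ T.Reg) → Prop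
  | disc_str (d : Option ι) (p : Fin (2 * (discColour col out d).n)) :
      Incident T (.inl d) (.inr (.inl (T.str d p)))
  | disc_reg (d : Option ι) (j : Fin (2 * (discColour col out d).n + 1)) :
      Incident T (.inl d) (.inr (.inr (T.reg d j)))
  | str_reg (b : Bool) (s : T.Str) :
      Incident T (.inr (.inl s)) (.inr (.inr (T.side b s)))

/-- A disc touches the strings that end on it. -/
inductive Touch (T : PreTangle col out) : Option ι ⊕ T.Str → Option ι ⊕ T.Str → Prop
  | mk (d : Option ι) (p : Fin (2 * (discColour col out d).n)) :
      Touch T (.inl d) (.inr (T.str d p))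

/-- The connected components of the union of the discs and the strings. -/
def Component (T : PreTangle col out) : Type := Quot T.Touch

/-- Orient every string so that the shaded region is on a fixed side.  Then `T.dir d p` tells
whether the string at the point `p` of `d` enters or leaves the disc; the outer disc is seen from
the inside. -/
def dir (_T : PreTangle col out) (d : Option ι) (p : Fin (2 * (discColour col out d).n)) : Bool :=
  xor ((discColour col out d).shadeAt p) d.isNone

end PreTangle

/-- A shaded planar tangle with input discs indexed by `ι`, up to isotopy.  The incidence
conditions say that the data come from an oriented surface that is cut into regions by the discs
and the strings.  The last two conditions are the connectedness of the whole picture and Euler's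
formula `V - E + F = 1 + C` for a graph with `C` components in the sphere, where `V` is the number
of discs (including the outer one), `E` the number of non-closed strings, which is half of the
number of all boundary points, `F` the number of regions and `C` the number of components (a closed
loop contributes `1` to `V`, to `E` and to `C`).  Together they say that the surface is a sphere,
with the exterior of the outer disc as a removed disc, and that every region has genus zero. -/
structure Tangle {ι : Type} [Fintype ι] (col : ι → Colour) (out : Colour)
    extends PreTangle col out where
  finite_str : Finite Str
  finite_reg : Finite Reg
  reg_last : ∀ d, reg d (Fin.last _) = reg d 0
  reg_before : ∀ d (p : Fin (2 * (discColour col out d).n)),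
    reg d p.castSucc = side ((discColour col out d).shadeAt p) (str d p)
  reg_after : ∀ d (p : Fin (2 * (discColour col out d).n)),
    reg d p.succ = side ((discColour col out d).shadeAt (p + 1)) (str d p)
  shade_reg : ∀ d j, shade (reg d j) = (discColour col out d).shadeAt j
  shade_side : ∀ b s, shade (side b s) = b
  /-- A string is a closed loop, or it has exactly two end points, one of each direction. -/
  ends : ∀ s, (∀ d p, str d p ≠ s) ∨
    ∀ b, ∃! x : (d : Option ι) × Fin (2 * (discColour col out d).n),
      str x.1 x.2 = s ∧ toPreTangle.dir x.1 x.2 = b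
  connected : ∀ x, Relation.EqvGen toPreTangle.Incident (.inl none) x
  euler : (Fintype.card ι + 1) + Nat.card Reg =
    (out.n + ∑ i, (col i).n) + 1 + Nat.card toPreTangle.Component

namespace Tangle

variable {ι : Type} [Fintype ι] {col : ι → Colour} {out : Colour}

/-- Strings are glued where the outer boundary of the `i`-th inserted tangle meets the `i`-th
input disc. -/
inductive GlueStr {κ : ι → Type} [∀ i, Fintype (κ i)] {ic : ∀ i, κ i → Colour}
    (T : Tangle col out) (U : ∀ i, Tangle (ic i) (col i)) :
    T.Str ⊕ ((i : ι) × (U i).Str) → T.Str ⊕ ((i : ι) × (U i).Str) → Prop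
  | mk (i : ι) (p : Fin (2 * (col i).n)) :
      GlueStr T U (.inl (T.str (some i) p)) (.inr ⟨i, (U i).str none p⟩)

/-- Regions are glued along the boundary intervals of the input discs. -/
inductive GlueReg {κ : ι → Type} [∀ i, Fintype (κ i)] {ic : ∀ i, κ i → Colour}
    (T : Tangle col out) (U : ∀ i, Tangle (ic i) (col i)) :
    T.Reg ⊕ ((i : ι) × (U i).Reg) → T.Reg ⊕ ((i : ι) × (U i).Reg) → Prop
  | mk (i : ι) (j : Fin (2 * (col i).n + 1)) :
      GlueReg T U (.inl (T.reg (some i) j)) (.inr ⟨i, (U i).reg none j⟩)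

/-- `W` is the tangle that results from inserting the tangles `U i` into the input discs of `T`:
its strings (regions) are the classes of the strings (regions) of `T` and of the `U i`
under gluing. -/
def IsComposite {κ : ι → Type} [∀ i, Fintype (κ i)] {ic : ∀ i, κ i → Colour}
    (T : Tangle col out) (U : ∀ i, Tangle (ic i) (col i))
    (W : Tangle (fun x : (i : ι) × κ i => ic x.1 x.2) out) : Prop :=
  ∃ (f : T.Str ⊕ ((i : ι) × (U i).Str) → W.Str) (g : T.Reg ⊕ ((i : ι) × (U i).Reg) → W.Reg),
    Function.Surjective f ∧ Function.Surjective g ∧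
    (∀ a b, f a = f b ↔ Relation.EqvGen (GlueStr T U) a b) ∧
    (∀ a b, g a = g b ↔ Relation.EqvGen (GlueReg T U) a b) ∧
    (∀ p, W.str none p = f (.inl (T.str none p))) ∧
    (∀ i k p, W.str (some ⟨i, k⟩) p = f (.inr ⟨i, (U i).str (some k) p⟩)) ∧
    (∀ j, W.reg none j = g (.inl (T.reg none j))) ∧
    (∀ i k j, W.reg (some ⟨i, k⟩) j = g (.inr ⟨i, (U i).reg (some k) j⟩)) ∧
    (∀ b s, W.side b (f (.inl s)) = g (.inl (T.side b s))) ∧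
    (∀ b i s, W.side b (f (.inr ⟨i, s⟩)) = g (.inr ⟨i, (U i).side b s⟩))

/-- `W` is `T` up to isotopy, with the input discs renamed along `e`. -/
def IsRelabelling {ι' : Type} [Fintype ι'] (e : ι' ≃ ι) (T : Tangle col out)
    (W : Tangle (fun i => col (e i)) out) : Prop :=
  ∃ (f : T.Str ≃ W.Str) (g : T.Reg ≃ W.Reg),
    (∀ p, W.str none p = f (T.str none p)) ∧
    (∀ i p, W.str (some i) p = f (T.str (some (e i)) p)) ∧
    (∀ j, W.reg none j = g (T.reg none j)) ∧
    (∀ i j, W.reg (some i) j = g (T.reg (some (e i)) j)) ∧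
    (∀ b s, W.side b (f s) = g (T.side b s))

/-- `W` is the image of `T` under a reflection of the plane. -/
def IsReflection (T W : Tangle col out) : Prop :=
  ∃ (f : T.Str ≃ W.Str) (g : T.Reg ≃ W.Reg),
    (∀ d p, W.str d p = f (T.str d p.rev)) ∧
    (∀ d j, W.reg d j = g (T.reg d j.rev)) ∧
    (∀ b s, W.side b (f s) = g (T.side b s))

/-- Two tangles without boundary points on the outer disc are isotopic as diagrams on the sphere:
the outer disc may lie in different regions. -/
def IsSphereIsotopic {s s' : Bool} (T : Tangle col ⟨0, s⟩) (W : Tangle col ⟨0, s'⟩) : Prop :=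
  ∃ (f : T.Str ≃ W.Str) (g : T.Reg ≃ W.Reg),
    (∀ i p, W.str (some i) p = f (T.str (some i) p)) ∧
    (∀ i j, W.reg (some i) j = g (T.reg (some i) j)) ∧
    (∀ b s, W.side b (f s) = g (T.side b s))

end Tangle

/-! ### Helper facts for the construction of tangles -/

theorem Colour.shadeAt_eq_iff (c : Colour) (j k : ℕ) :
    c.shadeAt j = c.shadeAt k ↔ j % 2 = k % 2 := by
  unfold Colour.shadeAt
  rcases Nat.mod_two_eq_zero_or_one j with h | h <;>
    rcases Nat.mod_two_eq_zero_or_one k with h' | h' <;> cases c.shaded <;> simp [h, h']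

theorem Colour.shadeAt_succ (c : Colour) (j : ℕ) : c.shadeAt (j + 1) = !c.shadeAt j := by
  unfold Colour.shadeAt
  rcases Nat.mod_two_eq_zero_or_one j with h | h <;> cases c.shaded <;>
    simp [h, Nat.add_mod]

theorem Colour.shadeAt_zero (c : Colour) : c.shadeAt 0 = c.shaded := by
  simp [Colour.shadeAt]

theorem PreTangle.incident_disc_str {ι : Type} {col : ι → Colour} {out : Colour}
    (T : PreTangle col out) {x} (d p) (h : Relation.EqvGen T.Incident x (.inl d)) :
    Relation.EqvGen T.Incident x (.inr (.inl (T.str d p))) :=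
  .trans _ _ _ h (.rel _ _ (.disc_str d p))

theorem PreTangle.incident_str_disc {ι : Type} {col : ι → Colour} {out : Colour}
    (T : PreTangle col out) {x} (d p)
    (h : Relation.EqvGen T.Incident x (.inr (.inl (T.str d p)))) :
    Relation.EqvGen T.Incident x (.inl d) :=
  .trans _ _ _ h (.symm _ _ (.rel _ _ (.disc_str d p)))

theorem PreTangle.incident_disc_reg {ι : Type} {col : ι → Colour} {out : Colour}
    (T : PreTangle col out) {x} (d j) (h : Relation.EqvGen T.Incident x (.inl d)) :
    Relation.EqvGen T.Incident x (.inr (.inr (T.reg d j))) :=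
  .trans _ _ _ h (.rel _ _ (.disc_reg d j))

theorem PreTangle.incident_reg_disc {ι : Type} {col : ι → Colour} {out : Colour}
    (T : PreTangle col out) {x} (d j)
    (h : Relation.EqvGen T.Incident x (.inr (.inr (T.reg d j)))) :
    Relation.EqvGen T.Incident x (.inl d) :=
  .trans _ _ _ h (.symm _ _ (.rel _ _ (.disc_reg d j)))

theorem PreTangle.connected_of {ι : Type} {col : ι → Colour} {out : Colour}
    (T : PreTangle col out) (hd : ∀ i, ∃ j j', T.reg (some i) j = T.reg none j')
    (hs : ∀ s, ∃ d p, T.str d p = s) (hr : ∀ r, ∃ d j, T.reg d j = r) (x) :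
    Relation.EqvGen T.Incident (.inl none) x := by
  have key : ∀ d, Relation.EqvGen T.Incident (.inl none) (.inl d) := by
    rintro (_ | i)
    · exact .refl _
    · obtain ⟨j, j', h⟩ := hd i
      apply T.incident_reg_disc (some i) j
      rw [h]
      exact T.incident_disc_reg none j' (.refl _)
  rcases x with d | s | r
  · exact key d
  · obtain ⟨d, p, rfl⟩ := hs s
    exact T.incident_disc_str d p (key d)
  · obtain ⟨d, j, rfl⟩ := hr r
    exact T.incident_disc_reg d j (key d)

theorem PreTangle.card_component {ι : Type} {col : ι → Colour} {out : Colour}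
    (T : PreTangle col out) (k : ℕ) (f : Option ι ⊕ T.Str → Fin k) (g : Fin k → Option ι ⊕ T.Str)
    (hf : ∀ d p, f (.inl d) = f (.inr (T.str d p))) (hfg : ∀ m, f (g m) = m)
    (hg : ∀ x, Relation.EqvGen T.Touch (g (f x)) x) : Nat.card T.Component = k := by
  have e : T.Component ≃ Fin k :=
    { toFun := Quot.lift f (by rintro _ _ ⟨d, p⟩; exact hf d p)
      invFun := fun m => Quot.mk _ (g m)
      left_inv := by
        rintro ⟨x⟩
        exact Quot.eqvGen_sound (hg x)
      right_inv := hfg }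
  rw [Nat.card_congr e, Nat.card_eq_fintype_card, Fintype.card_fin]

theorem PreTangle.card_component_one {ι : Type} {col : ι → Colour} {out : Colour}
    (T : PreTangle col out) (hd : ∀ i, Relation.EqvGen T.Touch (.inl none) (.inl (some i)))
    (hs : ∀ s, ∃ d p, T.str d p = s) : Nat.card T.Component = 1 := by
  refine T.card_component 1 (fun _ => 0) (fun _ => .inl none) (fun _ _ => rfl)
    (fun m => (Subsingleton.elim _ _)) ?_
  have key : ∀ d, Relation.EqvGen T.Touch (.inl none) (.inl d) := by
    rintro (_ | i)
    · exact .refl _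
    · exact hd i
  rintro (d | s)
  · exact key d
  · obtain ⟨d, p, rfl⟩ := hs s
    exact .trans _ _ _ (key d) (.rel _ _ (.mk d p))

theorem PreTangle.touch_trans {ι : Type} {col : ι → Colour} {out : Colour}
    (T : PreTangle col out) {x} (d p d' p') (h : Relation.EqvGen T.Touch x (.inl d))
    (h' : T.str d p = T.str d' p') : Relation.EqvGen T.Touch x (.inl d') := by
  refine .trans _ _ _ h (.trans _ _ _ (.rel _ _ (.mk d p)) ?_)
  rw [h']
  exact .symm _ _ (.rel _ _ (.mk d' p'))

theorem PreTangle.card_component_of_isEmpty {ι : Type} [Fintype ι] {col : ι → Colour}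
    {out : Colour} (T : PreTangle col out) (h : IsEmpty T.Str) :
    Nat.card T.Component = Fintype.card ι + 1 := by
  have e : T.Component ≃ Option ι :=
    { toFun := Quot.lift (Sum.elim id (fun s => h.elim s))
        (by rintro _ _ ⟨d, p⟩; exact h.elim (T.str d p))
      invFun := fun d => Quot.mk _ (.inl d)
      left_inv := by
        rintro ⟨d | s⟩
        · rfl
        · exact h.elim s
      right_inv := fun _ => rfl }
  rw [Nat.card_congr e, Nat.card_eq_fintype_card, Fintype.card_option]

/-! ### The tangles in which the operations are defined

A box with `2 * n` boundary points is drawn as a rectangle with the distinguished interval on the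
left: the points `0, …, n-1` are on the top, from left to right, and the points `n, …, 2n-1` on the
bottom, from right to left. -/

/-- The gaps between the vertical strings in a stack of `L + 1` layers of `n` strings each: the gap
number `k` lies to the left of the string number `k`.  The leftmost gaps of all layers are the
same region, and so are the rightmost ones. -/
abbrev Gap (L n : ℕ) : Type :=
  {x : Fin (L + 1) × Fin (n + 1) // (x.2.val = 0 ∨ x.2.val = n) → x.1 = 0}

/-- The gap number `k` in the layer `l`. -/
def gap {L n : ℕ} (l : Fin (L + 1)) (k : Fin (n + 1)) : Gap L n :=
  if h : k.val = 0 ∨ k.val = n then ⟨(0, k), fun _ => rfl⟩ else ⟨(l, k), fun h' => absurd h' h⟩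

theorem gap_val {L n : ℕ} (r : Gap L n) : gap r.1.1 r.1.2 = r := by
  obtain ⟨⟨l, k⟩, hr⟩ := r
  unfold gap
  split_ifs with h
  · have := hr h
    simp only at this
    subst this
    rfl
  · rfl

theorem gap_val_snd {L n : ℕ} (l : Fin (L + 1)) (k : Fin (n + 1)) : (gap l k).1.2 = k := by
  unfold gap
  split_ifs <;> rfl

theorem gap_eq {L n : ℕ} (l l' : Fin (L + 1)) (k k' : Fin (n + 1)) (hk : k.val = k'.val)
    (h : l = l' ∨ k.val = 0 ∨ k.val = n) : gap l k = gap l' k' := by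
  obtain rfl : k = k' := Fin.ext hk
  rcases h with rfl | h
  · rfl
  · unfold gap
    rw [dif_pos h, dif_pos h]

theorem card_gap_zero (L : ℕ) : Nat.card (Gap L 0) = 1 := by
  rw [Nat.card_eq_one_iff_unique]
  refine ⟨⟨?_⟩, ⟨⟨(0, 0), fun _ => rfl⟩⟩⟩
  rintro ⟨⟨l, k⟩, h⟩ ⟨⟨l', k'⟩, h'⟩
  have hk : k = 0 := Fin.ext (by omega)
  have hk' : k' = 0 := Fin.ext (by omega)
  subst hk hk'
  have h1 := h (.inl rfl)
  have h2 := h' (.inl rfl)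
  simp only at h1 h2
  subst h1 h2
  rfl

theorem card_gap_succ (L n : ℕ) : Nat.card (Gap L (n + 1)) = 2 + (L + 1) * n := by
  have e : Gap L (n + 1) ≃ Fin 2 ⊕ (Fin (L + 1) × Fin n) :=
    { toFun := fun r =>
        if h0 : r.1.2.val = 0 then .inl 0
        else if h1 : r.1.2.val = n + 1 then .inl 1
        else .inr (r.1.1, ⟨r.1.2.val - 1, by have := r.1.2.isLt; omega⟩)
      invFun := Sum.elim
        (fun i => if i = 0 then ⟨(0, 0), fun _ => rfl⟩ else ⟨(0, Fin.last _), fun _ => rfl⟩)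
        (fun x => ⟨(x.1, ⟨x.2.val + 1, by have := x.2.isLt; omega⟩),
          fun h => absurd h (by have := x.2.isLt; simp only; omega)⟩)
      left_inv := by
        rintro ⟨⟨l, k⟩, h⟩
        by_cases h0 : k.val = 0
        · have hl := h (.inl h0)
          simp only at hl
          subst hl
          have : k = 0 := Fin.ext h0
          subst this
          simp
        · by_cases h1 : k.val = n + 1
          · have hl := h (.inr h1)
            simp only at hl
            subst hl
            have : k = Fin.last _ := Fin.ext h1
            subst this
            simp
          · simp only [h0, h1, dite_false, Sum.elim_inr]
            apply Subtype.ext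
            refine Prod.ext rfl (Fin.ext ?_)
            simp only
            omega
      right_inv := by
        rintro (i | ⟨l, k⟩)
        · fin_cases i <;> simp
        · have := k.isLt
          have h1 : k.val ≠ n := by omega
          simp [h1] }
  rw [Nat.card_congr e, Nat.card_eq_fintype_card]
  simp

/-- The region of shading `b` among the two regions `x` and `y` to the left and to the right of the
vertical string number `k`. -/
def pick {α : Type} (c : Colour) (k : ℕ) (b : Bool) (x y : α) : α :=
  if c.shadeAt k = b then x else y

theorem pick_of_even {α : Type} (c : Colour) (k m : ℕ) (x y : α) (h : m % 2 = k % 2) :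
    pick c k (c.shadeAt m) x y = x := by
  simp [pick, Colour.shadeAt_eq_iff, h]

theorem pick_of_odd {α : Type} (c : Colour) (k m : ℕ) (x y : α) (h : m % 2 ≠ k % 2) :
    pick c k (c.shadeAt m) x y = y := by
  simp [pick, Colour.shadeAt_eq_iff, h.symm]

/-- The string at the point `p` of an `n`-box whose bottom meets the layer `l` and whose top meets
the layer `l'`. -/
def boxStr {L n : ℕ} (l l' : Fin (L + 1)) (p : Fin (2 * n)) : Fin (L + 1) × Fin n :=
  if h : p.val < n then (l', ⟨p, h⟩) else (l, ⟨2 * n - 1 - p, by omega⟩)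

/-- The region at the interval `j` of such a box. -/
def boxReg {L n : ℕ} (l l' : Fin (L + 1)) (j : Fin (2 * n + 1)) : Gap L n :=
  if h : j.val ≤ n then gap l' ⟨j, by omega⟩ else gap l ⟨2 * n - j, by omega⟩

/-- The regions along the strings of the layers, for the colour `c` of the boxes. -/
def layerSide {L : ℕ} (c : Colour) (b : Bool) (s : Fin (L + 1) × Fin c.n) : Gap L c.n :=
  pick c s.2 b (gap s.1 s.2.castSucc) (gap s.1 s.2.succ)

theorem boxReg_last {L n : ℕ} (l l' : Fin (L + 1)) :
    boxReg (n := n) l l' (Fin.last _) = boxReg l l' 0 := by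
  unfold boxReg
  rw [dif_pos (show ((0 : Fin (2 * n + 1)) : ℕ) ≤ n by simp)]
  split_ifs with h
  · simp only [Fin.val_last] at h
    exact gap_eq _ _ _ _ (by simp; omega) (.inl rfl)
  · exact gap_eq _ _ _ _ (by simp) (.inr (.inl (by simp)))

theorem boxReg_castSucc {L : ℕ} (c : Colour) (l l' : Fin (L + 1)) (p : Fin (2 * c.n)) :
    boxReg l l' p.castSucc = layerSide c (c.shadeAt p) (boxStr l l' p) := by
  have hp := p.isLt
  unfold layerSide boxStr boxReg
  by_cases h : p.val < c.n
  · rw [dif_pos h, dif_pos (by simp; omega), pick_of_even _ _ _ _ _ (by simp)]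
    rfl
  · rw [dif_neg h, pick_of_odd _ _ _ _ _ (by simp only; omega)]
    split_ifs with h'
    · simp only [Fin.val_castSucc] at h'
      exact gap_eq _ _ _ _ (by simp; omega) (.inr (.inr (by simp; omega)))
    · exact gap_eq _ _ _ _ (by simp; omega) (.inl rfl)

theorem boxReg_succ {L : ℕ} (c : Colour) (l l' : Fin (L + 1)) (p : Fin (2 * c.n)) :
    boxReg l l' p.succ = layerSide c (c.shadeAt (p + 1)) (boxStr l l' p) := by
  have hp := p.isLt
  unfold layerSide boxStr boxReg
  by_cases h : p.val < c.n
  · rw [dif_pos h, dif_pos (by simp; omega), pick_of_odd _ _ _ _ _ (by simp; omega)]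
    rfl
  · rw [dif_neg h, pick_of_even _ _ _ _ _ (by simp only; omega), dif_neg (by simp; omega)]
    exact gap_eq _ _ _ _ (by simp; omega) (.inl rfl)

theorem shade_gap {L n : ℕ} (c : Colour) (l : Fin (L + 1)) (k : Fin (n + 1)) :
    c.shadeAt (gap l k).1.2 = c.shadeAt k := by
  rw [gap_val_snd]

theorem shade_boxReg {L n : ℕ} (c : Colour) (l l' : Fin (L + 1)) (j : Fin (2 * n + 1)) :
    c.shadeAt (boxReg l l' j).1.2 = c.shadeAt j := by
  unfold boxReg
  split_ifs with h
  · rw [shade_gap]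
  · rw [shade_gap, Colour.shadeAt_eq_iff]
    simp only
    omega

theorem shade_layerSide {L : ℕ} (c : Colour) (b : Bool) (s : Fin (L + 1) × Fin c.n) :
    c.shadeAt (layerSide c b s).1.2 = b := by
  unfold layerSide pick
  split_ifs with h
  · rw [shade_gap]
    simpa using h
  · rw [shade_gap]
    simp only [Fin.val_succ, Colour.shadeAt_succ]
    cases b <;> simp_all

/-- The point on the bottom (`t = false`) or the top (`t = true`) of a box at the string
number `k`. -/
def boxPt {n : ℕ} (t : Bool) (k : Fin n) : Fin (2 * n) :=
  if t then ⟨k, by omega⟩ else ⟨2 * n - 1 - k, by omega⟩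

theorem boxStr_boxPt {L n : ℕ} (l l' : Fin (L + 1)) (t : Bool) (k : Fin n) :
    boxStr l l' (boxPt t k) = (if t then l' else l, k) := by
  cases t
  · have : ¬ (2 * n - 1 - k.val < n) := by omega
    simp only [boxStr, boxPt, Bool.false_eq_true, if_false, this, dite_false]
    refine Prod.ext rfl (Fin.ext ?_)
    simp only
    omega
  · simp [boxStr, boxPt]

theorem boxPt_boxStr {L n : ℕ} (l l' : Fin (L + 1)) (p : Fin (2 * n)) :
    boxPt (decide (p.val < n)) (boxStr l l' p).2 = p := by
  unfold boxPt boxStr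
  by_cases h : p.val < n
  · simp [h]
  · simp only [h, decide_false, dite_false, Bool.false_eq_true, if_false]
    refine Fin.ext ?_
    simp only
    omega

theorem boxStr_fst {L n : ℕ} (l l' : Fin (L + 1)) (p : Fin (2 * n)) :
    (boxStr l l' p).1 = if p.val < n then l' else l := by
  unfold boxStr
  split_ifs <;> rfl

theorem shadeAt_boxPt (c : Colour) (t : Bool) (k : Fin c.n) :
    c.shadeAt (boxPt t k) = xor (c.shadeAt k) (!t) := by
  cases t
  · have : c.shadeAt (2 * c.n - 1 - k.val) = c.shadeAt (k.val + 1) := by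
      rw [Colour.shadeAt_eq_iff]
      omega
    simp [boxPt, this, Colour.shadeAt_succ]
  · simp [boxPt]

theorem shadeAt_boxStr {L : ℕ} (c : Colour) (l l' : Fin (L + 1)) (p : Fin (2 * c.n)) :
    c.shadeAt (boxStr l l' p).2 = xor (c.shadeAt p) (!decide (p.val < c.n)) := by
  have h := shadeAt_boxPt c (decide (p.val < c.n)) (boxStr l l' p).2
  rw [boxPt_boxStr] at h
  rw [h]
  cases c.shadeAt (boxStr l l' p).2 <;> cases decide (p.val < c.n) <;> rfl

theorem boxReg_boxes {L n : ℕ} (l l' : Fin (L + 1)) (k : Fin (n + 1)) :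
    (∃ j, boxReg l l' j = gap l' k) ∧ ∃ j, boxReg l l' j = gap l k := by
  constructor
  · refine ⟨⟨k, by omega⟩, ?_⟩
    unfold boxReg
    rw [dif_pos (by simp only; omega)]
  · by_cases h : k.val = n
    · refine ⟨⟨n, by omega⟩, ?_⟩
      unfold boxReg
      rw [dif_pos le_rfl]
      exact gap_eq _ _ _ _ h.symm (.inr (.inr rfl))
    · refine ⟨⟨2 * n - k, by omega⟩, ?_⟩
      unfold boxReg
      rw [dif_neg (by simp only; omega)]
      exact gap_eq _ _ _ _ (by simp only; omega) (.inl rfl)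

/-- `m` boxes of the colour `c` stacked upon each other, the box number `0` at the bottom.  The
strings and the gaps in the layers between the boxes are numbered by `Fin (m + 1)`, from the bottom
to the top.  For `m = 0, 1, 2` these are the diagram of `n` parallel strings, the identity tangle and
the multiplication tangle. -/
def stackPre (c : Colour) (m : ℕ) : PreTangle (fun _ : Fin m => c) c where
  Str := Fin (m + 1) × Fin c.n
  Reg := Gap m c.n
  str
    | none => boxStr 0 (Fin.last m)
    | some i => boxStr i.castSucc i.succ
  reg
    | none => boxReg 0 (Fin.last m)
    | some i => boxReg i.castSucc i.succ
  side := layerSide c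
  shade r := c.shadeAt r.1.2

theorem stackPre_card_component (c : Colour) (m : ℕ) (h : c.n ≠ 0) :
    Nat.card (stackPre c m).Component = 1 := by
  have hn : 0 < c.n := Nat.pos_of_ne_zero h
  have key : ∀ i : Fin m, Relation.EqvGen (stackPre c m).Touch (.inl none) (.inl (some i)) := by
    rintro ⟨i, hi⟩
    induction i with
    | zero =>
      refine (stackPre c m).touch_trans none (boxPt false ⟨0, hn⟩) _ (boxPt false ⟨0, hn⟩)
        (.refl _) ?_
      refine (boxStr_boxPt _ _ _ _).trans (.trans ?_ (boxStr_boxPt _ _ _ _).symm)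
      rfl
    | succ i ih =>
      refine (stackPre c m).touch_trans (some ⟨i, by omega⟩) (boxPt true ⟨0, hn⟩) _
        (boxPt false ⟨0, hn⟩) (ih _) ?_
      refine (boxStr_boxPt _ _ _ _).trans (.trans ?_ (boxStr_boxPt _ _ _ _).symm)
      rfl
  refine (stackPre c m).card_component_one key ?_
  rintro ⟨l, k⟩
  induction l using Fin.cases with
  | zero => exact ⟨none, boxPt false k, boxStr_boxPt _ _ _ _⟩
  | succ i => exact ⟨some i, boxPt true k, boxStr_boxPt _ _ _ _⟩

theorem boxPt_of_boxStr {L n : ℕ} {l l' m : Fin (L + 1)} {p : Fin (2 * n)} {k : Fin n}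
    (h : boxStr l l' p = (m, k)) :
    (p.val < n ∧ m = l' ∧ p = boxPt true k) ∨ (¬ p.val < n ∧ m = l ∧ p = boxPt false k) := by
  have h1 := boxPt_boxStr l l' p
  have h2 := boxStr_fst l l' p
  rw [h] at h1 h2
  by_cases hp : p.val < n
  · exact .inl ⟨hp, by simpa [hp] using h2, by simpa [hp] using h1.symm⟩
  · exact .inr ⟨hp, by simpa [hp] using h2, by simpa [hp] using h1.symm⟩

theorem PreTangle.ends_of_two {ι : Type} {col : ι → Colour} {out : Colour}
    (T : PreTangle col out) (s : T.Str)
    (x y : (d : Option ι) × Fin (2 * (discColour col out d).n))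
    (hx : T.str x.1 x.2 = s) (hy : T.str y.1 y.2 = s) (hxy : T.dir x.1 x.2 = !T.dir y.1 y.2)
    (h : ∀ d p, T.str d p = s → x = ⟨d, p⟩ ∨ y = ⟨d, p⟩) :
    (∀ d p, T.str d p ≠ s) ∨
    ∀ b, ∃! x : (d : Option ι) × Fin (2 * (discColour col out d).n),
      T.str x.1 x.2 = s ∧ T.dir x.1 x.2 = b := by
  refine .inr fun b => ?_
  by_cases hb : T.dir x.1 x.2 = b
  · refine ⟨x, ⟨hx, hb⟩, ?_⟩
    rintro ⟨d, p⟩ ⟨h1, h2⟩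
    rcases h d p h1 with h' | h'
    · exact h'.symm
    · subst h'
      simp only at h2
      rw [h2, hb] at hxy
      cases b <;> simp at hxy
  · refine ⟨y, ⟨hy, ?_⟩, ?_⟩
    · rw [hxy] at hb
      cases b <;> simp_all
    · rintro ⟨d, p⟩ ⟨h1, h2⟩
      rcases h d p h1 with h' | h'
      · subst h'
        exact absurd h2 hb
      · exact h'.symm

theorem stackPre_ends (c : Colour) (m : ℕ) (s : Fin (m + 1) × Fin c.n) :
    (∀ d p, (stackPre c m).str d p ≠ s) ∨
    ∀ b, ∃! x : (d : Option (Fin m)) × Fin (2 * (discColour (fun _ : Fin m => c) c d).n),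
      (stackPre c m).str x.1 x.2 = s ∧ (stackPre c m).dir x.1 x.2 = b := by
  obtain ⟨l, k⟩ := s
  have hout : ∀ t, (stackPre c m).dir none (boxPt t k) = xor (c.shadeAt k) t := by
    intro t
    refine (congrArg (fun b => xor b true) (shadeAt_boxPt c t k)).trans ?_
    cases t <;> cases c.shadeAt k <;> rfl
  have hin : ∀ i t, (stackPre c m).dir (some i) (boxPt t k) = xor (c.shadeAt k) (!t) := by
    intro i t
    refine (congrArg (fun b => xor b false) (shadeAt_boxPt c t k)).trans ?_
    cases t <;> cases c.shadeAt k <;> rfl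
  have low : ∃ x : (d : Option (Fin m)) × Fin (2 * (discColour (fun _ : Fin m => c) c d).n),
      (stackPre c m).str x.1 x.2 = (l, k) ∧ (stackPre c m).dir x.1 x.2 = c.shadeAt k ∧
      (∀ p, (stackPre c m).str none p = (l, k) → ¬ p.val < c.n → x = ⟨none, p⟩) ∧
      (∀ i p, (stackPre c m).str (some i) p = (l, k) → p.val < c.n → x = ⟨some i, p⟩) := by
    induction l using Fin.cases with
    | zero =>
      refine ⟨⟨none, boxPt false k⟩, boxStr_boxPt _ _ _ _, (hout _).trans (by simp), ?_, ?_⟩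
      · intro p h hp
        rcases boxPt_of_boxStr h with h' | h'
        · exact absurd h'.1 hp
        · rw [h'.2.2]
      · intro i p h hp
        rcases boxPt_of_boxStr h with h' | h'
        · exact absurd h'.2.1 (Fin.succ_ne_zero i).symm
        · exact absurd hp h'.1
    | succ j =>
      refine ⟨⟨some j, boxPt true k⟩, boxStr_boxPt _ _ _ _, (hin _ _).trans (by simp), ?_, ?_⟩
      · intro p h hp
        rcases boxPt_of_boxStr h with h' | h'
        · exact absurd h'.1 hp
        · exact absurd h'.2.1 (Fin.succ_ne_zero j)
      · intro i p h hp
        rcases boxPt_of_boxStr h with h' | h'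
        · obtain rfl := Fin.succ_injective _ h'.2.1
          rw [h'.2.2]
        · exact absurd hp h'.1
  have upp : ∃ x : (d : Option (Fin m)) × Fin (2 * (discColour (fun _ : Fin m => c) c d).n),
      (stackPre c m).str x.1 x.2 = (l, k) ∧ (stackPre c m).dir x.1 x.2 = !c.shadeAt k ∧
      (∀ p, (stackPre c m).str none p = (l, k) → p.val < c.n → x = ⟨none, p⟩) ∧
      (∀ i p, (stackPre c m).str (some i) p = (l, k) → ¬ p.val < c.n → x = ⟨some i, p⟩) := by
    induction l using Fin.lastCases with
    | last =>
      refine ⟨⟨none, boxPt true k⟩, boxStr_boxPt _ _ _ _, (hout _).trans (by simp), ?_, ?_⟩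
      · intro p h hp
        rcases boxPt_of_boxStr h with h' | h'
        · rw [h'.2.2]
        · exact absurd hp h'.1
      · intro i p h hp
        rcases boxPt_of_boxStr h with h' | h'
        · exact absurd h'.1 hp
        · exact absurd h'.2.1 (Fin.castSucc_lt_last i).ne'
    | cast j =>
      refine ⟨⟨some j, boxPt false k⟩, boxStr_boxPt _ _ _ _, (hin _ _).trans (by simp), ?_, ?_⟩
      · intro p h hp
        rcases boxPt_of_boxStr h with h' | h'
        · exact absurd h'.2.1 (Fin.castSucc_lt_last j).ne
        · exact absurd hp h'.1
      · intro i p h hp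
        rcases boxPt_of_boxStr h with h' | h'
        · exact absurd h'.1 hp
        · obtain rfl := Fin.castSucc_injective _ h'.2.1
          rw [h'.2.2]
  obtain ⟨x, hx1, hx2, hx3, hx4⟩ := low
  obtain ⟨y, hy1, hy2, hy3, hy4⟩ := upp
  refine (stackPre c m).ends_of_two (l, k) x y hx1 hy1 (by rw [hx2, hy2, Bool.not_not]) ?_
  rintro (_ | i) p h
  · by_cases hp : p.val < c.n
    · exact .inr (hy3 p h hp)
    · exact .inl (hx3 p h hp)
  · by_cases hp : p.val < c.n
    · exact .inl (hx4 i p h hp)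
    · exact .inr (hy4 i p h hp)

/-- See `stackPre`. -/
def stack (c : Colour) (m : ℕ) : Tangle (fun _ : Fin m => c) c where
  toPreTangle := stackPre c m
  finite_str := inferInstanceAs (Finite (Fin (m + 1) × Fin c.n))
  finite_reg := inferInstanceAs (Finite (Gap m c.n))
  reg_last := by
    rintro (_ | i) <;> exact boxReg_last _ _
  reg_before := by
    rintro (_ | i) p <;> exact boxReg_castSucc _ _ _ _
  reg_after := by
    rintro (_ | i) p <;> exact boxReg_succ _ _ _ _
  shade_reg := by
    rintro (_ | i) j <;> exact shade_boxReg _ _ _ _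
  shade_side := shade_layerSide c
  ends := stackPre_ends c m
  connected := by
    refine (stackPre c m).connected_of ?_ ?_ ?_
    · intro i
      refine ⟨0, 0, ?_⟩
      change boxReg i.castSucc i.succ 0 = boxReg 0 (Fin.last m) 0
      unfold boxReg
      rw [dif_pos (by simp), dif_pos (by simp)]
      exact gap_eq _ _ _ _ rfl (.inr (.inl (by simp)))
    · rintro ⟨l, k⟩
      induction l using Fin.cases with
      | zero => exact ⟨none, boxPt false k, boxStr_boxPt _ _ _ _⟩
      | succ i => exact ⟨some i, boxPt true k, boxStr_boxPt _ _ _ _⟩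
    · intro r
      obtain ⟨l, k, rfl⟩ : ∃ l k, gap l k = r := ⟨_, _, gap_val r⟩
      induction l using Fin.cases with
      | zero => exact ⟨none, (boxReg_boxes _ _ _).2⟩
      | succ i => exact ⟨some i, (boxReg_boxes _ _ _).1⟩
  euler := by
    obtain ⟨n, b⟩ := c
    cases n with
    | zero =>
      have h : IsEmpty (stackPre ⟨0, b⟩ m).Str :=
        inferInstanceAs (IsEmpty (Fin (m + 1) × Fin 0))
      rw [PreTangle.card_component_of_isEmpty _ h, show Nat.card (stackPre ⟨0, b⟩ m).Reg = 1 from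
        card_gap_zero m]
      simp
      omega
    | succ n =>
      rw [stackPre_card_component _ _ (by simp), show Nat.card (stackPre ⟨n + 1, b⟩ m).Reg = _ from
        card_gap_succ m n]
      simp
      ring

/-- The diagram in the box space of colour `(m + 2, ±)` with `m` parallel strings on the left, and
a cap and a cup on the right: the last two points of the top are connected, and so are the last
two points of the bottom. -/
def cupCapPre (m : ℕ) (b : Bool) : PreTangle (Fin.elim0 : Fin 0 → Colour) ⟨m + 2, b⟩ where
  Str := Fin m ⊕ Bool
  Reg := Fin (m + 1) ⊕ Bool
  str
    | none => fun (p : Fin (2 * (m + 2))) =>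
      if h : p.val < m then .inl ⟨p, h⟩
      else if _ : p.val < m + 2 then .inr true
      else if _ : p.val < m + 4 then .inr false
      else .inl ⟨2 * m + 3 - p, by omega⟩
    | some i => i.elim0
  reg
    | none => fun (j : Fin (2 * (m + 2) + 1)) =>
      if h : j.val ≤ m then .inl ⟨j, by omega⟩
      else if _ : j.val = m + 1 then .inr true
      else if _ : j.val = m + 2 then .inl (Fin.last m)
      else if _ : j.val = m + 3 then .inr false
      else .inl ⟨2 * m + 4 - j, by omega⟩
    | some i => i.elim0
  side s
    | .inl k => pick ⟨m + 2, b⟩ k s (.inl k.castSucc) (.inl k.succ)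
    | .inr t => pick ⟨m + 2, b⟩ m s (.inl (Fin.last m)) (.inr t)
  shade
    | .inl k => (Colour.mk (m + 2) b).shadeAt k
    | .inr _ => (Colour.mk (m + 2) b).shadeAt (m + 1)

/-- See `cupCapPre`. -/
def cupCap (m : ℕ) (b : Bool) : Tangle (Fin.elim0 : Fin 0 → Colour) ⟨m + 2, b⟩ where
  toPreTangle := cupCapPre m b
  finite_str := inferInstanceAs (Finite (Fin m ⊕ Bool))
  finite_reg := inferInstanceAs (Finite (Fin (m + 1) ⊕ Bool))
  reg_last := by
    rintro (_ | i)
    · have h1 : ¬ (2 * (m + 2) ≤ m) := by omega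
      have h2 : ¬ (2 * (m + 2) = m + 1) := by omega
      have h3 : ¬ (2 * (m + 2) = m + 2) := by omega
      have h4 : ¬ (2 * (m + 2) = m + 3) := by omega
      simp only [cupCapPre, Fin.val_last, Fin.val_zero, discColour, Option.elim, h1, h2, h3, h4,
        dite_false, Nat.zero_le]
      congr 2
      omega
    · exact i.elim0
  reg_before := by
    rintro (_ | i) p
    · change Fin (2 * (m + 2)) at p
      have hp := p.isLt
      simp only [cupCapPre, discColour, Option.elim, Fin.val_castSucc]
      by_cases h1 : p.val < m
      · rw [dif_pos h1, dif_pos (by omega)]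
        simp only
        rw [pick_of_even _ _ _ _ _ (by simp)]
        rfl
      by_cases h2 : p.val < m + 2
      · rw [dif_neg h1, dif_pos h2]
        simp only
        by_cases h3 : p.val = m
        · rw [dif_pos (by omega), pick_of_even _ _ _ _ _ (by omega)]
          simp [Fin.ext_iff, h3]
        · rw [dif_neg (by omega), dif_pos (by omega), pick_of_odd _ _ _ _ _ (by omega)]
      by_cases h3 : p.val < m + 4
      · rw [dif_neg h1, dif_neg h2, dif_pos h3]
        simp only
        rw [dif_neg (by omega), dif_neg (by omega)]
        by_cases h4 : p.val = m + 2
        · rw [dif_pos (by omega), pick_of_even _ _ _ _ _ (by omega)]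
        · rw [dif_neg (by omega), dif_pos (by omega), pick_of_odd _ _ _ _ _ (by omega)]
      · rw [dif_neg h1, dif_neg h2, dif_neg h3]
        simp only
        rw [dif_neg (by omega), dif_neg (by omega), dif_neg (by omega), dif_neg (by omega),
          pick_of_odd _ _ _ _ _ (by omega)]
        congr 1
        apply Fin.ext
        simp only [Fin.val_succ]
        omega
    · exact i.elim0
  reg_after := by
    rintro (_ | i) p
    · change Fin (2 * (m + 2)) at p
      have hp := p.isLt
      simp only [cupCapPre, discColour, Option.elim, Fin.val_succ]
      by_cases h1 : p.val < m
      · rw [dif_pos h1, dif_pos (by omega)]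
        simp only
        rw [pick_of_odd _ _ _ _ _ (by omega)]
        rfl
      by_cases h2 : p.val < m + 2
      · rw [dif_neg h1, dif_pos h2, dif_neg (by omega)]
        simp only
        by_cases h3 : p.val = m
        · rw [dif_pos (by omega), pick_of_odd _ _ _ _ _ (by omega)]
        · rw [dif_neg (by omega), dif_pos (by omega), pick_of_even _ _ _ _ _ (by omega)]
      by_cases h3 : p.val < m + 4
      · rw [dif_neg h1, dif_neg h2, dif_pos h3]
        simp only
        rw [dif_neg (by omega), dif_neg (by omega), dif_neg (by omega)]
        by_cases h4 : p.val = m + 2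
        · rw [dif_pos (by omega), pick_of_odd _ _ _ _ _ (by omega)]
        · rw [dif_neg (by omega), pick_of_even _ _ _ _ _ (by omega)]
          congr 1
          apply Fin.ext
          simp only [Fin.val_last]
          omega
      · rw [dif_neg h1, dif_neg h2, dif_neg h3]
        simp only
        rw [dif_neg (by omega), dif_neg (by omega), dif_neg (by omega), dif_neg (by omega),
          pick_of_even _ _ _ _ _ (by omega)]
        congr 1
        apply Fin.ext
        simp only [Fin.val_castSucc]
        omega
    · exact i.elim0
  shade_reg := by
    rintro (_ | i) j
    · change Fin (2 * (m + 2) + 1) at j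
      have hj := j.isLt
      simp only [cupCapPre, discColour, Option.elim]
      split_ifs
      · rfl
      all_goals
        simp only [Colour.shadeAt_eq_iff, Fin.val_last]
        omega
    · exact i.elim0
  shade_side := by
    rintro s (k | t)
    · simp only [cupCapPre, pick]
      split_ifs with h
      · simpa using h
      · simp only [Fin.val_succ, Colour.shadeAt_succ]
        cases s <;> simp_all
    · simp only [cupCapPre, pick]
      split_ifs with h
      · simpa using h
      · simp only [Colour.shadeAt_succ]
        cases s <;> simp_all
  ends := by
    have key : ∀ (s) (x y : Fin (2 * (m + 2))), (cupCapPre m b).str none x = s →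
        (cupCapPre m b).str none y = s → x.val % 2 ≠ y.val % 2 →
        (∀ p : Fin (2 * (m + 2)), (cupCapPre m b).str none p = s → x = p ∨ y = p) →
        (∀ d p, (cupCapPre m b).str d p ≠ s) ∨ ∀ a, ∃! z : (d : Option (Fin 0)) ×
          Fin (2 * (discColour (Fin.elim0 : Fin 0 → Colour) ⟨m + 2, b⟩ d).n),
        (cupCapPre m b).str z.1 z.2 = s ∧ (cupCapPre m b).dir z.1 z.2 = a := by
      intro s x y hx hy hxy h
      refine (cupCapPre m b).ends_of_two s ⟨none, x⟩ ⟨none, y⟩ hx hy ?_ ?_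
      · simp only [PreTangle.dir, discColour, Option.elim, Option.isNone_none]
        have h1 : (Colour.mk (m + 2) b).shadeAt x = (Colour.mk (m + 2) b).shadeAt (y + 1) := by
          rw [Colour.shadeAt_eq_iff]
          omega
        rw [h1, Colour.shadeAt_succ]
        cases (Colour.mk (m + 2) b).shadeAt y <;> rfl
      · rintro (_ | i) p hp
        · rcases h p hp with rfl | rfl
          · exact .inl rfl
          · exact .inr rfl
        · exact i.elim0
    rintro (k | t)
    · have hk := k.isLt
      refine key _ ⟨k, by omega⟩ ⟨2 * m + 3 - k, by omega⟩ ?_ ?_ ?_ ?_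
      · simp [cupCapPre]
      · simp only [cupCapPre]
        rw [dif_neg (by omega), dif_neg (by omega), dif_neg (by omega)]
        congr 1
        apply Fin.ext
        simp only
        omega
      · simp only
        omega
      · intro p hp
        have := p.isLt
        simp only [cupCapPre] at hp
        simp only [Fin.ext_iff]
        split_ifs at hp with h1 h2 h3
        · have := congrArg Fin.val (Sum.inl_injective hp)
          simp only at this
          omega
        · have := congrArg Fin.val (Sum.inl_injective hp)
          simp only at this
          omega
    · cases t
      · refine key _ ⟨m + 2, by omega⟩ ⟨m + 3, by omega⟩ ?_ ?_ ?_ ?_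
        · simp [cupCapPre]
        · simp [cupCapPre]
        · simp only
          omega
        · intro p hp
          have := p.isLt
          simp only [cupCapPre] at hp
          simp only [Fin.ext_iff]
          split_ifs at hp with h1 h2 h3
          · simp at hp
          · omega
      · refine key _ ⟨m, by omega⟩ ⟨m + 1, by omega⟩ ?_ ?_ ?_ ?_
        · simp [cupCapPre]
        · simp [cupCapPre]
        · simp only
          omega
        · intro p hp
          have := p.isLt
          simp only [cupCapPre] at hp
          simp only [Fin.ext_iff]
          split_ifs at hp with h1 h2 h3
          · omega
          · simp at hp
  connected := by
    refine (cupCapPre m b).connected_of (fun i => i.elim0) ?_ ?_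
    · rintro (k | t)
      · exact ⟨none, (⟨k, by have := k.isLt; omega⟩ : Fin (2 * (m + 2))), by simp [cupCapPre]⟩
      · cases t
        · exact ⟨none, (⟨m + 2, by omega⟩ : Fin (2 * (m + 2))), by simp [cupCapPre]⟩
        · exact ⟨none, (⟨m, by omega⟩ : Fin (2 * (m + 2))), by simp [cupCapPre]⟩
    · rintro (k | t)
      · refine ⟨none, (⟨k, by have := k.isLt; omega⟩ : Fin (2 * (m + 2) + 1)), ?_⟩
        have := k.isLt
        simp only [cupCapPre]
        rw [dif_pos (by omega)]
      · cases t
        · exact ⟨none, (⟨m + 3, by omega⟩ : Fin (2 * (m + 2) + 1)), by simp [cupCapPre]⟩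
        · exact ⟨none, (⟨m + 1, by omega⟩ : Fin (2 * (m + 2) + 1)), by simp [cupCapPre]⟩
  euler := by
    rw [PreTangle.card_component_one (cupCapPre m b) (fun i => i.elim0)]
    · have : Nat.card (cupCapPre m b).Reg = m + 3 := by
        change Nat.card (Fin (m + 1) ⊕ Bool) = m + 3
        simp
      rw [this]
      simp
      omega
    · rintro (k | t)
      · exact ⟨none, (⟨k, by have := k.isLt; omega⟩ : Fin (2 * (m + 2))), by simp [cupCapPre]⟩
      · cases t
        · exact ⟨none, (⟨m + 2, by omega⟩ : Fin (2 * (m + 2))), by simp [cupCapPre]⟩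
        · exact ⟨none, (⟨m, by omega⟩ : Fin (2 * (m + 2))), by simp [cupCapPre]⟩

/-- The number of the string at the point `p` of an `n`-box, from left to right. -/
def foldStr {n : ℕ} (p : Fin (2 * n)) : Fin n :=
  if h : p.val < n then ⟨p, h⟩ else ⟨2 * n - 1 - p, by omega⟩

/-- The number of the gap at the interval `j` of an `n`-box, from left to right. -/
def foldReg {n : ℕ} (j : Fin (2 * n + 1)) : Fin (n + 1) :=
  if h : j.val ≤ n then ⟨j, by omega⟩ else ⟨2 * n - j, by omega⟩

theorem foldStr_val {n : ℕ} (p : Fin (2 * n)) :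
    (foldStr p).val = if p.val < n then p.val else 2 * n - 1 - p := by
  unfold foldStr
  split_ifs <;> rfl

theorem foldReg_val {n : ℕ} (j : Fin (2 * n + 1)) :
    (foldReg j).val = if j.val ≤ n then j.val else 2 * n - j := by
  unfold foldReg
  split_ifs <;> rfl

theorem foldReg_last {n : ℕ} : foldReg (Fin.last (2 * n)) = foldReg 0 := by
  apply Fin.ext
  rw [foldReg_val, foldReg_val, if_pos (show (0 : Fin (2 * n + 1)).val ≤ n by simp)]
  split_ifs with h <;> simp only [Fin.val_last, Fin.val_zero] at h ⊢ <;> omega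

/-- The regions along the string number `k`. -/
def foldSide (c : Colour) (s : Bool) (k : Fin c.n) : Fin (c.n + 1) := pick c k s k.castSucc k.succ

theorem foldReg_castSucc (c : Colour) (p : Fin (2 * c.n)) :
    foldReg p.castSucc = foldSide c (c.shadeAt p) (foldStr p) := by
  have hp := p.isLt
  unfold foldSide
  by_cases h : p.val < c.n
  · rw [pick_of_even _ _ _ _ _ (by rw [foldStr_val, if_pos h])]
    apply Fin.ext
    rw [foldReg_val, Fin.val_castSucc, Fin.val_castSucc, foldStr_val, if_pos h, if_pos (by omega)]
  · rw [pick_of_odd _ _ _ _ _ (by rw [foldStr_val, if_neg h]; omega)]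
    apply Fin.ext
    rw [foldReg_val, Fin.val_castSucc, Fin.val_succ, foldStr_val, if_neg h]
    split_ifs <;> omega

theorem foldReg_succ (c : Colour) (p : Fin (2 * c.n)) :
    foldReg p.succ = foldSide c (c.shadeAt (p + 1)) (foldStr p) := by
  have hp := p.isLt
  unfold foldSide
  by_cases h : p.val < c.n
  · rw [pick_of_odd _ _ _ _ _ (by rw [foldStr_val, if_pos h]; omega)]
    apply Fin.ext
    rw [foldReg_val, Fin.val_succ, Fin.val_succ, foldStr_val, if_pos h, if_pos (by omega)]
  · rw [pick_of_even _ _ _ _ _ (by rw [foldStr_val, if_neg h]; omega)]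
    apply Fin.ext
    rw [foldReg_val, Fin.val_succ, Fin.val_castSucc, foldStr_val, if_neg h, if_neg (by omega)]
    omega

theorem shade_foldReg (c : Colour) (j : Fin (2 * c.n + 1)) :
    c.shadeAt (foldReg j) = c.shadeAt j := by
  rw [Colour.shadeAt_eq_iff, foldReg_val]
  split_ifs <;> omega

theorem shade_foldSide (c : Colour) (s : Bool) (k : Fin c.n) :
    c.shadeAt (foldSide c s k) = s := by
  unfold foldSide pick
  split_ifs with h
  · exact h
  · rw [Fin.val_succ, Colour.shadeAt_succ]
    cases s <;> simp_all

/-- The tangle of the Markov trace: the string number `k` on the top of the box is connected with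
the string number `k` on its bottom, around the right-hand side of the box. -/
def tracePre (c : Colour) : PreTangle (fun _ : Unit => c) ⟨0, c.shaded⟩ where
  Str := Fin c.n
  Reg := Fin (c.n + 1)
  str
    | none => fun (p : Fin (2 * 0)) => p.elim0
    | some _ => foldStr
  reg
    | none => fun _ => 0
    | some _ => foldReg
  side := foldSide c
  shade k := c.shadeAt (Fin.val k)

/-- See `tracePre`. -/
def traceTangle (c : Colour) : Tangle (fun _ : Unit => c) ⟨0, c.shaded⟩ where
  toPreTangle := tracePre c
  finite_str := inferInstanceAs (Finite (Fin c.n))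
  finite_reg := inferInstanceAs (Finite (Fin (c.n + 1)))
  reg_last := by
    rintro (_ | i)
    · rfl
    · exact foldReg_last
  reg_before := by
    rintro (_ | i) p
    · exact Fin.elim0 p
    · exact foldReg_castSucc c p
  reg_after := by
    rintro (_ | i) p
    · exact Fin.elim0 p
    · exact foldReg_succ c p
  shade_reg := by
    rintro (_ | i) j
    · have : j.val = 0 := by have := j.isLt; simp only [discColour, Option.elim] at this; omega
      rw [this]
      exact (c.shadeAt_zero).trans (Colour.shadeAt_zero ⟨0, c.shaded⟩).symm
    · exact shade_foldReg c j
  shade_side := shade_foldSide c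
  ends := by
    intro k
    change Fin c.n at k
    have hk := k.isLt
    refine (tracePre c).ends_of_two k ⟨some (), (⟨k, by omega⟩ : Fin (2 * c.n))⟩
      ⟨some (), (⟨2 * c.n - 1 - k, by omega⟩ : Fin (2 * c.n))⟩ ?_ ?_ ?_ ?_
    · exact Fin.ext ((foldStr_val _).trans (if_pos hk))
    · refine Fin.ext ((foldStr_val _).trans ((if_neg ?_).trans ?_))
      · simp only
        omega
      · simp only
        omega
    · simp only [PreTangle.dir, discColour, Option.elim, Option.isNone_some, Bool.xor_false]
      rw [← Colour.shadeAt_succ, Colour.shadeAt_eq_iff]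
      omega
    · rintro (_ | i) p hp
      · exact Fin.elim0 p
      · change Fin (2 * c.n) at p
        have := p.isLt
        have h' : (foldStr p).val = k.val := congrArg Fin.val hp
        rw [foldStr_val] at h'
        by_cases h : p.val < c.n
        · rw [if_pos h] at h'
          refine .inl ?_
          congr 1
          exact Fin.ext h'.symm
        · rw [if_neg h] at h'
          refine .inr ?_
          congr 1
          apply Fin.ext
          simp only
          omega
  connected := by
    refine (tracePre c).connected_of ?_ ?_ ?_
    · rintro i
      exact ⟨(0 : Fin (2 * c.n + 1)), 0, by simp [tracePre, foldReg]⟩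
    · intro k
      change Fin c.n at k
      exact ⟨some (), (⟨k, by omega⟩ : Fin (2 * c.n)), by simp [tracePre, foldStr]⟩
    · intro k
      change Fin (c.n + 1) at k
      refine ⟨some (), (⟨k, by omega⟩ : Fin (2 * c.n + 1)), ?_⟩
      exact Fin.ext ((foldReg_val _).trans (if_pos (by simp only; omega)))
  euler := by
    rw [PreTangle.card_component (tracePre c) 2
      (Sum.elim (fun d => if d = none then 0 else 1) fun _ => 1)
      (fun k => if k = 0 then .inl none else .inl (some ()))]
    · have : Nat.card (tracePre c).Reg = c.n + 1 := by
        change Nat.card (Fin (c.n + 1)) = c.n + 1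
        simp
      rw [this]
      simp
      omega
    · rintro (_ | i) p
      · exact Fin.elim0 p
      · rfl
    · intro k
      fin_cases k <;> rfl
    · rintro ((_ | i) | k)
      · exact .refl _
      · exact .refl _
      · change Fin c.n at k
        have h : (tracePre c).str (some ()) (⟨k, by omega⟩ : Fin (2 * c.n)) = k := by
          simp [tracePre, foldStr]
        have h' := PreTangle.Touch.mk (T := tracePre c) (some ()) (⟨k, by omega⟩ : Fin (2 * c.n))
        rw [h] at h'
        exact .rel _ _ h'

/-- The string at the point `p` of an `n + 1`-box that consists of an `n`-box with one layer of
strings below and one above, and a further vertical string `none` on the right. -/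
def inclStr {n : ℕ} (p : Fin (2 * (n + 1))) : Option (Fin 2 × Fin n) :=
  if h : p.val < n then some (1, ⟨p, h⟩)
  else if _ : p.val < n + 2 then none
  else some (0, ⟨2 * n + 1 - p, by omega⟩)

/-- The region at the interval `j` of such a box; `none` is the region on the right. -/
def inclReg {n : ℕ} (j : Fin (2 * (n + 1) + 1)) : Option (Gap 1 n) :=
  if h : j.val ≤ n then some (gap 1 ⟨j, by omega⟩)
  else if _ : j.val = n + 1 then none
  else some (gap 0 ⟨2 * n + 2 - j, by omega⟩)

/-- The regions along the strings of such a box. -/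
def inclSide (c : Colour) (s : Bool) : Option (Fin 2 × Fin c.n) → Option (Gap 1 c.n)
  | some k => some (layerSide c s k)
  | none => pick c c.n s (some (gap 0 (Fin.last _))) none

theorem inclReg_last {n : ℕ} : inclReg (Fin.last (2 * (n + 1))) = inclReg 0 := by
  unfold inclReg
  rw [dif_neg (by simp only [Fin.val_last]; omega), dif_neg (by simp only [Fin.val_last]; omega),
    dif_pos (by simp)]
  congr 1
  exact gap_eq _ _ _ _ (by simp only [Fin.val_last, Fin.val_zero]; omega)
    (.inr (.inl (by simp only [Fin.val_last]; omega)))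

theorem inclReg_castSucc (c : Colour) (p : Fin (2 * (c.n + 1))) :
    inclReg p.castSucc = inclSide c (c.shadeAt p) (inclStr p) := by
  have hp := p.isLt
  unfold inclReg inclStr
  simp only [Fin.val_castSucc]
  by_cases h1 : p.val < c.n
  · rw [dif_pos h1, dif_pos (by omega)]
    simp only [inclSide, layerSide]
    rw [pick_of_even _ _ _ _ _ (by simp)]
    rfl
  by_cases h2 : p.val < c.n + 2
  · rw [dif_neg h1, dif_pos h2]
    simp only [inclSide]
    by_cases h3 : p.val = c.n
    · rw [dif_pos (by omega), pick_of_even _ _ _ _ _ (by omega)]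
      congr 1
      exact gap_eq _ _ _ _ (by simp [h3]) (.inr (.inr h3))
    · rw [dif_neg (by omega), dif_pos (by omega), pick_of_odd _ _ _ _ _ (by omega)]
  · rw [dif_neg h1, dif_neg h2, dif_neg (by omega), dif_neg (by omega)]
    simp only [inclSide, layerSide]
    rw [pick_of_odd _ _ _ _ _ (by omega)]
    congr 1
    exact gap_eq _ _ _ _ (by simp only [Fin.val_succ]; omega) (.inl rfl)

theorem inclReg_succ (c : Colour) (p : Fin (2 * (c.n + 1))) :
    inclReg p.succ = inclSide c (c.shadeAt (p + 1)) (inclStr p) := by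
  have hp := p.isLt
  unfold inclReg inclStr
  simp only [Fin.val_succ]
  by_cases h1 : p.val < c.n
  · rw [dif_pos h1, dif_pos (by omega)]
    simp only [inclSide, layerSide]
    rw [pick_of_odd _ _ _ _ _ (by omega)]
    rfl
  by_cases h2 : p.val < c.n + 2
  · rw [dif_neg h1, dif_pos h2, dif_neg (by omega)]
    simp only [inclSide]
    by_cases h3 : p.val = c.n
    · rw [dif_pos (by omega), pick_of_odd _ _ _ _ _ (by omega)]
    · rw [dif_neg (by omega), pick_of_even _ _ _ _ _ (by omega)]
      congr 1
      exact gap_eq _ _ _ _ (by simp only [Fin.val_last]; omega) (.inl rfl)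
  · rw [dif_neg h1, dif_neg h2, dif_neg (by omega), dif_neg (by omega)]
    simp only [inclSide, layerSide]
    rw [pick_of_even _ _ _ _ _ (by omega)]
    congr 1
    exact gap_eq _ _ _ _ (by simp only [Fin.val_castSucc]; omega) (.inl rfl)

/-- The shading of the regions of such a box. -/
def inclShade (c : Colour) : Option (Gap 1 c.n) → Bool
  | some k => c.shadeAt k.1.2
  | none => c.shadeAt (c.n + 1)

theorem inclShade_inclReg (c : Colour) (j : Fin (2 * (c.n + 1) + 1)) :
    inclShade c (inclReg j) = c.shadeAt j := by
  have hj := j.isLt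
  unfold inclReg
  by_cases h1 : j.val ≤ c.n
  · rw [dif_pos h1]
    simp only [inclShade, gap_val_snd]
  by_cases h2 : j.val = c.n + 1
  · rw [dif_neg h1, dif_pos h2, h2]
    rfl
  · rw [dif_neg h1, dif_neg h2]
    simp only [inclShade, gap_val_snd, Colour.shadeAt_eq_iff]
    omega

theorem inclShade_inclSide (c : Colour) (s : Bool) (k : Option (Fin 2 × Fin c.n)) :
    inclShade c (inclSide c s k) = s := by
  rcases k with _ | k
  · simp only [inclSide, pick]
    split_ifs with h
    · simpa [inclShade, gap_val_snd] using h
    · simp only [inclShade, Colour.shadeAt_succ]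
      cases s <;> simp_all
  · exact shade_layerSide c s k

/-- The tangle that adds a vertical string on the right of a box. -/
def inclPre (c : Colour) : PreTangle (fun _ : Unit => c) ⟨c.n + 1, c.shaded⟩ where
  Str := Option (Fin 2 × Fin c.n)
  Reg := Option (Gap 1 c.n)
  str
    | none => inclStr
    | some _ => fun p => some (boxStr 0 1 p)
  reg
    | none => inclReg
    | some _ => fun j => some (boxReg 0 1 j)
  side := inclSide c
  shade := inclShade c

/-- See `inclPre`. -/
def inclTangle (c : Colour) : Tangle (fun _ : Unit => c) ⟨c.n + 1, c.shaded⟩ where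
  toPreTangle := inclPre c
  finite_str := inferInstanceAs (Finite (Option (Fin 2 × Fin c.n)))
  finite_reg := inferInstanceAs (Finite (Option (Gap 1 c.n)))
  reg_last := by
    rintro (_ | i)
    · exact inclReg_last
    · exact congrArg some (boxReg_last _ _)
  reg_before := by
    rintro (_ | i) p
    · exact inclReg_castSucc c p
    · exact congrArg some (boxReg_castSucc _ _ _ _)
  reg_after := by
    rintro (_ | i) p
    · exact inclReg_succ c p
    · exact congrArg some (boxReg_succ _ _ _ _)
  shade_reg := by
    rintro (_ | i) j
    · exact inclShade_inclReg c j
    · exact shade_boxReg _ _ _ _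
  shade_side := inclShade_inclSide c
  ends := by
    have hd1 : ∀ p : Fin (2 * (c.n + 1)), (inclPre c).dir none p = !c.shadeAt p := by
      intro p
      exact Bool.xor_true _
    have hd2 : ∀ i, ∀ p : Fin (2 * c.n), (inclPre c).dir (some i) p = c.shadeAt p := by
      intro i p
      exact Bool.xor_false _
    rintro (_ | ⟨l, k⟩)
    · refine (inclPre c).ends_of_two none ⟨none, (⟨c.n, by omega⟩ : Fin (2 * (c.n + 1)))⟩
        ⟨none, (⟨c.n + 1, by omega⟩ : Fin (2 * (c.n + 1)))⟩ ?_ ?_ ?_ ?_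
      · simp [inclPre, inclStr]
      · simp [inclPre, inclStr]
      · simp only [hd1, Colour.shadeAt_succ, Bool.not_not]
      · rintro (_ | i) p hp
        · change Fin (2 * (c.n + 1)) at p
          change inclStr p = _ at hp
          unfold inclStr at hp
          split_ifs at hp with h1 h2
          by_cases h3 : p.val = c.n
          · refine .inl ?_
            congr 1
            exact Fin.ext h3.symm
          · refine .inr ?_
            congr 1
            apply Fin.ext
            simp only
            omega
        · exact absurd hp (by simp [inclPre])
    · have hk := k.isLt
      have hl : l = 0 ∨ l = 1 := by omega
      rcases hl with rfl | rfl
      · refine (inclPre c).ends_of_two (some (0, k))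
          ⟨none, (⟨2 * c.n + 1 - k, by omega⟩ : Fin (2 * (c.n + 1)))⟩
          ⟨some (), (boxPt false k : Fin (2 * c.n))⟩ ?_ ?_ ?_ ?_
        · change inclStr ⟨2 * c.n + 1 - k, _⟩ = _
          unfold inclStr
          rw [dif_neg (by simp only; omega), dif_neg (by simp only; omega)]
          congr 2
          apply Fin.ext
          simp only
          omega
        · exact congrArg some (boxStr_boxPt 0 1 false k)
        · simp only [hd1, hd2, shadeAt_boxPt]
          have : c.shadeAt (2 * c.n + 1 - k.val) = c.shadeAt (k.val + 1) := by
            rw [Colour.shadeAt_eq_iff]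
            omega
          rw [this, Colour.shadeAt_succ]
          cases c.shadeAt k <;> rfl
        · rintro (_ | i) p hp
          · change Fin (2 * (c.n + 1)) at p
            have := p.isLt
            change inclStr p = _ at hp
            unfold inclStr at hp
            split_ifs at hp with h1 h2
            · simp at hp
            · simp only [Option.some.injEq, Prod.mk.injEq, Fin.ext_iff, true_and] at hp
              refine .inl ?_
              congr 1
              apply Fin.ext
              simp only
              omega
          · rcases boxPt_of_boxStr (Option.some_injective _ hp) with h | h
            · exact absurd h.2.1 (by decide)
            · refine .inr ?_
              rw [h.2.2]
      · refine (inclPre c).ends_of_two (some (1, k))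
          ⟨none, (⟨k, by omega⟩ : Fin (2 * (c.n + 1)))⟩
          ⟨some (), (boxPt true k : Fin (2 * c.n))⟩ ?_ ?_ ?_ ?_
        · simp [inclPre, inclStr]
        · exact congrArg some (boxStr_boxPt 0 1 true k)
        · simp only [hd1, hd2, shadeAt_boxPt]
          cases c.shadeAt k <;> rfl
        · rintro (_ | i) p hp
          · change Fin (2 * (c.n + 1)) at p
            have := p.isLt
            change inclStr p = _ at hp
            unfold inclStr at hp
            split_ifs at hp with h1 h2
            · simp only [Option.some.injEq, Prod.mk.injEq, Fin.ext_iff, true_and] at hp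
              refine .inl ?_
              congr 1
              exact Fin.ext hp.symm
            · simp at hp
          · rcases boxPt_of_boxStr (Option.some_injective _ hp) with h | h
            · refine .inr ?_
              rw [h.2.2]
            · exact absurd h.2.1 (by decide)
  connected := by
    refine (inclPre c).connected_of ?_ ?_ ?_
    · intro i
      refine ⟨(0 : Fin (2 * c.n + 1)), (0 : Fin (2 * (c.n + 1) + 1)), ?_⟩
      simp [inclPre, inclReg, boxReg]
    · rintro (_ | ⟨l, k⟩)
      · exact ⟨none, (⟨c.n, by omega⟩ : Fin (2 * (c.n + 1))), by simp [inclPre, inclStr]⟩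
      · have hl : l = 0 ∨ l = 1 := by omega
        rcases hl with rfl | rfl
        · exact ⟨some (), _, congrArg some (boxStr_boxPt 0 1 false k)⟩
        · exact ⟨some (), _, congrArg some (boxStr_boxPt 0 1 true k)⟩
    · rintro (_ | r)
      · exact ⟨none, (⟨c.n + 1, by omega⟩ : Fin (2 * (c.n + 1) + 1)), by simp [inclPre, inclReg]⟩
      · obtain ⟨l, k, rfl⟩ : ∃ l k, gap l k = r := ⟨_, _, gap_val r⟩
        have hl : l = 0 ∨ l = 1 := by fin_cases l <;> simp
        obtain ⟨⟨j1, h1⟩, ⟨j0, h0⟩⟩ := boxReg_boxes (0 : Fin 2) 1 k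
        rcases hl with rfl | rfl
        · exact ⟨some (), j0, congrArg some h0⟩
        · exact ⟨some (), j1, congrArg some h1⟩
  euler := by
    by_cases hn : c.n = 0
    · have hr : Nat.card (inclPre c).Reg = 2 := by
        change Nat.card (Option (Gap 1 c.n)) = 2
        rw [hn, Finite.card_option, card_gap_zero]
      rw [hr, PreTangle.card_component (inclPre c) 2
        (Sum.elim (fun d => if d = none then 0 else 1) fun _ => 0)
        (fun k => if k = 0 then .inl none else .inl (some ()))]
      · simp [hn]
      · rintro (_ | i) p
        · rfl
        · change Fin (2 * c.n) at p
          exact absurd p.isLt (by omega)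
      · intro k
        fin_cases k <;> rfl
      · rintro ((_ | i) | (_ | k))
        · exact .refl _
        · exact .refl _
        · have h : (inclPre c).str none (⟨c.n, by omega⟩ : Fin (2 * (c.n + 1))) = none := by
            simp [inclPre, inclStr]
          have h' := PreTangle.Touch.mk (T := inclPre c) none
            (⟨c.n, by omega⟩ : Fin (2 * (c.n + 1)))
          rw [h] at h'
          exact .rel _ _ h'
        · exact absurd k.2.isLt (by omega)
    · obtain ⟨m, hm⟩ := Nat.exists_eq_succ_of_ne_zero hn
      have hr : Nat.card (inclPre c).Reg = 3 + 2 * m := by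
        change Nat.card (Option (Gap 1 c.n)) = _
        rw [hm, Finite.card_option, card_gap_succ]
        ring
      rw [hr, PreTangle.card_component_one]
      · simp [hm]
        ring
      · intro i
        refine (inclPre c).touch_trans none (⟨0, by omega⟩ : Fin (2 * (c.n + 1))) _
          (boxPt true ⟨0, by omega⟩ : Fin (2 * c.n)) (.refl _) ?_
        refine .trans ?_ (congrArg some (boxStr_boxPt 0 1 true _)).symm
        change inclStr _ = _
        unfold inclStr
        rw [dif_pos (by simp only; omega)]
        rfl
      · rintro (_ | ⟨l, k⟩)
        · exact ⟨none, (⟨c.n, by omega⟩ : Fin (2 * (c.n + 1))), by simp [inclPre, inclStr]⟩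
        · have hl : l = 0 ∨ l = 1 := by omega
          rcases hl with rfl | rfl
          · exact ⟨some (), _, congrArg some (boxStr_boxPt 0 1 false k)⟩
          · exact ⟨some (), _, congrArg some (boxStr_boxPt 0 1 true k)⟩

/-- The colour of the 2-boxes whose distinguished interval meets an unshaded region. -/
abbrev twoBox : Colour := ⟨2, false⟩

/-- The coproduct tangle: the box `0` is on the left of the box `1`; the two right points of the
box `0` are connected with the two left points of the box `1`. -/
def coproductPre : PreTangle (fun _ : Fin 2 => twoBox) twoBox where
  Str := Fin 6
  Reg := Fin 5
  str
    | none => (![0, 1, 2, 3] : Fin 4 → Fin 6)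
    | some 0 => (![0, 4, 5, 3] : Fin 4 → Fin 6)
    | some 1 => (![4, 1, 2, 5] : Fin 4 → Fin 6)
  reg
    | none => (![0, 1, 2, 3, 0] : Fin 5 → Fin 5)
    | some 0 => (![0, 1, 4, 3, 0] : Fin 5 → Fin 5)
    | some 1 => (![4, 1, 2, 3, 4] : Fin 5 → Fin 5)
  side
    | false => (![0, 2, 2, 0, 4, 4] : Fin 6 → Fin 5)
    | true => (![1, 1, 3, 3, 1, 3] : Fin 6 → Fin 5)
  shade := (![false, true, false, true, false] : Fin 5 → Bool)

/-- See `coproductPre`. -/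
def coproductTangle : Tangle (fun _ : Fin 2 => twoBox) twoBox where
  toPreTangle := coproductPre
  finite_str := inferInstanceAs (Finite (Fin 6))
  finite_reg := inferInstanceAs (Finite (Fin 5))
  reg_last := by
    rintro (_ | i)
    · rfl
    · fin_cases i <;> rfl
  reg_before := by
    rintro (_ | i) p
    · change Fin 4 at p
      fin_cases p <;> rfl
    · change Fin 4 at p
      fin_cases i <;> fin_cases p <;> rfl
  reg_after := by
    rintro (_ | i) p
    · change Fin 4 at p
      fin_cases p <;> rfl
    · change Fin 4 at p
      fin_cases i <;> fin_cases p <;> rfl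
  shade_reg := by
    rintro (_ | i) j
    · change Fin 5 at j
      fin_cases j <;> rfl
    · change Fin 5 at j
      fin_cases i <;> fin_cases j <;> rfl
  shade_side := by
    intro b s
    change Fin 6 at s
    cases b <;> fin_cases s <;> rfl
  ends := by
    have key : ∀ (s : Fin 6)
        (x y : (d : Option (Fin 2)) × Fin (2 * (discColour (fun _ : Fin 2 => twoBox) twoBox d).n)),
        (∀ p : Fin 4, (![0, 1, 2, 3] : Fin 4 → Fin 6) p = s → x = ⟨none, p⟩ ∨ y = ⟨none, p⟩) →
        (∀ p : Fin 4, (![0, 4, 5, 3] : Fin 4 → Fin 6) p = s → x = ⟨some 0, p⟩ ∨ y = ⟨some 0, p⟩) →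
        (∀ p : Fin 4, (![4, 1, 2, 5] : Fin 4 → Fin 6) p = s → x = ⟨some 1, p⟩ ∨ y = ⟨some 1, p⟩) →
        ∀ d p, coproductPre.str d p = s → x = ⟨d, p⟩ ∨ y = ⟨d, p⟩ := by
      rintro s x y h h0 h1 (_ | i) p hp
      · exact h p hp
      · fin_cases i
        · exact h0 p hp
        · exact h1 p hp
    intro s
    change Fin 6 at s
    fin_cases s
    · refine coproductPre.ends_of_two _ ⟨none, (0 : Fin 4)⟩ ⟨some 0, (0 : Fin 4)⟩ rfl rfl rfl ?_
      exact key _ _ _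
        (fun p hp => by
          fin_cases p <;>
            first | exact .inl rfl | exact .inr rfl | exact absurd (congrArg Fin.val hp) (by decide))
        (fun p hp => by
          fin_cases p <;>
            first | exact .inl rfl | exact .inr rfl | exact absurd (congrArg Fin.val hp) (by decide))
        (fun p hp => by
          fin_cases p <;>
            first | exact .inl rfl | exact .inr rfl | exact absurd (congrArg Fin.val hp) (by decide))
    · refine coproductPre.ends_of_two _ ⟨none, (1 : Fin 4)⟩ ⟨some 1, (1 : Fin 4)⟩ rfl rfl rfl ?_
      exact key _ _ _
        (fun p hp => by
          fin_cases p <;>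
            first | exact .inl rfl | exact .inr rfl | exact absurd (congrArg Fin.val hp) (by decide))
        (fun p hp => by
          fin_cases p <;>
            first | exact .inl rfl | exact .inr rfl | exact absurd (congrArg Fin.val hp) (by decide))
        (fun p hp => by
          fin_cases p <;>
            first | exact .inl rfl | exact .inr rfl | exact absurd (congrArg Fin.val hp) (by decide))
    · refine coproductPre.ends_of_two _ ⟨none, (2 : Fin 4)⟩ ⟨some 1, (2 : Fin 4)⟩ rfl rfl rfl ?_
      exact key _ _ _
        (fun p hp => by
          fin_cases p <;>
            first | exact .inl rfl | exact .inr rfl | exact absurd (congrArg Fin.val hp) (by decide))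
        (fun p hp => by
          fin_cases p <;>
            first | exact .inl rfl | exact .inr rfl | exact absurd (congrArg Fin.val hp) (by decide))
        (fun p hp => by
          fin_cases p <;>
            first | exact .inl rfl | exact .inr rfl | exact absurd (congrArg Fin.val hp) (by decide))
    · refine coproductPre.ends_of_two _ ⟨none, (3 : Fin 4)⟩ ⟨some 0, (3 : Fin 4)⟩ rfl rfl rfl ?_
      exact key _ _ _
        (fun p hp => by
          fin_cases p <;>
            first | exact .inl rfl | exact .inr rfl | exact absurd (congrArg Fin.val hp) (by decide))
        (fun p hp => by
          fin_cases p <;>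
            first | exact .inl rfl | exact .inr rfl | exact absurd (congrArg Fin.val hp) (by decide))
        (fun p hp => by
          fin_cases p <;>
            first | exact .inl rfl | exact .inr rfl | exact absurd (congrArg Fin.val hp) (by decide))
    · refine coproductPre.ends_of_two _ ⟨some 0, (1 : Fin 4)⟩ ⟨some 1, (0 : Fin 4)⟩ rfl rfl rfl ?_
      exact key _ _ _
        (fun p hp => by
          fin_cases p <;>
            first | exact .inl rfl | exact .inr rfl | exact absurd (congrArg Fin.val hp) (by decide))
        (fun p hp => by
          fin_cases p <;>
            first | exact .inl rfl | exact .inr rfl | exact absurd (congrArg Fin.val hp) (by decide))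
        (fun p hp => by
          fin_cases p <;>
            first | exact .inl rfl | exact .inr rfl | exact absurd (congrArg Fin.val hp) (by decide))
    · refine coproductPre.ends_of_two _ ⟨some 0, (2 : Fin 4)⟩ ⟨some 1, (3 : Fin 4)⟩ rfl rfl rfl ?_
      exact key _ _ _
        (fun p hp => by
          fin_cases p <;>
            first | exact .inl rfl | exact .inr rfl | exact absurd (congrArg Fin.val hp) (by decide))
        (fun p hp => by
          fin_cases p <;>
            first | exact .inl rfl | exact .inr rfl | exact absurd (congrArg Fin.val hp) (by decide))
        (fun p hp => by
          fin_cases p <;>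
            first | exact .inl rfl | exact .inr rfl | exact absurd (congrArg Fin.val hp) (by decide))
  connected := by
    refine coproductPre.connected_of ?_ ?_ ?_
    · intro i
      refine ⟨(1 : Fin 5), (1 : Fin 5), ?_⟩
      fin_cases i <;> rfl
    · intro s
      change Fin 6 at s
      fin_cases s
      · exact ⟨none, (0 : Fin 4), rfl⟩
      · exact ⟨none, (1 : Fin 4), rfl⟩
      · exact ⟨none, (2 : Fin 4), rfl⟩
      · exact ⟨none, (3 : Fin 4), rfl⟩
      · exact ⟨some 0, (1 : Fin 4), rfl⟩
      · exact ⟨some 0, (2 : Fin 4), rfl⟩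
    · intro r
      change Fin 5 at r
      fin_cases r
      · exact ⟨none, (0 : Fin 5), rfl⟩
      · exact ⟨none, (1 : Fin 5), rfl⟩
      · exact ⟨none, (2 : Fin 5), rfl⟩
      · exact ⟨none, (3 : Fin 5), rfl⟩
      · exact ⟨some 0, (2 : Fin 5), rfl⟩
  euler := by
    have h : Nat.card coproductPre.Reg = 5 := Nat.card_fin 5
    rw [h, PreTangle.card_component_one]
    · rfl
    · intro i
      fin_cases i
      · exact coproductPre.touch_trans none (0 : Fin 4) (some 0) (0 : Fin 4) (.refl _) rfl
      · exact coproductPre.touch_trans none (1 : Fin 4) (some 1) (1 : Fin 4) (.refl _) rfl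
    · intro s
      change Fin 6 at s
      fin_cases s
      · exact ⟨none, (0 : Fin 4), rfl⟩
      · exact ⟨none, (1 : Fin 4), rfl⟩
      · exact ⟨none, (2 : Fin 4), rfl⟩
      · exact ⟨none, (3 : Fin 4), rfl⟩
      · exact ⟨some 0, (1 : Fin 4), rfl⟩
      · exact ⟨some 0, (2 : Fin 4), rfl⟩

/-- The regions along the four strings of the contragredient tangle. -/
def contragredientSide : Bool → Fin 4 → Fin 4
  | false => ![0, 2, 2, 0]
  | true => ![1, 1, 3, 3]

/-- The tangle of the contragredient: the rotation of a 2-box by a half turn. -/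
def contragredientPre : PreTangle (fun _ : Unit => twoBox) twoBox where
  Str := Fin 4
  Reg := Fin 4
  str
    | none => (![0, 1, 2, 3] : Fin 4 → Fin 4)
    | some _ => (![2, 3, 0, 1] : Fin 4 → Fin 4)
  reg
    | none => (![0, 1, 2, 3, 0] : Fin 5 → Fin 4)
    | some _ => (![2, 3, 0, 1, 2] : Fin 5 → Fin 4)
  side := contragredientSide
  shade := (![false, true, false, true] : Fin 4 → Bool)

/-- See `contragredientPre`. -/
def contragredientTangle : Tangle (fun _ : Unit => twoBox) twoBox where
  toPreTangle := contragredientPre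
  finite_str := inferInstanceAs (Finite (Fin 4))
  finite_reg := inferInstanceAs (Finite (Fin 4))
  reg_last := by
    rintro (_ | ⟨⟩) <;> rfl
  reg_before := by
    rintro (_ | i) p
    · exact (by decide : ∀ p : Fin 4, (![0, 1, 2, 3, 0] : Fin 5 → Fin 4) p.castSucc =
        contragredientSide (twoBox.shadeAt p) ((![0, 1, 2, 3] : Fin 4 → Fin 4) p)) p
    · exact (by decide : ∀ p : Fin 4, (![2, 3, 0, 1, 2] : Fin 5 → Fin 4) p.castSucc =
        contragredientSide (twoBox.shadeAt p) ((![2, 3, 0, 1] : Fin 4 → Fin 4) p)) p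
  reg_after := by
    rintro (_ | i) p
    · exact (by decide : ∀ p : Fin 4, (![0, 1, 2, 3, 0] : Fin 5 → Fin 4) p.succ =
        contragredientSide (twoBox.shadeAt (p + 1)) ((![0, 1, 2, 3] : Fin 4 → Fin 4) p)) p
    · exact (by decide : ∀ p : Fin 4, (![2, 3, 0, 1, 2] : Fin 5 → Fin 4) p.succ =
        contragredientSide (twoBox.shadeAt (p + 1)) ((![2, 3, 0, 1] : Fin 4 → Fin 4) p)) p
  shade_reg := by
    rintro (_ | i) j
    · exact (by decide : ∀ j : Fin 5, (![false, true, false, true] : Fin 4 → Bool)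
        ((![0, 1, 2, 3, 0] : Fin 5 → Fin 4) j) = twoBox.shadeAt j) j
    · exact (by decide : ∀ j : Fin 5, (![false, true, false, true] : Fin 4 → Bool)
        ((![2, 3, 0, 1, 2] : Fin 5 → Fin 4) j) = twoBox.shadeAt j) j
  shade_side := by
    intro b s
    change Fin 4 at s
    cases b <;> fin_cases s <;> rfl
  ends := by
    intro s
    change Fin 4 at s
    refine contragredientPre.ends_of_two s ⟨none, s⟩ ⟨some (), (s + 2 : Fin 4)⟩ ?_ ?_ ?_ ?_
    · fin_cases s <;> rfl
    · fin_cases s <;> rfl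
    · fin_cases s <;> rfl
    · rintro (_ | i) p hp
      · refine .inl ?_
        change Fin 4 at p
        have hp' : (![0, 1, 2, 3] : Fin 4 → Fin 4) p = s := hp
        have : s = p := (by decide : ∀ s p : Fin 4, (![0, 1, 2, 3] : Fin 4 → Fin 4) p = s → s = p)
          s p hp'
        rw [this]
      · refine .inr ?_
        change Fin 4 at p
        have hp' : (![2, 3, 0, 1] : Fin 4 → Fin 4) p = s := hp
        have : s + 2 = p := (by decide : ∀ s p : Fin 4,
          (![2, 3, 0, 1] : Fin 4 → Fin 4) p = s → s + 2 = p) s p hp'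
        rw [this]
  connected := by
    refine contragredientPre.connected_of ?_ ?_ ?_
    · intro i
      exact ⟨(0 : Fin 5), (2 : Fin 5), rfl⟩
    · intro s
      change Fin 4 at s
      exact ⟨none, s, by fin_cases s <;> rfl⟩
    · intro s
      change Fin 4 at s
      exact ⟨none, s.castSucc, by fin_cases s <;> rfl⟩
  euler := by
    have h : Nat.card contragredientPre.Reg = 4 := Nat.card_fin 4
    rw [h, PreTangle.card_component_one]
    · rfl
    · intro i
      exact contragredientPre.touch_trans none (2 : Fin 4) (some ()) (0 : Fin 4) (.refl _) rfl
    · intro s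
      change Fin 4 at s
      exact ⟨none, s, by fin_cases s <;> rfl⟩

/-! ### Planar algebras -/

universe u

/-- A (shaded) planar algebra over `ℂ`: every planar tangle acts by a multilinear map, and the
action is compatible with the insertion of tangles into tangles. -/
structure PlanarAlgebra where
  V : Colour → Type u
  [addCommGroup : ∀ c, AddCommGroup (V c)]
  [module : ∀ c, Module ℂ (V c)]
  Z : ∀ {ι : Type} [Fintype ι] {col : ι → Colour} {out : Colour},
    Tangle col out → MultilinearMap ℂ (fun i => V (col i)) (V out)
  /-- The identity tangle acts as the identity. -/
  Z_id : ∀ (c : Colour) (x : V c), Z (stack c 1) (fun _ => x) = x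
  Z_relabel : ∀ {ι ι' : Type} [Fintype ι] [Fintype ι'] {col : ι → Colour} {out : Colour}
    (e : ι' ≃ ι) (T : Tangle col out) (W : Tangle (fun i => col (e i)) out),
    T.IsRelabelling e W → ∀ x : ∀ i, V (col i), Z W (fun i => x (e i)) = Z T x
  Z_comp : ∀ {ι : Type} [Fintype ι] {κ : ι → Type} [∀ i, Fintype (κ i)] {col : ι → Colour}
    {ic : ∀ i, κ i → Colour} {out : Colour} (T : Tangle col out)
    (U : ∀ i, Tangle (ic i) (col i)) (W : Tangle (fun y : (i : ι) × κ i => ic y.1 y.2) out),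
    T.IsComposite U W → ∀ x : ∀ y : (i : ι) × κ i, V (ic y.1 y.2),
      Z W x = Z T (fun i => Z (U i) (fun k => x ⟨i, k⟩))

attribute [instance] PlanarAlgebra.addCommGroup PlanarAlgebra.module

namespace PlanarAlgebra

variable (S : PlanarAlgebra.{u})

/-- The product `x y`: the box `y` is put on top of the box `x`. -/
def mul {c : Colour} (x y : S.V c) : S.V c := S.Z (stack c 2) (![x, y] : Fin 2 → S.V c)

/-- The identity of the product: `n` parallel strings.  For `n = 0` it is the empty diagram. -/
def one (c : Colour) : S.V c := S.Z (stack c 0) (fun i => i.elim0)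

/-- The unnormalized Markov trace, with values in the space of 0-boxes. -/
def tr {c : Colour} (x : S.V c) : S.V ⟨0, c.shaded⟩ := S.Z (traceTangle c) (fun _ => x)

/-- The inclusion that adds a string on the right. -/
def incl {c : Colour} (x : S.V c) : S.V ⟨c.n + 1, c.shaded⟩ := S.Z (inclTangle c) (fun _ => x)

/-- The coproduct of 2-boxes. -/
def coproduct (x y : S.V twoBox) : S.V twoBox :=
  S.Z coproductTangle (![x, y] : Fin 2 → S.V twoBox)

/-- The contragredient of a 2-box. -/
def contragredient (x : S.V twoBox) : S.V twoBox := S.Z contragredientTangle (fun _ => x)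

open Classical in
/-- The scalar `t` with `x = t • 1` for a 0-box `x`. -/
noncomputable def scalar {b : Bool} (x : S.V ⟨0, b⟩) : ℂ :=
  if h : ∃ t : ℂ, x = t • S.one ⟨0, b⟩ then h.choose else 0

/-- The value `δ` of a closed circle. -/
noncomputable def delta : ℂ := S.scalar (S.tr (S.one ⟨1, false⟩))

/-- The `n`-boxes whose distinguished interval meets an unshaded region. -/
abbrev Box (n : ℕ) : Type u := S.V ⟨n, false⟩

/-- The Jones projection in the space of `n + 2`-boxes, usually denoted by `e_{n+1}`. -/
noncomputable def jones (n : ℕ) : S.Box (n + 2) :=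
  S.delta⁻¹ • S.Z (cupCap n false) (fun i => i.elim0)

/-- The two-sided ideal of the algebra of `n`-boxes that is generated by the last Jones projection;
it is zero for `n = 0, 1`. -/
noncomputable def jonesIdeal : (n : ℕ) → Submodule ℂ (S.Box n)
  | 0 => ⊥
  | 1 => ⊥
  | n + 2 => Submodule.span ℂ {z | ∃ x y : S.Box (n + 2), z = S.mul (S.mul x (S.jones n)) y}

/-- The subspace `{q x p | x}`. -/
def corner {c : Colour} (q p : S.V c) : Submodule ℂ (S.V c) :=
  Submodule.span ℂ {z | ∃ x, z = S.mul (S.mul q x) p}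

end PlanarAlgebra

/-- A planar *-algebra: the involution is conjugate linear and compatible with reflection of
tangles. -/
structure PlanarStarAlgebra extends PlanarAlgebra.{u} where
  star : ∀ {c : Colour}, V c → V c
  star_add : ∀ {c : Colour} (x y : V c), star (x + y) = star x + star y
  star_smul : ∀ {c : Colour} (t : ℂ) (x : V c), star (t • x) = (starRingEnd ℂ) t • star x
  star_star : ∀ {c : Colour} (x : V c), star (star x) = x
  star_Z : ∀ {ι : Type} [Fintype ι] {col : ι → Colour} {out : Colour} (T W : Tangle col out),
    T.IsReflection W → ∀ x : ∀ i, V (col i), star (Z T x) = Z W (fun i => star (x i))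

/-- A subfactor planar algebra. -/
structure SubfactorPlanarAlgebra extends PlanarStarAlgebra.{u} where
  finiteDimensional : ∀ c, FiniteDimensional ℂ (V c)
  finrank_zero : ∀ b, Module.finrank ℂ (V ⟨0, b⟩) = 1
  /-- The value of a labelled diagram without boundary points depends only on the diagram on the
  sphere. -/
  spherical : ∀ {ι : Type} [Fintype ι] {col : ι → Colour} {s s' : Bool}
    (T : Tangle col ⟨0, s⟩) (W : Tangle col ⟨0, s'⟩), T.IsSphereIsotopic W →
    ∀ (x : ∀ i, V (col i)) (t : ℂ), Z T x = t • toPlanarAlgebra.one ⟨0, s⟩ →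
      Z W x = t • toPlanarAlgebra.one ⟨0, s'⟩
  /-- The inner product given by the Markov trace is positive definite. -/
  tr_pos : ∀ {c : Colour} (x : V c), x ≠ 0 → ∃ t : ℝ, 0 < t ∧
    toPlanarAlgebra.tr (toPlanarAlgebra.mul (star x) x) =
      (t : ℂ) • toPlanarAlgebra.one ⟨0, c.shaded⟩

namespace PlanarStarAlgebra

variable (S : PlanarStarAlgebra.{u})

/-- (Orthogonal) projections. -/
def IsProjection {c : Colour} (p : S.V c) : Prop := S.star p = p ∧ S.mul p p = p

/-- Minimal projections: `p ≠ 0` and `p x p` is a multiple of `p` for all `x`. -/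
def IsMinimalProjection {c : Colour} (p : S.V c) : Prop :=
  S.IsProjection p ∧ p ≠ 0 ∧ ∀ x, ∃ t : ℂ, S.mul (S.mul p x) p = t • p

/-- The positive operator `X` has rank `k`: it is a linear combination with positive coefficients
of `k` mutually orthogonal minimal projections. -/
def HasRank {c : Colour} (X : S.V c) (k : ℕ) : Prop :=
  ∃ (R : Fin k → S.V c) (C : Fin k → ℝ), (∀ i, S.IsMinimalProjection (R i)) ∧ (∀ i, 0 < C i) ∧
    (∀ i j, i ≠ j → S.mul (R i) (R j) = 0) ∧ X = ∑ i, (C i : ℂ) • R i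

/-- Equivalence of projections. -/
def MvN {c : Colour} (p q : S.V c) : Prop :=
  ∃ v, S.mul (S.star v) v = p ∧ S.mul v (S.star v) = q

/-- The minimal projections in the orthogonal complement of the ideal generated by the last Jones
projection. -/
def NewProjection (n : ℕ) : Type u :=
  {p : S.Box n // S.IsMinimalProjection p ∧ ∀ x ∈ S.jonesIdeal n, S.tr (S.mul (S.star x) p) = 0}

/-- The vertices of depth `n` of the principal graph: the equivalence classes of the minimal
projections in the orthogonal complement of the ideal generated by the last Jones projection in
the algebra of `n`-boxes. -/
def DepthVertex (n : ℕ) : Type u := Quot fun p q : S.NewProjection n => S.MvN p.1 q.1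

/-- The vertices of the principal graph. -/
abbrev Vertex : Type u := (n : ℕ) × S.DepthVertex n

/-- The number of edges between a vertex of depth `n` and a vertex of depth `n + 1`, represented by
the projections `p` and `q`: the multiplicity of `q` in the image of `p` in the algebra of
`n + 1`-boxes (which does not depend on the choice of the representatives). -/
noncomputable def edgeCount {n : ℕ} (a : S.DepthVertex n) (b : S.DepthVertex (n + 1)) : ℕ :=
  Module.finrank ℂ (S.corner (c := ⟨n + 1, false⟩) (Quot.out b).1 (S.incl (Quot.out a).1))

/-- The (undirected) edges of the principal graph, with a direction of travel. -/
inductive Edge : S.Vertex → S.Vertex → Type u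
  | up {n : ℕ} (a : S.DepthVertex n) (b : S.DepthVertex (n + 1)) (k : Fin (S.edgeCount a b)) :
      Edge ⟨n, a⟩ ⟨n + 1, b⟩
  | down {n : ℕ} (a : S.DepthVertex n) (b : S.DepthVertex (n + 1)) (k : Fin (S.edgeCount a b)) :
      Edge ⟨n + 1, b⟩ ⟨n, a⟩

/-- The number of paths of length 2 between two vertices of the principal graph. -/
noncomputable def pathCountTwo (v w : S.Vertex) : ℕ :=
  Nat.card ((z : S.Vertex) × S.Edge v z × S.Edge z w)

/-- The vertex of the principal graph that corresponds to a minimal projection `p` in the algebra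
of `n`-boxes: the class of `p` if `p` is orthogonal to the ideal generated by the Jones projection,
and otherwise the vertex of any minimal projection `q` in the algebra of `n - 2`-boxes such that `p`
is equivalent to the product of `q` and the last Jones projection. -/
inductive Represents : ∀ {n : ℕ}, S.Box n → S.Vertex → Prop
  | new {n : ℕ} (p : S.NewProjection n) : Represents (n := n) p.1 ⟨n, Quot.mk _ p⟩
  | old {n : ℕ} (q : S.Box n) (v : S.Vertex) (p : S.Box (n + 2)) (h : Represents q v)
      (hp : S.MvN p (S.mul (S.incl (S.incl q) : S.Box (n + 2)) (S.jones n))) :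
      Represents (n := n + 2) p v

end PlanarStarAlgebra

/-! ### Tangles as numerical tables -/

/-! Write ρ(R) for `rotateShift R`, the 3-box that consists of a vertical string with a rotated copy
of the 2-box R on its right. The rank inequality rests on one equality of closed diagrams on the
sphere: for projections P and Q, tr(R* (P'*Q) R') = tr((Q ρ(R) P)* (Q ρ(R') P)), see
`tr_rotateShift_mul` and `trace_toCorner`. For R = R' the right-hand side is nonnegative, so P'*Q is
positive and the spectral theorem decomposes it (`exists_hasRank`). If P'*Q is the sum of the C_i
R_i, then the same equality for R, R' among the R_i shows that the elements Q ρ(R_i) P of Q S_3 P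
are nonzero and pairwise orthogonal, which bounds their number by the dimension
(`le_finrank_of_hasRank`).

For the path count, S_3 is regarded as a finite-dimensional *-algebra with a faithful trace.
Splitting P and Q into minimal projections of S_3 and applying Schur's lemma gives dim(Q S_3 P) as
the sum of dim(Q S_3 F) dim(F S_3 P) over representatives F of the classes of minimal projections of
S_3 (`finrank_corner_eq_sum_card`). These classes are of two kinds: the vertices of depth 3, and the
projections g e_2, where g runs through the vertices of depth 1 (`existsUnique_minProjThree`). Every
factor is a number of edges (`nonempty_edge_equiv`). This is the definition if F has depth 3 and P
has depth 2. For F = g e_2 the map b ↦ b e_2 identifies P S_2 g with P S_3 g e_2. If P is equivalent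
to q e_1, the same argument one level lower leads to the edges at depth 0, and e_1 = δ² e_1 e_2 e_1
shows that F of depth 3 contributes nothing. So the term of F counts the paths of length 2 through
the vertex of F.

The planar algebra enters only through a short list of identities between diagrams made of boxes
with n ≤ 3. They are proved by computation: a tangle is turned into tables of numbers
(`TangleCode`), insertion of tangles into a union-find problem, and isotopy into the comparison of
tables. `BoxTerm.eval_congr`, `BoxTerm.star_eval` and `BoxTerm.eval_eq_smul_one` convert such a
computation into a statement about elements, by means of the axioms on composition, relabelling,
reflection and sphericality. The rest takes place in an abstract tracial *-algebra
(`TracialAlgebra`) and in a tower with a Jones projection (`IsJonesProjection`). -/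

/-- Evaluate a number before it is passed on. -/
def forceNat {α : Type} (n : ℕ) (k : ℕ → α) : α := n.rec (k 0) fun m _ => k m.succ

/-- The recursor makes the kernel reduce `n` to a literal before it is substituted, so that shared
data are not recomputed in every use. The value is unaffected, and the `force` functions disappear
from all proofs by rewriting. -/
theorem forceNat_eq {α : Type} (n : ℕ) (k : ℕ → α) : forceNat n k = k n := by
  cases n <;> rfl

/-- Evaluate a truth value before it is passed on. -/
def forceBool {α : Type} (b : Bool) (k : Bool → α) : α := b.rec (k false) (k true)

theorem forceBool_eq {α : Type} (b : Bool) (k : Bool → α) : forceBool b k = k b := by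
  cases b <;> rfl

/-- Evaluate a list before it is passed on. -/
def forceList {α β : Type} (f : β → (β → α) → α) (l : List β) : (List β → α) → α :=
  l.rec (fun k => k []) fun a _ ih k => f a fun a' => ih fun l' => k (a' :: l')

theorem forceList_eq {α β : Type} {f : β → (β → α) → α} (hf : ∀ b k, f b k = k b) (l : List β)
    (k : List β → α) : forceList f l k = k l := by
  induction l generalizing k with
  | nil => rfl
  | cons a l ih =>
    change f a (fun a' => forceList f l fun l' => k (a' :: l')) = _
    rw [hf, ih]

/-- Evaluate a pair of numbers before it is passed on. -/
def forcePair {α : Type} (x : ℕ × ℕ) (k : ℕ × ℕ → α) : α :=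
  forceNat x.1 fun a => forceNat x.2 fun b => k (a, b)

theorem forcePair_eq {α : Type} (x : ℕ × ℕ) (k : ℕ × ℕ → α) : forcePair x k = k x := by
  rw [forcePair, forceNat_eq, forceNat_eq]

/-- One step of a union-find procedure on a list of labels. -/
def unionStep (L : List ℕ) (e : ℕ × ℕ) : List ℕ :=
  forceNat (L.getD e.1 0) fun a => forceNat (L.getD e.2 0) fun b =>
    L.map fun z => if z = a then b else z

theorem unionStep_eq (L : List ℕ) (e : ℕ × ℕ) :
    unionStep L e = L.map fun z => if z = L.getD e.1 0 then L.getD e.2 0 else z := by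
  rw [unionStep, forceNat_eq, forceNat_eq]

/-- The labels of the connected components of the graph on `0, …, N - 1` with the given edges. -/
def unionFind (N : ℕ) (E : List (ℕ × ℕ)) : List ℕ :=
  E.rec (fun L => L) (fun e _ ih L => forceList forceNat (unionStep L e) ih) (List.range N)

theorem unionFind_eq (N : ℕ) (E : List (ℕ × ℕ)) :
    unionFind N E = E.foldl unionStep (List.range N) := by
  rw [unionFind]
  generalize List.range N = L
  induction E generalizing L with
  | nil => rfl
  | cons e E ih =>
    change forceList forceNat (unionStep L e) _ = _
    rw [forceList_eq forceNat_eq, ih, List.foldl_cons]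

/-- Renumber labels by consecutive numbers. -/
def renumber (L : List ℕ) : List ℕ :=
  forceList forceNat L.dedup fun D => L.map fun z => D.idxOf z

/-- A tangle all of whose input discs have the same colour, given by numerical tables.  The outer
disc has the number `0`, and the input discs have the numbers `1, …, arity`; strings and regions
are numbered as well. -/
structure TangleCode where
  arity : ℕ
  nStr : ℕ
  nReg : ℕ
  strT : List (List ℕ)
  regT : List (List ℕ)
  sideT : List (ℕ × ℕ)
  shadeT : List Bool

instance : Inhabited TangleCode := ⟨⟨0, 0, 0, [], [], [], []⟩⟩

namespace TangleCode

/-- The string at the point `p` of the disc `d`. -/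
def str (w : TangleCode) (d p : ℕ) : ℕ := (w.strT.getD d []).getD p 0

/-- The region at the interval `j` of the disc `d`. -/
def reg (w : TangleCode) (d j : ℕ) : ℕ := (w.regT.getD d []).getD j 0

/-- The region of shading `b` along the string `s`. -/
def side (w : TangleCode) (b : Bool) (s : ℕ) : ℕ :=
  if b then (w.sideT.getD s (0, 0)).2 else (w.sideT.getD s (0, 0)).1

/-- The shading of the region `r`. -/
def shade (w : TangleCode) (r : ℕ) : Bool := w.shadeT.getD r false

/-- The colour of the disc number `d`. -/
def colourAt (c out : Colour) : ℕ → Colour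
  | 0 => out
  | _ + 1 => c

/-- All boundary points of all discs. -/
def points (c out : Colour) (w : TangleCode) : List (ℕ × ℕ) :=
  (List.range (w.arity + 1)).flatMap fun d =>
    (List.range (2 * (colourAt c out d).n)).map fun p => (d, p)

/-- The direction of the string at a boundary point. -/
def dir (c out : Colour) (d p : ℕ) : Bool := xor ((colourAt c out d).shadeAt p) (decide (d = 0))

/-- The edges of the incidence graph of discs, strings and regions. -/
def incidences (c out : Colour) (w : TangleCode) : List (ℕ × ℕ) :=
  ((w.points c out).map fun x => (x.1, w.arity + 1 + w.str x.1 x.2)) ++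
  ((List.range (w.arity + 1)).flatMap fun d =>
    (List.range (2 * (colourAt c out d).n + 1)).map fun j =>
      (d, w.arity + 1 + w.nStr + w.reg d j)) ++
  (List.range w.nStr).flatMap fun s => [false, true].map fun b =>
    (w.arity + 1 + s, w.arity + 1 + w.nStr + w.side b s)

/-- The edges of the graph of discs and strings. -/
def touches (c out : Colour) (w : TangleCode) : List (ℕ × ℕ) :=
  (w.points c out).map fun x => (x.1, w.arity + 1 + w.str x.1 x.2)

/-- The conditions under which the tables describe a tangle. -/
def Valid (c out : Colour) (w : TangleCode) : Prop :=
  (∀ d < w.arity + 1, ∀ p < 2 * (colourAt c out d).n, w.str d p < w.nStr) ∧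
  (∀ d < w.arity + 1, ∀ j < 2 * (colourAt c out d).n + 1, w.reg d j < w.nReg) ∧
  (∀ b, ∀ s < w.nStr, w.side b s < w.nReg) ∧
  (∀ d < w.arity + 1, w.reg d (2 * (colourAt c out d).n) = w.reg d 0) ∧
  (∀ d < w.arity + 1, ∀ p < 2 * (colourAt c out d).n,
    w.reg d p = w.side ((colourAt c out d).shadeAt p) (w.str d p)) ∧
  (∀ d < w.arity + 1, ∀ p < 2 * (colourAt c out d).n,
    w.reg d (p + 1) = w.side ((colourAt c out d).shadeAt (p + 1)) (w.str d p)) ∧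
  (∀ d < w.arity + 1, ∀ j < 2 * (colourAt c out d).n + 1,
    w.shade (w.reg d j) = (colourAt c out d).shadeAt j) ∧
  (∀ b, ∀ s < w.nStr, w.shade (w.side b s) = b) ∧
  (∀ s < w.nStr, (∀ x ∈ w.points c out, w.str x.1 x.2 ≠ s) ∨
    ∀ b, ((w.points c out).filter
      fun x => decide (w.str x.1 x.2 = s) && (dir c out x.1 x.2 == b)).length = 1) ∧
  (∀ a < w.arity + 1 + w.nStr + w.nReg,
    (unionFind (w.arity + 1 + w.nStr + w.nReg) (w.incidences c out)).getD a 0 =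
      (unionFind (w.arity + 1 + w.nStr + w.nReg) (w.incidences c out)).getD 0 0) ∧
  w.arity + 1 + w.nReg = out.n + w.arity * c.n + 1 +
    (unionFind (w.arity + 1 + w.nStr) (w.touches c out)).dedup.length

/-- All quantifiers in the conditions are bounded or range over truth values, so concrete tables can
be checked by evaluation. -/
instance (c out : Colour) (w : TangleCode) : Decidable (w.Valid c out) := by
  unfold Valid
  infer_instance

/-- Evaluate a code before it is passed on. -/
def force {α : Type} (w : TangleCode) (k : TangleCode → α) : α :=
  forceNat w.arity fun a => forceNat w.nStr fun s => forceNat w.nReg fun r =>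
  forceList (forceList forceNat) w.strT fun st => forceList (forceList forceNat) w.regT fun rt =>
  forceList forcePair w.sideT fun si => forceList forceBool w.shadeT fun sh =>
  k ⟨a, s, r, st, rt, si, sh⟩

theorem force_eq {α : Type} (w : TangleCode) (k : TangleCode → α) : w.force k = k w := by
  simp only [force, forceNat_eq, forceList_eq forcePair_eq, forceList_eq forceBool_eq,
    forceList_eq (forceList_eq forceNat_eq)]

/-! ### Composition of codes -/

/-- The codes that are inserted are numbered by `ℕ`. -/
abbrev nth (us : List TangleCode) (i : ℕ) : TangleCode := us.getD i default

/-- The number of the first string of the `i`-th inserted tangle in the disjoint union. -/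
def strOff (t : TangleCode) (us : List TangleCode) (i : ℕ) : ℕ :=
  t.nStr + ((us.take i).map nStr).sum

/-- The number of the first region of the `i`-th inserted tangle in the disjoint union. -/
def regOff (t : TangleCode) (us : List TangleCode) (i : ℕ) : ℕ :=
  t.nReg + ((us.take i).map nReg).sum

/-- The number of the first input disc of the `i`-th inserted tangle. -/
def discOff (us : List TangleCode) (i : ℕ) : ℕ := ((us.take i).map arity).sum

/-- The pairs of strings that are glued. -/
def strGlue (c' : Colour) (t : TangleCode) (us : List TangleCode) : List (ℕ × ℕ) :=
  (List.range t.arity).flatMap fun i => (List.range (2 * c'.n)).map fun p =>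
    (t.str (i + 1) p, strOff t us i + (nth us i).str 0 p)

/-- The pairs of regions that are glued. -/
def regGlue (c' : Colour) (t : TangleCode) (us : List TangleCode) : List (ℕ × ℕ) :=
  (List.range t.arity).flatMap fun i => (List.range (2 * c'.n + 1)).map fun j =>
    (t.reg (i + 1) j, regOff t us i + (nth us i).reg 0 j)

/-- The classes of strings under gluing. -/
def strClass (c' : Colour) (t : TangleCode) (us : List TangleCode) : List ℕ :=
  renumber (unionFind (strOff t us t.arity) (strGlue c' t us))

/-- The classes of regions under gluing. -/
def regClass (c' : Colour) (t : TangleCode) (us : List TangleCode) : List ℕ :=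
  renumber (unionFind (regOff t us t.arity) (regGlue c' t us))

/-- The tables of the composite with given classes of strings and of regions. -/
def composeWith (c out : Colour) (t : TangleCode) (us : List TangleCode) (FS FR : List ℕ) :
    TangleCode where
  arity := discOff us t.arity
  nStr := FS.dedup.length
  nReg := FR.dedup.length
  strT := ((List.range (2 * out.n)).map fun p => FS.getD (t.str 0 p) 0) ::
    (List.range t.arity).flatMap fun i => (List.range (nth us i).arity).map fun k =>
      (List.range (2 * c.n)).map fun p => FS.getD (strOff t us i + (nth us i).str (k + 1) p) 0
  regT := ((List.range (2 * out.n + 1)).map fun j => FR.getD (t.reg 0 j) 0) ::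
    (List.range t.arity).flatMap fun i => (List.range (nth us i).arity).map fun k =>
      (List.range (2 * c.n + 1)).map fun j =>
        FR.getD (regOff t us i + (nth us i).reg (k + 1) j) 0
  sideT := (List.range FS.dedup.length).map fun q =>
    (((List.range t.nStr).map fun s => (FR.getD (t.side false s) 0, FR.getD (t.side true s) 0)) ++
      (List.range t.arity).flatMap fun i => (List.range (nth us i).nStr).map fun s =>
        (FR.getD (regOff t us i + (nth us i).side false s) 0,
          FR.getD (regOff t us i + (nth us i).side true s) 0)).getD (FS.idxOf q) (0, 0)
  shadeT := (List.range FR.dedup.length).map fun q =>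
    (((List.range t.nReg).map fun r => t.shade r) ++
      (List.range t.arity).flatMap fun i => (List.range (nth us i).nReg).map fun r =>
        (nth us i).shade r).getD (FR.idxOf q) false

/-- The tables of the composite. -/
def compose (c c' out : Colour) (t : TangleCode) (us : List TangleCode) : TangleCode :=
  composeWith c out t us (strClass c' t us) (regClass c' t us)

/-- `w` is the composite, with the given classes of strings and regions. -/
def CompositeWith (c out : Colour) (t : TangleCode) (us : List TangleCode) (w : TangleCode)
    (FS FR : List ℕ) : Prop :=
  us.length = t.arity ∧ w.arity = discOff us t.arity ∧
  (∀ s < t.nStr, FS.getD s 0 < w.nStr) ∧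
  (∀ i < t.arity, ∀ s < (nth us i).nStr, FS.getD (strOff t us i + s) 0 < w.nStr) ∧
  (∀ r < t.nReg, FR.getD r 0 < w.nReg) ∧
  (∀ i < t.arity, ∀ r < (nth us i).nReg, FR.getD (regOff t us i + r) 0 < w.nReg) ∧
  (∀ q < w.nStr, (∃ s < t.nStr, FS.getD s 0 = q) ∨
    ∃ i < t.arity, ∃ s < (nth us i).nStr, FS.getD (strOff t us i + s) 0 = q) ∧
  (∀ q < w.nReg, (∃ r < t.nReg, FR.getD r 0 = q) ∨
    ∃ i < t.arity, ∃ r < (nth us i).nReg, FR.getD (regOff t us i + r) 0 = q) ∧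
  (∀ p < 2 * out.n, w.str 0 p = FS.getD (t.str 0 p) 0) ∧
  (∀ i < t.arity, ∀ k < (nth us i).arity, ∀ p < 2 * c.n,
    w.str (discOff us i + k + 1) p = FS.getD (strOff t us i + (nth us i).str (k + 1) p) 0) ∧
  (∀ j < 2 * out.n + 1, w.reg 0 j = FR.getD (t.reg 0 j) 0) ∧
  (∀ i < t.arity, ∀ k < (nth us i).arity, ∀ j < 2 * c.n + 1,
    w.reg (discOff us i + k + 1) j = FR.getD (regOff t us i + (nth us i).reg (k + 1) j) 0) ∧
  (∀ b, ∀ s < t.nStr, w.side b (FS.getD s 0) = FR.getD (t.side b s) 0) ∧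
  (∀ b, ∀ i < t.arity, ∀ s < (nth us i).nStr,
    w.side b (FS.getD (strOff t us i + s) 0) = FR.getD (regOff t us i + (nth us i).side b s) 0)

instance (c out : Colour) (t : TangleCode) (us : List TangleCode) (w : TangleCode)
    (FS FR : List ℕ) : Decidable (CompositeWith c out t us w FS FR) := by
  unfold CompositeWith
  infer_instance

/-- `w` is the composite. -/
def Composite (c c' out : Colour) (t : TangleCode) (us : List TangleCode) (w : TangleCode) : Prop :=
  CompositeWith c out t us w (strClass c' t us) (regClass c' t us)

/-! ### Comparison of codes -/

/-- The number of a point or an interval, or of its mirror image. -/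
def mirror (m : Bool) (k p : ℕ) : ℕ := if m then k - p else p

/-- The permutation `P` of the input discs and the maps `FS` and `FR` of strings and regions
identify `w` (or its mirror image, if `m` is `true`) with `w'`; if `sph` is `true`, then the outer
disc is disregarded. -/
def Matches (m sph : Bool) (c out : Colour) (w w' : TangleCode) (P FS FR : List ℕ) : Prop :=
  w.arity = w'.arity ∧ w.nStr = w'.nStr ∧ w.nReg = w'.nReg ∧
  (∀ i < w.arity, P.getD i 0 < w.arity) ∧
  (∀ i < w.arity, ∀ j < w.arity, P.getD i 0 = P.getD j 0 → i = j) ∧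
  (∀ i < w.nStr, FS.getD i 0 < w.nStr) ∧
  (∀ i < w.nStr, ∀ j < w.nStr, FS.getD i 0 = FS.getD j 0 → i = j) ∧
  (∀ i < w.nReg, FR.getD i 0 < w.nReg) ∧
  (∀ i < w.nReg, ∀ j < w.nReg, FR.getD i 0 = FR.getD j 0 → i = j) ∧
  (sph = true ∨ ((∀ p < 2 * out.n,
      w'.str 0 p = FS.getD (w.str 0 (mirror m (2 * out.n - 1) p)) 0) ∧
    ∀ j < 2 * out.n + 1, w'.reg 0 j = FR.getD (w.reg 0 (mirror m (2 * out.n) j)) 0)) ∧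
  (∀ i < w.arity, ∀ p < 2 * c.n,
    w'.str (i + 1) p = FS.getD (w.str (P.getD i 0 + 1) (mirror m (2 * c.n - 1) p)) 0) ∧
  (∀ i < w.arity, ∀ j < 2 * c.n + 1,
    w'.reg (i + 1) j = FR.getD (w.reg (P.getD i 0 + 1) (mirror m (2 * c.n) j)) 0) ∧
  (∀ b, ∀ s < w.nStr, w'.side b (FS.getD s 0) = FR.getD (w.side b s) 0)

instance (m sph : Bool) (c out : Colour) (w w' : TangleCode) (P FS FR : List ℕ) :
    Decidable (Matches m sph c out w w' P FS FR) := by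
  unfold Matches
  infer_instance

/-- Extend a list of pairs to a function on `0, …, n - 1`; the points that do not occur are mapped
to the first number that does not occur as a value. -/
def tabulate (n : ℕ) (l : List (ℕ × ℕ)) : List ℕ :=
  (List.range n).map fun s => match l.find? fun x => x.1 == s with
    | some x => x.2
    -- This serves closed loops, which meet no disc. Two missing points would receive the same
    -- value, and then the injectivity required by `Matches` fails; the value is only a guess that
    -- is checked afterwards.
    | none => ((List.range n).filter fun q => !((l.map Prod.snd).contains q)).getD 0 0

/-- The map of strings that is determined by the discs. -/
def strMatch (m sph : Bool) (c out : Colour) (w w' : TangleCode) (P : List ℕ) : List ℕ :=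
  tabulate w.nStr ((if sph then [] else (List.range (2 * out.n)).map fun p =>
      (w.str 0 (mirror m (2 * out.n - 1) p), w'.str 0 p)) ++
    (List.range w.arity).flatMap fun i => (List.range (2 * c.n)).map fun p =>
      (w.str (P.getD i 0 + 1) (mirror m (2 * c.n - 1) p), w'.str (i + 1) p))

/-- The map of regions that is determined by the discs and by the map of strings. -/
def regMatch (m sph : Bool) (c out : Colour) (w w' : TangleCode) (P FS : List ℕ) : List ℕ :=
  tabulate w.nReg ((if sph then [] else (List.range (2 * out.n + 1)).map fun j =>
      (w.reg 0 (mirror m (2 * out.n) j), w'.reg 0 j)) ++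
    ((List.range w.arity).flatMap fun i => (List.range (2 * c.n + 1)).map fun j =>
      (w.reg (P.getD i 0 + 1) (mirror m (2 * c.n) j), w'.reg (i + 1) j)) ++
    (List.range w.nStr).flatMap fun s => [false, true].map fun b =>
      (w.side b s, w'.side b (FS.getD s 0)))

end TangleCode

/-! ### Terms -/

/-- A code with a variable for every input disc, and a flag that tells whether the code is
legitimate. -/
structure LabelledCode where
  code : TangleCode
  vars : List ℕ
  ok : Bool

instance : Inhabited LabelledCode := ⟨⟨default, [], false⟩⟩

namespace LabelledCode

open TangleCode

/-- Evaluate a labelled code before it is passed on. -/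
def force {α : Type} (l : LabelledCode) (k : LabelledCode → α) : α :=
  l.code.force fun w => forceList forceNat l.vars fun vs => forceBool l.ok fun b => k ⟨w, vs, b⟩

theorem force_eq {α : Type} (l : LabelledCode) (k : LabelledCode → α) : l.force k = k l := by
  rw [force, TangleCode.force_eq, forceList_eq forceNat_eq, forceBool_eq]

/-- The composite of a code with labelled codes, for given classes of strings and regions. -/
def compWith (c c' out : Colour) (t : TangleCode) (ls : List LabelledCode) (us : List TangleCode)
    (FS FR vars : List ℕ) (w : TangleCode) : LabelledCode where
  code := w
  vars := vars
  -- The tables that `composeWith` produces are never proved correct in general. The flag records a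
  -- check of the concrete result, and only the classes of strings and regions need a correctness
  -- proof.
  ok := ls.all ok && decide (t.Valid c' out) &&
    decide (w.Valid c out) && decide (CompositeWith c out t us w FS FR) &&
    decide (∀ i < t.arity, ∀ k < (nth us i).arity,
      vars.getD (discOff us i + k) 0 = (ls.getD i default).vars.getD k 0)

/-- The composite of a code with labelled codes. -/
def comp (c c' out : Colour) (t : TangleCode) (ls : List LabelledCode) : LabelledCode :=
  t.force fun t => forceList force ls fun ls => forceList forceNat (ls.flatMap vars) fun vs =>
  forceList TangleCode.force (ls.map code) fun us =>
  forceList forceNat (strClass c' t us) fun FS => forceList forceNat (regClass c' t us) fun FR =>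
  (composeWith c out t us FS FR).force fun w => compWith c c' out t ls us FS FR vs w

theorem comp_eq (c c' out : Colour) (t : TangleCode) (ls : List LabelledCode) :
    comp c c' out t ls = compWith c c' out t ls (ls.map code) (strClass c' t (ls.map code))
      (regClass c' t (ls.map code)) (ls.flatMap vars) (compose c c' out t (ls.map code)) := by
  rw [comp, TangleCode.force_eq, forceList_eq force_eq, forceList_eq forceNat_eq,
    forceList_eq TangleCode.force_eq, forceList_eq forceNat_eq, forceList_eq forceNat_eq,
    TangleCode.force_eq, compose]

/-- The permutation of the discs that is determined by the variables. -/
def discMatch (l l' : LabelledCode) : List ℕ := l'.vars.map fun v => l.vars.idxOf v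

/-- The two labelled codes are the same up to isotopy. -/
def same (m sph : Bool) (c out : Colour) (l l' : LabelledCode) : Bool :=
  l.force fun l => l'.force fun l' => forceList forceNat (discMatch l l') fun P =>
  forceList forceNat (strMatch m sph c out l.code l'.code P) fun FS =>
  forceList forceNat (regMatch m sph c out l.code l'.code P FS) fun FR =>
  -- `P`, `FS` and `FR` are guesses read off from the variables and the discs; only this check of
  -- them is used.
  l.ok && l'.ok && decide (Matches m sph c out l.code l'.code P FS FR) &&
  decide (∀ i < l.code.arity, l'.vars.getD i 0 = l.vars.getD (P.getD i 0) 0)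

theorem same_eq (m sph : Bool) (c out : Colour) (l l' : LabelledCode) :
    same m sph c out l l' = (l.ok && l'.ok && decide (Matches m sph c out l.code l'.code
      (discMatch l l') (strMatch m sph c out l.code l'.code (discMatch l l'))
      (regMatch m sph c out l.code l'.code (discMatch l l')
        (strMatch m sph c out l.code l'.code (discMatch l l')))) &&
      decide (∀ i < l.code.arity,
        l'.vars.getD i 0 = l.vars.getD ((discMatch l l').getD i 0) 0)) := by
  rw [same, force_eq, force_eq, forceList_eq forceNat_eq, forceList_eq forceNat_eq,
    forceList_eq forceNat_eq]

end LabelledCode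

/-! ### Codes of tangles -/

namespace Tangle

variable {ι : Type} {col : ι → Colour} {out : Colour}

/-- The tables of a tangle, for given enumerations of the input discs, strings and regions. -/
def encode (T : PreTangle col out) {m : ℕ} (e : Fin m → ι) (ss : List T.Str)
    (rs : List T.Reg) [DecidableEq T.Str] [DecidableEq T.Reg] : TangleCode where
  arity := m
  nStr := ss.length
  nReg := rs.length
  strT := ((List.finRange (2 * out.n)).map fun p => ss.idxOf (T.str none p)) ::
    (List.finRange m).map fun i =>
      (List.finRange (2 * (col (e i)).n)).map fun p => ss.idxOf (T.str (some (e i)) p)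
  regT := ((List.finRange (2 * out.n + 1)).map fun j => rs.idxOf (T.reg none j)) ::
    (List.finRange m).map fun i =>
      (List.finRange (2 * (col (e i)).n + 1)).map fun j => rs.idxOf (T.reg (some (e i)) j)
  sideT := ss.map fun s => (rs.idxOf (T.side false s), rs.idxOf (T.side true s))
  shadeT := rs.map T.shade

end Tangle

/-- The list of all gaps. -/
def gapList (L n : ℕ) : List (Gap L n) :=
  ((List.finRange (L + 1)).product (List.finRange (n + 1))).filterMap fun x =>
    if h : (x.2.val = 0 ∨ x.2.val = n) → x.1 = 0 then some ⟨x, h⟩ else none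

/-- The list of all elements of `Fin k ⊕ Bool`. -/
def sumBoolList (k : ℕ) : List (Fin k ⊕ Bool) :=
  (List.finRange k).map .inl ++ [.inr false, .inr true]

/-- The list of all elements of `Option α`, for a list of all elements of `α`. -/
def optionList {α : Type} (l : List α) : List (Option α) := none :: l.map some

namespace TangleCode

/-- The code of the stack of `m` boxes. -/
def stack (c : Colour) (m : ℕ) : TangleCode :=
  letI : DecidableEq (stackPre c m).Str := inferInstanceAs (DecidableEq (Fin (m + 1) × Fin c.n))
  letI : DecidableEq (stackPre c m).Reg := inferInstanceAs (DecidableEq (Gap m c.n))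
  Tangle.encode (stackPre c m) (m := m) id
    ((List.finRange (m + 1)).product (List.finRange c.n)) (gapList m c.n)

/-- The code of the tangle of the Markov trace. -/
def trace (c : Colour) : TangleCode :=
  letI : DecidableEq (tracePre c).Str := inferInstanceAs (DecidableEq (Fin c.n))
  letI : DecidableEq (tracePre c).Reg := inferInstanceAs (DecidableEq (Fin (c.n + 1)))
  Tangle.encode (tracePre c) (m := 1) (fun _ => ()) (List.finRange _) (List.finRange _)

/-- The code of the inclusion tangle. -/
def incl (c : Colour) : TangleCode :=
  letI : DecidableEq (inclPre c).Str := inferInstanceAs (DecidableEq (Option (Fin 2 × Fin c.n)))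
  letI : DecidableEq (inclPre c).Reg := inferInstanceAs (DecidableEq (Option (Gap 1 c.n)))
  Tangle.encode (inclPre c) (m := 1) (fun _ => ())
    (optionList ((List.finRange 2).product (List.finRange c.n))) (optionList (gapList 1 c.n))

/-- The code of the conditional expectation: the last two points on the right of a box are
connected.  It is the inclusion tangle with the outer disc and the input disc exchanged. -/
def partialTrace (c : Colour) : TangleCode :=
  { incl c with strT := (incl c).strT.reverse, regT := (incl c).regT.reverse }

/-- The code of the diagram with a cap and a cup. -/
def cupCap (m : ℕ) (b : Bool) : TangleCode :=
  letI : DecidableEq (cupCapPre m b).Str := inferInstanceAs (DecidableEq (Fin m ⊕ Bool))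
  letI : DecidableEq (cupCapPre m b).Reg := inferInstanceAs (DecidableEq (Fin (m + 1) ⊕ Bool))
  Tangle.encode (cupCapPre m b) (m := 0) (fun i => i.elim0)
    (sumBoolList m) (sumBoolList (m + 1))

/-- The code of the coproduct tangle. -/
def coproduct : TangleCode :=
  letI : DecidableEq coproductPre.Str := inferInstanceAs (DecidableEq (Fin 6))
  letI : DecidableEq coproductPre.Reg := inferInstanceAs (DecidableEq (Fin 5))
  Tangle.encode coproductPre (m := 2) id (List.finRange 6) (List.finRange 5)

/-- The code of the contragredient tangle. -/
def contragredient : TangleCode :=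
  letI : DecidableEq contragredientPre.Str := inferInstanceAs (DecidableEq (Fin 4))
  letI : DecidableEq contragredientPre.Reg := inferInstanceAs (DecidableEq (Fin 4))
  Tangle.encode contragredientPre (m := 1) (fun _ => ()) (List.finRange 4) (List.finRange 4)

/-- A 0-box with shaded boundary is put on the right of a vertical string. -/
def rightOfString : TangleCode where
  arity := 1
  nStr := 1
  nReg := 2
  strT := [[0, 0], []]
  regT := [[0, 1, 0], [1]]
  sideT := [(0, 1)]
  shadeT := [false, true]

/-- A 2-box is rotated and put on the right of a vertical string: its points `0, 1, 2, 3` become the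
points `2, 3, 4, 1` of a 3-box. -/
def rotateShift : TangleCode where
  arity := 1
  nStr := 5
  nReg := 5
  strT := [[0, 1, 2, 3, 4, 0], [2, 3, 4, 1]]
  regT := [[0, 1, 2, 3, 4, 1, 0], [2, 3, 4, 1, 2]]
  sideT := [(0, 1), (2, 1), (2, 3), (4, 3), (4, 1)]
  shadeT := [false, true, false, true, false]

end TangleCode

/-- Terms for the elements that are obtained from boxes of the colour `c` by means of tangles. -/
inductive BoxTerm (c : Colour) : Colour → Type
  | var (i : ℕ) : BoxTerm c c
  | node {c' : Colour} (out : Colour) (t : TangleCode) (args : Fin t.arity → BoxTerm c c') :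
      BoxTerm c out

namespace BoxTerm

variable {c : Colour}

/-- The labelled code of a term. -/
def code : {out : Colour} → BoxTerm c out → LabelledCode
  | _, var i => ⟨TangleCode.stack c 1, [i], decide ((TangleCode.stack c 1).Valid c c)⟩
  | _, node (c' := c') out t args => LabelledCode.comp c c' out t (List.ofFn fun i => (args i).code)

def mul {d : Colour} (x y : BoxTerm c d) : BoxTerm c d := node d (.stack d 2) ![x, y]
def one (d : Colour) : BoxTerm c d := node (c' := d) d (.stack d 0) Fin.elim0
def tr {d : Colour} (x : BoxTerm c d) : BoxTerm c ⟨0, d.shaded⟩ := node _ (.trace d) fun _ => x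
def incl {d : Colour} (x : BoxTerm c d) : BoxTerm c ⟨d.n + 1, d.shaded⟩ :=
  node _ (.incl d) fun _ => x
def partialTrace {d : Colour} (x : BoxTerm c ⟨d.n + 1, d.shaded⟩) : BoxTerm c d :=
  node _ (.partialTrace d) fun _ => x
def cupCap (m : ℕ) (b : Bool) : BoxTerm c ⟨m + 2, b⟩ :=
  node (c' := ⟨0, false⟩) _ (.cupCap m b) Fin.elim0
def coproduct (x y : BoxTerm c twoBox) : BoxTerm c twoBox := node _ .coproduct ![x, y]
def contragredient (x : BoxTerm c twoBox) : BoxTerm c twoBox := node _ .contragredient fun _ => x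
def rightOfString (x : BoxTerm c ⟨0, true⟩) : BoxTerm c ⟨1, false⟩ :=
  node _ .rightOfString fun _ => x
def rotateShift (x : BoxTerm c ⟨2, false⟩) : BoxTerm c ⟨3, false⟩ := node _ .rotateShift fun _ => x

/-- The two terms describe isotopic diagrams. -/
def same (m sph : Bool) {out out' : Colour} (x : BoxTerm c out) (y : BoxTerm c out') : Bool :=
  LabelledCode.same m sph c out x.code y.code

end BoxTerm

/-! ### Correctness of the union-find procedure -/

theorem Relation.EqvGen.bind {α : Type*} {r s : α → α → Prop}
    (h : ∀ a b, r a b → Relation.EqvGen s a b) {a b : α} (hab : Relation.EqvGen r a b) :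
    Relation.EqvGen s a b := by
  induction hab with
  | rel a b hab => exact h a b hab
  | refl a => exact .refl a
  | symm a b _ ih => exact .symm _ _ ih
  | trans a b c _ _ ih ih' => exact .trans _ _ _ ih ih'

theorem Relation.EqvGen.eq_of {α β : Type*} {r : α → α → Prop} (f : α → β)
    (h : ∀ a b, r a b → f a = f b) {a b : α} (hab : Relation.EqvGen r a b) : f a = f b := by
  induction hab with
  | rel a b hab => exact h a b hab
  | refl a => rfl
  | symm a b _ ih => exact ih.symm
  | trans a b c _ _ ih ih' => exact ih.trans ih'

theorem length_unionStep (L : List ℕ) (e : ℕ × ℕ) : (unionStep L e).length = L.length := by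
  simp [unionStep_eq]

theorem getD_unionStep (L : List ℕ) (e : ℕ × ℕ) (x : ℕ) (hx : x < L.length) :
    (unionStep L e).getD x 0 =
      if L.getD x 0 = L.getD e.1 0 then L.getD e.2 0 else L.getD x 0 := by
  simp [unionStep_eq, hx]

theorem length_foldl_unionStep (E : List (ℕ × ℕ)) (L : List ℕ) :
    (E.foldl unionStep L).length = L.length := by
  induction E generalizing L with
  | nil => rfl
  | cons e E ih => rw [List.foldl_cons, ih, length_unionStep]

theorem length_unionFind (N : ℕ) (E : List (ℕ × ℕ)) : (unionFind N E).length = N := by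
  rw [unionFind_eq, length_foldl_unionStep, List.length_range]

/-- The induction is on the edges with an arbitrary initial labelling. Equality of the initial
labels is therefore part of the relation, and one step merges exactly the label classes of the two
ends of an edge. -/
theorem foldl_unionStep_spec {X : Type*} (num : X → ℕ) (E : List (X × X)) (L : List ℕ)
    (hL : ∀ x, num x < L.length) (x y : X) :
    ((E.map (Prod.map num num)).foldl unionStep L).getD (num x) 0 =
      ((E.map (Prod.map num num)).foldl unionStep L).getD (num y) 0 ↔
    Relation.EqvGen (fun a b => L.getD (num a) 0 = L.getD (num b) 0 ∨ (a, b) ∈ E) x y := by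
  induction E generalizing L with
  | nil =>
    refine ⟨fun h => .rel _ _ (.inl h), fun h => h.eq_of (fun a => L.getD (num a) 0) ?_⟩
    rintro a b (h | h)
    · exact h
    · simp at h
  | cons e E ih =>
    obtain ⟨u, v⟩ := e
    rw [List.map_cons, List.foldl_cons, ih _ (by simpa [length_unionStep] using hL)]
    have key : ∀ a, (unionStep L (Prod.map num num (u, v))).getD (num a) 0 =
        if L.getD (num a) 0 = L.getD (num u) 0 then L.getD (num v) 0 else L.getD (num a) 0 :=
      fun a => getD_unionStep L (num u, num v) (num a) (hL a)
    constructor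
    · refine Relation.EqvGen.bind ?_
      rintro a b (h | h)
      · have huv : Relation.EqvGen (fun a b => L.getD (num a) 0 = L.getD (num b) 0 ∨
            (a, b) ∈ (u, v) :: E) u v := .rel _ _ (.inr (by simp))
        rw [key, key] at h
        split_ifs at h with h1 h2 h2
        · exact .rel _ _ (.inl (h1.trans h2.symm))
        · exact .trans _ _ _ (.trans _ _ _ (.rel _ _ (.inl h1)) huv) (.rel _ _ (.inl h))
        · exact .trans _ _ _ (.rel _ _ (.inl h)) (.trans _ _ _ (.symm _ _ huv)
            (.rel _ _ (.inl h2.symm)))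
        · exact .rel _ _ (.inl h)
      · exact .rel _ _ (.inr (by simp [h]))
    · refine Relation.EqvGen.bind ?_
      rintro a b (h | h)
      · refine .rel _ _ (.inl ?_)
        rw [key, key, h]
      · rcases List.mem_cons.1 h with h | h
        · obtain ⟨rfl, rfl⟩ := Prod.mk.inj h
          refine .rel _ _ (.inl ?_)
          rw [key, key]
          simp
        · exact .rel _ _ (.inr h)

/-- The initial labels are the numbers themselves, so by injectivity of `num` equality of initial
labels adds nothing to `r`. Numbers outside the image of `num` do no harm, because no edge meets
them. -/
theorem unionFind_spec {X : Type*} (r : X → X → Prop) (num : X → ℕ)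
    (hinj : Function.Injective num) (N : ℕ) (hN : ∀ x, num x < N) (E : List (ℕ × ℕ))
    (h1 : ∀ e ∈ E, ∃ x y, num x = e.1 ∧ num y = e.2 ∧ r x y)
    (h2 : ∀ x y, r x y → (num x, num y) ∈ E) (x y : X) :
    (unionFind N E).getD (num x) 0 = (unionFind N E).getD (num y) 0 ↔ Relation.EqvGen r x y := by
  -- The edges are lifted to pairs in `X` that are related by `r`.
  obtain ⟨E', rfl, hE'⟩ : ∃ E' : List (X × X), E'.map (Prod.map num num) = E ∧
      ∀ e ∈ E', r e.1 e.2 := by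
    clear h2
    induction E with
    | nil => exact ⟨[], rfl, by simp⟩
    | cons e E ih =>
      obtain ⟨E', h, h'⟩ := ih fun e he => h1 e (by simp [he])
      obtain ⟨a, b, ha, hb, hab⟩ := h1 e (by simp)
      exact ⟨(a, b) :: E', by simp [h, ha, hb], by simpa [hab] using h'⟩
  rw [unionFind_eq, foldl_unionStep_spec num E' _ (by simpa using hN)]
  have hr : ∀ a, (List.range N).getD (num a) 0 = num a := fun a => by simp [hN a]
  constructor
  · refine Relation.EqvGen.bind ?_
    rintro a b (h | h)
    · rw [hr, hr] at h
      rw [hinj h]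
      exact .refl _
    · exact .rel _ _ (hE' _ h)
  · refine Relation.EqvGen.bind ?_
    intro a b h
    refine .rel _ _ (.inr ?_)
    obtain ⟨⟨a', b'⟩, he, h'⟩ := List.mem_map.1 (h2 a b h)
    obtain ⟨h3, h4⟩ := Prod.mk.inj h'
    rwa [hinj h3, hinj h4] at he

theorem renumber_eq_iff (L : List ℕ) (a b : ℕ) (ha : a < L.length) (hb : b < L.length) :
    (renumber L).getD a 0 = (renumber L).getD b 0 ↔ L.getD a 0 = L.getD b 0 := by
  simp only [renumber, forceList_eq forceNat_eq, List.getD_eq_getElem?_getD, List.getElem?_map]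
  simp only [ha, hb, List.getElem?_eq_getElem, Option.map_some, Option.getD_some]
  refine List.idxOf_inj ?_
  simp

namespace TangleCode

/-! ### From codes to tangles -/

section toTangle

variable {ι : Type} {c out : Colour} {w : TangleCode}

/-- The number of a disc. -/
def discNum (e : ι ≃ Fin w.arity) : Option ι → ℕ
  | none => 0
  | some i => e i + 1

theorem discNum_lt (e : ι ≃ Fin w.arity) (d : Option ι) : discNum e d < w.arity + 1 := by
  rcases d with _ | i
  · simp [discNum]
  · simp [discNum]

theorem discNum_injective (e : ι ≃ Fin w.arity) : Function.Injective (discNum e) := by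
  rintro (_ | i) (_ | j) h
  · rfl
  · simp [discNum] at h
  · simp [discNum] at h
  · simp only [discNum, Nat.add_right_cancel_iff] at h
    rw [e.injective (Fin.ext h)]

theorem exists_discNum (e : ι ≃ Fin w.arity) {k : ℕ} (hk : k < w.arity + 1) :
    ∃ d, discNum e d = k := by
  rcases k with _ | k
  · exact ⟨none, rfl⟩
  · exact ⟨some (e.symm ⟨k, by omega⟩), by simp [discNum]⟩

theorem colourAt_discNum (e : ι ≃ Fin w.arity) (d : Option ι) :
    colourAt c out (discNum e d) = discColour (fun _ => c) out d := by
  cases d <;> rfl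

theorem mem_points {x : ℕ × ℕ} :
    x ∈ w.points c out ↔ x.1 < w.arity + 1 ∧ x.2 < 2 * (colourAt c out x.1).n := by
  obtain ⟨d, p⟩ := x
  simp only [points, List.mem_flatMap, List.mem_range, List.mem_map, Prod.mk.injEq]
  constructor
  · rintro ⟨d', hd, p', hp, rfl, rfl⟩
    exact ⟨hd, hp⟩
  · rintro ⟨hd, hp⟩
    exact ⟨d, hd, p, hp, rfl, rfl⟩

theorem discNum_mem_points (e : ι ≃ Fin w.arity) (d : Option ι)
    (p : Fin (2 * (discColour (fun _ => c) out d).n)) :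
    (discNum e d, p.val) ∈ w.points c out :=
  mem_points.2 ⟨discNum_lt e d, by simpa only [colourAt_discNum e d] using p.2⟩

theorem exists_of_mem_points (e : ι ≃ Fin w.arity) {x : ℕ × ℕ} (hx : x ∈ w.points c out) :
    ∃ (d : Option ι) (p : Fin (2 * (discColour (fun _ => c) out d).n)),
      x = (discNum e d, p.val) := by
  obtain ⟨d, p⟩ := x
  obtain ⟨h1, h2⟩ := mem_points.1 hx
  obtain ⟨d, rfl⟩ := exists_discNum e h1
  simp only [colourAt_discNum e d] at h2
  exact ⟨d, ⟨p, h2⟩, rfl⟩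

/-- The diagram that is described by a code, with the input discs named by `ι`. -/
def toPreTangle (h : w.Valid c out) (e : ι ≃ Fin w.arity) : PreTangle (fun _ : ι => c) out where
  Str := Fin w.nStr
  Reg := Fin w.nReg
  str d p := ⟨w.str (discNum e d) p, h.1 _ (discNum_lt e d) _ (by
    simpa only [colourAt_discNum e d] using p.2)⟩
  reg d j := ⟨w.reg (discNum e d) j, h.2.1 _ (discNum_lt e d) _ (by
    simpa only [colourAt_discNum e d] using j.2)⟩
  side b s := ⟨w.side b s, h.2.2.1 b s s.2⟩
  shade r := w.shade r

/-- A filtered list of length one contains exactly one boundary point; the list of all points has no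
repetitions hidden from this count, so the numerical condition yields unique existence. -/
theorem toPreTangle_ends (h : w.Valid c out) (e : ι ≃ Fin w.arity) (s : Fin w.nStr) :
    (∀ d p, (toPreTangle h e).str d p ≠ s) ∨
    ∀ b, ∃! x : (d : Option ι) × Fin (2 * (discColour (fun _ : ι => c) out d).n),
      (toPreTangle h e).str x.1 x.2 = s ∧ (toPreTangle h e).dir x.1 x.2 = b := by
  obtain ⟨-, -, -, -, -, -, -, -, h, -⟩ := id h
  have hdir : ∀ d p, (toPreTangle ‹_› e).dir d p = dir c out (discNum e d) p := by
    rintro (_ | i) p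
    · rfl
    · simp [PreTangle.dir, dir, discNum, colourAt, discColour]
  rcases h s s.2 with h | h
  · refine .inl fun d p hp => h _ (discNum_mem_points e d p) (congrArg Fin.val hp)
  · refine .inr fun b => ?_
    obtain ⟨x, hx⟩ := List.length_eq_one_iff.1 (h b)
    have hmem : ∀ y, (y ∈ w.points c out ∧ w.str y.1 y.2 = s ∧ dir c out y.1 y.2 = b) ↔ y = x := by
      intro y
      rw [show y = x ↔ y ∈ [x] from List.mem_singleton.symm, ← hx, List.mem_filter]
      simp
    obtain ⟨h1, h2, h3⟩ := (hmem x).2 rfl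
    obtain ⟨d, p, rfl⟩ := exists_of_mem_points e h1
    refine ⟨⟨d, p⟩, ⟨Fin.ext h2, (hdir d p).trans h3⟩, ?_⟩
    rintro ⟨d', p'⟩ ⟨h4, h5⟩
    have := (hmem (discNum e d', p')).1 ⟨discNum_mem_points e d' p', congrArg Fin.val h4,
      (hdir d' p').symm.trans h5⟩
    obtain ⟨h6, h7⟩ := Prod.mk.inj this
    obtain rfl := discNum_injective e h6
    rw [Fin.ext h7]

/-- Discs, strings and regions are numbered consecutively. By `unionFind_spec` the equality of all
labels with the label of the outer disc is connectedness. -/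
theorem toPreTangle_connected (h : w.Valid c out) (e : ι ≃ Fin w.arity) (x) :
    Relation.EqvGen (toPreTangle h e).Incident (.inl none) x := by
  have hc := h.2.2.2.2.2.2.2.2.2.1
  let num : Option ι ⊕ (Fin w.nStr ⊕ Fin w.nReg) → ℕ :=
    Sum.elim (discNum e) (Sum.elim (fun s => w.arity + 1 + s) fun r => w.arity + 1 + w.nStr + r)
  have hnum : ∀ x, num x < w.arity + 1 + w.nStr + w.nReg := by
    rintro (d | s | r)
    · have := discNum_lt e d
      simp only [num, Sum.elim_inl]
      omega
    · have := s.2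
      simp only [num, Sum.elim_inl, Sum.elim_inr]
      omega
    · have := r.2
      simp only [num, Sum.elim_inr]
      omega
  have hinj : Function.Injective num := by
    rintro (d | s | r) (d' | s' | r') hx
    all_goals
      simp only [num, Sum.elim_inl, Sum.elim_inr] at hx
    · rw [discNum_injective e hx]
    · have := discNum_lt e d
      omega
    · have := discNum_lt e d
      omega
    · have := discNum_lt e d'
      omega
    · rw [Fin.ext (show s.val = s' by omega)]
    · have := s.2
      omega
    · have := discNum_lt e d'
      omega
    · have := s'.2
      omega
    · rw [Fin.ext (show r.val = r' by omega)]
  refine (unionFind_spec (toPreTangle h e).Incident num hinj _ hnum (w.incidences c out) ?_ ?_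
    (.inl none) x).1 ((hc _ (hnum x)).symm)
  · intro a ha
    simp only [incidences, List.mem_append, List.mem_map, List.mem_flatMap, List.mem_range] at ha
    rcases ha with (⟨x, hx, rfl⟩ | ⟨d, hd, j, hj, rfl⟩) | ⟨s, hs, b, -, rfl⟩
    · obtain ⟨d, p, rfl⟩ := exists_of_mem_points e hx
      exact ⟨_, _, rfl, rfl, .disc_str d p⟩
    · obtain ⟨d, rfl⟩ := exists_discNum e hd
      rw [colourAt_discNum e d] at hj
      exact ⟨.inl d, _, rfl, rfl, PreTangle.Incident.disc_reg (T := toPreTangle h e) d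
        (⟨j, hj⟩ : Fin (2 * (discColour (fun _ : ι => c) out d).n + 1))⟩
    · exact ⟨.inr (.inl (⟨s, hs⟩ : Fin w.nStr)), _, rfl, rfl,
        PreTangle.Incident.str_reg (T := toPreTangle h e) b (⟨s, hs⟩ : Fin w.nStr)⟩
  · rintro _ _ (⟨d, p⟩ | ⟨d, j⟩ | ⟨b, s⟩)
    · simp only [incidences, List.mem_append, List.mem_map, List.mem_flatMap, List.mem_range]
      exact .inl (.inl ⟨_, discNum_mem_points e d p, rfl⟩)
    · simp only [incidences, List.mem_append, List.mem_map, List.mem_flatMap, List.mem_range]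
      refine .inl (.inr ⟨_, discNum_lt e d, j, ?_, rfl⟩)
      rw [colourAt_discNum e d]
      exact j.2
    · simp only [incidences, List.mem_append, List.mem_map, List.mem_flatMap, List.mem_range]
      exact .inr ⟨s.val, s.2, b, by cases b <;> simp, rfl⟩

/-- Two discs or strings have the same final label exactly when they lie in one component, and every
label in the list is attained; hence the components are in bijection with the distinct labels. -/
theorem toPreTangle_card_component (h : w.Valid c out) (e : ι ≃ Fin w.arity) :
    Nat.card (toPreTangle h e).Component =
      (unionFind (w.arity + 1 + w.nStr) (w.touches c out)).dedup.length := by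
  set L := unionFind (w.arity + 1 + w.nStr) (w.touches c out) with hL
  have hlen : L.length = w.arity + 1 + w.nStr := length_unionFind _ _
  let num : Option ι ⊕ Fin w.nStr → ℕ := Sum.elim (discNum e) fun s => w.arity + 1 + s
  have hnum : ∀ x, num x < w.arity + 1 + w.nStr := by
    rintro (d | s)
    · have := discNum_lt e d
      simp only [num, Sum.elim_inl]
      omega
    · have := s.2
      simp only [num, Sum.elim_inr]
      omega
  have hinj : Function.Injective num := by
    rintro (d | s) (d' | s') hx
    all_goals
      simp only [num, Sum.elim_inl, Sum.elim_inr] at hx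
    · rw [discNum_injective e hx]
    · have := discNum_lt e d
      omega
    · have := discNum_lt e d'
      omega
    · rw [Fin.ext (show s.val = s' by omega)]
  have hsurj : ∀ k < w.arity + 1 + w.nStr, ∃ x, num x = k := by
    intro k hk
    by_cases hk' : k < w.arity + 1
    · obtain ⟨d, hd⟩ := exists_discNum e hk'
      exact ⟨.inl d, hd⟩
    · exact ⟨.inr ⟨k - (w.arity + 1), by omega⟩, by simp only [num, Sum.elim_inr]; omega⟩
  have key := unionFind_spec (toPreTangle h e).Touch num hinj _ hnum (w.touches c out) (by
      intro a ha
      obtain ⟨x, hx, rfl⟩ := List.mem_map.1 ha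
      obtain ⟨d, p, rfl⟩ := exists_of_mem_points e hx
      exact ⟨_, _, rfl, rfl, .mk d p⟩) (by
      rintro _ _ ⟨d, p⟩
      exact List.mem_map.2 ⟨_, discNum_mem_points e d p, rfl⟩)
  rw [← hL] at key
  have hmem : ∀ x, L.getD (num x) 0 ∈ L.toFinset := by
    intro x
    rw [List.mem_toFinset, List.getD_eq_getElem _ _ (by rw [hlen]; exact hnum x)]
    exact List.getElem_mem _
  let F : (toPreTangle h e).Component → L.toFinset :=
    Quot.lift (fun x => ⟨L.getD (num x) 0, hmem x⟩) fun a b hab =>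
      Subtype.ext ((key a b).2 (.rel _ _ hab))
  have hF : Function.Bijective F := by
    constructor
    · rintro ⟨a⟩ ⟨b⟩ hab
      exact Quot.eqvGen_sound ((key a b).1 (congrArg Subtype.val hab))
    · rintro ⟨z, hz⟩
      obtain ⟨k, hk, rfl⟩ := List.mem_iff_getElem.1 (List.mem_toFinset.1 hz)
      obtain ⟨x, rfl⟩ := hsurj k (hlen ▸ hk)
      exact ⟨Quot.mk _ x, Subtype.ext (List.getD_eq_getElem _ _ hk)⟩
  rw [Nat.card_congr (Equiv.ofBijective F hF), Nat.card_eq_fintype_card, Fintype.card_coe,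
    List.card_toFinset]

/-- The tangle that is described by a code, with the input discs named by `ι`. -/
def toTangle [Fintype ι] (h : w.Valid c out) (e : ι ≃ Fin w.arity) :
    Tangle (fun _ : ι => c) out where
  toPreTangle := toPreTangle h e
  finite_str := inferInstanceAs (Finite (Fin w.nStr))
  finite_reg := inferInstanceAs (Finite (Fin w.nReg))
  reg_last d := Fin.ext (by
    have := h.2.2.2.1 _ (discNum_lt e d)
    rw [colourAt_discNum e d] at this
    exact this)
  reg_before d p := Fin.ext (by
    have := h.2.2.2.2.1 _ (discNum_lt e d) p (mem_points.1 (discNum_mem_points e d p)).2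
    rw [colourAt_discNum e d] at this
    exact this)
  reg_after d p := Fin.ext (by
    have := h.2.2.2.2.2.1 _ (discNum_lt e d) p (mem_points.1 (discNum_mem_points e d p)).2
    rw [colourAt_discNum e d] at this
    exact this)
  shade_reg d j := by
    have := h.2.2.2.2.2.2.1 _ (discNum_lt e d) j (by rw [colourAt_discNum e d]; exact j.2)
    rw [colourAt_discNum e d] at this
    exact this
  shade_side b s := h.2.2.2.2.2.2.2.1 b (Fin.val (n := w.nStr) s) s.2
  ends := toPreTangle_ends h e
  connected := toPreTangle_connected h e
  euler := by
    have h1 := h.2.2.2.2.2.2.2.2.2.2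
    have h2 : Fintype.card ι = w.arity := by rw [Fintype.card_congr e, Fintype.card_fin]
    have h3 : Nat.card (toPreTangle h e).Reg = w.nReg := Nat.card_fin _
    rw [toPreTangle_card_component, h2, h3, h1, Finset.sum_const, Finset.card_univ, h2,
      smul_eq_mul]

end toTangle

end TangleCode

namespace TangleCode

/-! ### Numbering of a disjoint union -/

section offsets

variable (f : TangleCode → ℕ) (us : List TangleCode)

theorem sum_take_succ {i : ℕ} (hi : i < us.length) :
    ((us.take (i + 1)).map f).sum = ((us.take i).map f).sum + f (nth us i) := by
  rw [List.take_succ_eq_append_getElem hi, List.map_append, List.sum_append]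
  simp [nth, hi]

theorem sum_take_add_le {i j : ℕ} (hij : i < j) (hj : j ≤ us.length) :
    ((us.take i).map f).sum + f (nth us i) ≤ ((us.take j).map f).sum := by
  induction j with
  | zero => omega
  | succ j ih =>
    rw [sum_take_succ f us (by omega)]
    rcases Nat.lt_succ_iff_lt_or_eq.1 hij with h | rfl
    · exact (ih h (by omega)).trans (Nat.le_add_right _ _)
    · exact le_rfl

theorem sum_take_injective {i j a b : ℕ} (hi : i < us.length) (hj : j < us.length)
    (ha : a < f (nth us i)) (hb : b < f (nth us j))
    (h : ((us.take i).map f).sum + a = ((us.take j).map f).sum + b) : i = j ∧ a = b := by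
  rcases lt_trichotomy i j with hij | rfl | hij
  · have := sum_take_add_le f us hij hj.le
    omega
  · exact ⟨rfl, by omega⟩
  · have := sum_take_add_le f us hij hi.le
    omega

theorem exists_of_lt_sum_take {m k : ℕ} (hm : m ≤ us.length)
    (hk : k < ((us.take m).map f).sum) :
    ∃ i < m, ∃ a < f (nth us i), ((us.take i).map f).sum + a = k := by
  induction m with
  | zero => simp at hk
  | succ m ih =>
    by_cases h : k < ((us.take m).map f).sum
    · obtain ⟨i, hi, a, ha, h'⟩ := ih (by omega) h
      exact ⟨i, by omega, a, ha, h'⟩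
    · rw [sum_take_succ f us (by omega)] at hk
      exact ⟨m, by omega, k - ((us.take m).map f).sum, by omega, by omega⟩

/-- The numbering of a disjoint union. -/
def unionNum (n m : ℕ) : Fin n ⊕ ((i : Fin m) × Fin (f (nth us i))) → ℕ :=
  Sum.elim Fin.val fun x => n + ((us.take x.1).map f).sum + x.2

theorem unionNum_lt (n m : ℕ) (hm : us.length = m) (x) :
    unionNum f us n m x < n + ((us.take m).map f).sum := by
  rcases x with x | ⟨i, a⟩
  · simp only [unionNum, Sum.elim_inl]
    omega
  · have := sum_take_add_le f us i.2 hm.ge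
    simp only [unionNum, Sum.elim_inr]
    omega

theorem unionNum_injective (n m : ℕ) (hm : us.length = m) :
    Function.Injective (unionNum f us n m) := by
  rintro (x | ⟨i, a⟩) (y | ⟨j, b⟩) h
  all_goals
    simp only [unionNum, Sum.elim_inl, Sum.elim_inr] at h
  · rw [Fin.ext h]
  · omega
  · omega
  · obtain ⟨h1, h2⟩ := sum_take_injective f us (hm ▸ i.2) (hm ▸ j.2) a.2 b.2 (by omega)
    obtain rfl := Fin.ext h1
    rw [Fin.ext h2]

/-- The numbering of the input discs of a composite. -/
noncomputable def discEquiv (m k : ℕ) (hm : us.length = m) (hk : k = discOff us m) :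
    ((i : Fin m) × Fin (nth us i).arity) ≃ Fin k :=
  Equiv.ofBijective (fun x => ⟨discOff us x.1 + x.2, by
    have := sum_take_add_le arity us x.1.2 hm.ge
    have := x.2.2
    simp only [discOff] at *
    omega⟩) (by
    constructor
    · rintro ⟨i, a⟩ ⟨j, b⟩ h
      obtain ⟨h1, h2⟩ := sum_take_injective arity us (hm ▸ i.2) (hm ▸ j.2) a.2 b.2
        (congrArg Fin.val h)
      obtain rfl := Fin.ext h1
      rw [Fin.ext h2]
    · rintro ⟨q, hq⟩
      obtain ⟨i, hi, a, ha, h⟩ := exists_of_lt_sum_take arity us hm.ge (hk ▸ hq)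
      exact ⟨⟨⟨i, hi⟩, ⟨a, ha⟩⟩, Fin.ext h⟩)

end offsets

/-! ### Correctness of the composition of codes -/

section composite

variable {c c' out : Colour} {t w : TangleCode} {us : List TangleCode}

/-- This is `unionFind_spec` for the disjoint union of the strings, numbered by `unionNum`;
`renumber` neither merges nor splits classes. -/
theorem strClass_eq_iff (ht : t.Valid c' out) (hu : ∀ i : Fin t.arity, (nth us i).Valid c c')
    (hlen : us.length = t.arity)
    (a b : Fin t.nStr ⊕ ((i : Fin t.arity) × Fin (nth us i).nStr)) :
    (strClass c' t us).getD (unionNum nStr us t.nStr t.arity a) 0 =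
      (strClass c' t us).getD (unionNum nStr us t.nStr t.arity b) 0 ↔
    Relation.EqvGen (Tangle.GlueStr (t.toTangle ht (Equiv.refl _))
      fun i => (nth us i).toTangle (hu i) (Equiv.refl _)) a b := by
  have hlt := unionNum_lt nStr us t.nStr t.arity hlen
  rw [strClass, renumber_eq_iff, strOff]
  · refine unionFind_spec (X := Fin t.nStr ⊕ ((i : Fin t.arity) × Fin (nth us i).nStr)) _ _
      (unionNum_injective nStr us _ _ hlen) _ hlt _ ?_ ?_ a b
    · intro e he
      simp only [strGlue, List.mem_flatMap, List.mem_map, List.mem_range] at he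
      obtain ⟨i, hi, p, hp, rfl⟩ := he
      exact ⟨_, _, rfl, rfl,
        .mk (T := t.toTangle ht (Equiv.refl _)) (⟨i, hi⟩ : Fin t.arity) ⟨p, hp⟩⟩
    · rintro _ _ ⟨i, p⟩
      simp only [strGlue, List.mem_flatMap, List.mem_map, List.mem_range]
      exact ⟨i, i.2, p, p.2, rfl⟩
  · rw [length_unionFind]
    exact hlt a
  · rw [length_unionFind]
    exact hlt b

theorem regClass_eq_iff (ht : t.Valid c' out) (hu : ∀ i : Fin t.arity, (nth us i).Valid c c')
    (hlen : us.length = t.arity)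
    (a b : Fin t.nReg ⊕ ((i : Fin t.arity) × Fin (nth us i).nReg)) :
    (regClass c' t us).getD (unionNum nReg us t.nReg t.arity a) 0 =
      (regClass c' t us).getD (unionNum nReg us t.nReg t.arity b) 0 ↔
    Relation.EqvGen (Tangle.GlueReg (t.toTangle ht (Equiv.refl _))
      fun i => (nth us i).toTangle (hu i) (Equiv.refl _)) a b := by
  have hlt := unionNum_lt nReg us t.nReg t.arity hlen
  rw [regClass, renumber_eq_iff, regOff]
  · refine unionFind_spec (X := Fin t.nReg ⊕ ((i : Fin t.arity) × Fin (nth us i).nReg)) _ _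
      (unionNum_injective nReg us _ _ hlen) _ hlt _ ?_ ?_ a b
    · intro e he
      simp only [regGlue, List.mem_flatMap, List.mem_map, List.mem_range] at he
      obtain ⟨i, hi, p, hp, rfl⟩ := he
      exact ⟨_, _, rfl, rfl,
        .mk (T := t.toTangle ht (Equiv.refl _)) (⟨i, hi⟩ : Fin t.arity) ⟨p, hp⟩⟩
    · rintro _ _ ⟨i, p⟩
      simp only [regGlue, List.mem_flatMap, List.mem_map, List.mem_range]
      exact ⟨i, i.2, p, p.2, rfl⟩
  · rw [length_unionFind]
    exact hlt a
  · rw [length_unionFind]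
    exact hlt b

/-- The two lists of classes define the maps of strings and regions. That their fibres are the
gluing classes is `strClass_eq_iff` and `regClass_eq_iff`; every other requirement is one of the
checked conditions. -/
theorem Composite.isComposite (h : Composite c c' out t us w) (ht : t.Valid c' out)
    (hu : ∀ i : Fin t.arity, (nth us i).Valid c c') (hw : w.Valid c out) :
    (t.toTangle ht (Equiv.refl _)).IsComposite
      (fun i => (nth us i).toTangle (hu i) (Equiv.refl _))
      (w.toTangle hw (discEquiv us t.arity w.arity h.1 h.2.1)) := by
  obtain ⟨hlen, -, s1, s2, r1, r2, s3, r3, o1, o2, o3, o4, d1, d2⟩ := id h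
  refine ⟨fun a => (⟨(strClass c' t us).getD (unionNum nStr us t.nStr t.arity a) 0, ?_⟩ :
      Fin w.nStr),
    fun a => (⟨(regClass c' t us).getD (unionNum nReg us t.nReg t.arity a) 0, ?_⟩ : Fin w.nReg),
    ?_, ?_, ?_, ?_, ?_, ?_, ?_, ?_, ?_, ?_⟩
  · rcases a with s | ⟨i, s⟩
    · exact s1 (Fin.val (n := t.nStr) s) s.2
    · exact s2 i i.2 (Fin.val (n := (nth us i).nStr) s) s.2
  · rcases a with s | ⟨i, s⟩
    · exact r1 (Fin.val (n := t.nReg) s) s.2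
    · exact r2 i i.2 (Fin.val (n := (nth us i).nReg) s) s.2
  · rintro ⟨q, hq⟩
    rcases s3 q hq with ⟨s, hs, h'⟩ | ⟨i, hi, s, hs, h'⟩
    · exact ⟨.inl (⟨s, hs⟩ : Fin t.nStr), Fin.ext h'⟩
    · exact ⟨.inr ⟨⟨i, hi⟩, (⟨s, hs⟩ : Fin (nth us i).nStr)⟩, Fin.ext h'⟩
  · rintro ⟨q, hq⟩
    rcases r3 q hq with ⟨s, hs, h'⟩ | ⟨i, hi, s, hs, h'⟩
    · exact ⟨.inl (⟨s, hs⟩ : Fin t.nReg), Fin.ext h'⟩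
    · exact ⟨.inr ⟨⟨i, hi⟩, (⟨s, hs⟩ : Fin (nth us i).nReg)⟩, Fin.ext h'⟩
  · intro a b
    exact Fin.ext_iff.trans (strClass_eq_iff ht hu hlen a b)
  · intro a b
    exact Fin.ext_iff.trans (regClass_eq_iff ht hu hlen a b)
  · intro p
    exact Fin.ext (o1 p p.2)
  · intro i k p
    exact Fin.ext (o2 i i.2 k k.2 p p.2)
  · intro j
    exact Fin.ext (o3 j j.2)
  · intro i k j
    exact Fin.ext (o4 i i.2 k k.2 j j.2)
  · intro b s
    exact Fin.ext (d1 b (Fin.val (n := t.nStr) s) s.2)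
  · intro b i s
    exact Fin.ext (d2 b i i.2 (Fin.val (n := (nth us i).nStr) s) s.2)

end composite

end TangleCode

/-! ### Comparison of tangles that are given by codes -/

/-- The bijection that is given by a list of numbers. -/
noncomputable def equivOfList (L : List ℕ) {n n' : ℕ} (hn : n = n')
    (hlt : ∀ i < n, L.getD i 0 < n)
    (hinj : ∀ i < n, ∀ j < n, L.getD i 0 = L.getD j 0 → i = j) : Fin n ≃ Fin n' :=
  (Equiv.ofBijective (fun i : Fin n => (⟨L.getD i 0, hlt i i.2⟩ : Fin n))
    (Finite.injective_iff_bijective.1 fun i j h =>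
      Fin.ext (hinj i i.2 j j.2 (congrArg Fin.val h)))).trans (finCongr hn)

namespace TangleCode

section matching

variable {m sph : Bool} {c out out' : Colour} {w w' : TangleCode} {P FS FR : List ℕ}

/-- The bijection of the input discs. -/
noncomputable def Matches.disc (h : Matches m sph c out w w' P FS FR) :
    Fin w'.arity ≃ Fin w.arity :=
  equivOfList P h.1.symm (fun i hi => h.1 ▸ h.2.2.2.1 i (h.1 ▸ hi))
    fun i hi j hj => h.2.2.2.2.1 i (h.1 ▸ hi) j (h.1 ▸ hj)

/-- The bijection of the strings. -/
noncomputable def Matches.strEquiv (h : Matches m sph c out w w' P FS FR) :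
    Fin w.nStr ≃ Fin w'.nStr :=
  equivOfList FS h.2.1 h.2.2.2.2.2.1 h.2.2.2.2.2.2.1

/-- The bijection of the regions. -/
noncomputable def Matches.regEquiv (h : Matches m sph c out w w' P FS FR) :
    Fin w.nReg ≃ Fin w'.nReg :=
  equivOfList FR h.2.2.1 h.2.2.2.2.2.2.2.1 h.2.2.2.2.2.2.2.2.1

/-- The permutation of the input discs is absorbed into the naming `h.disc` of the discs of `w`, so
the identity relabelling suffices. -/
theorem Matches.isRelabelling (h : Matches false false c out w w' P FS FR)
    (hw : w.Valid c out) (hw' : w'.Valid c out) :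
    (w.toTangle hw h.disc).IsRelabelling (Equiv.refl _) (w'.toTangle hw' (Equiv.refl _)) := by
  obtain ⟨h1, -, -, -, -, -, -, -, -, ho, hs, hr, hd⟩ := id h
  obtain ⟨ho, ho'⟩ := ho.resolve_left (by simp)
  refine ⟨h.strEquiv, h.regEquiv, ?_, ?_, ?_, ?_, ?_⟩
  · exact fun p => Fin.ext (ho p p.2)
  · exact fun i p => Fin.ext (hs i (i.2.trans_eq h1.symm) p p.2)
  · exact fun j => Fin.ext (ho' j j.2)
  · exact fun i j => Fin.ext (hr i (i.2.trans_eq h1.symm) j j.2)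
  · exact fun b s => Fin.ext (hd b (Fin.val (n := w.nStr) s) s.2)

theorem Matches.isReflection (h : Matches true false c out w w' P FS FR)
    (hw : w.Valid c out) (hw' : w'.Valid c out) :
    (w.toTangle hw h.disc).IsReflection (w'.toTangle hw' (Equiv.refl _)) := by
  obtain ⟨h1, -, -, -, -, -, -, -, -, ho, hs, hr, hd⟩ := id h
  obtain ⟨ho, ho'⟩ := ho.resolve_left (by simp)
  have hrev : ∀ {n : ℕ} (p : Fin n), mirror true (n - 1) p = p.rev := by
    intro n p
    simp only [mirror, if_true, Fin.val_rev]
    omega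
  have hrev' : ∀ {n : ℕ} (p : Fin (n + 1)), mirror true n p = p.rev := fun p => hrev p
  refine ⟨h.strEquiv, h.regEquiv, ?_, ?_, ?_⟩
  · rintro (_ | i) p
    · exact Fin.ext ((ho p p.2).trans (congrArg (fun q => FS.getD (w.str 0 q) 0) (hrev p)))
    · exact Fin.ext ((hs i (i.2.trans_eq h1.symm) p p.2).trans
        (congrArg (fun q => FS.getD (w.str (P.getD i 0 + 1) q) 0) (hrev p)))
  · rintro (_ | i) p
    · exact Fin.ext ((ho' p p.2).trans (congrArg (fun q => FR.getD (w.reg 0 q) 0) (hrev' p)))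
    · exact Fin.ext ((hr i (i.2.trans_eq h1.symm) p p.2).trans
        (congrArg (fun q => FR.getD (w.reg (P.getD i 0 + 1) q) 0) (hrev' p)))
  · exact fun b s => Fin.ext (hd b (Fin.val (n := w.nStr) s) s.2)

theorem Matches.isSphereIsotopic {b b' : Bool} (h : Matches false true c out w w' P FS FR)
    (hw : w.Valid c ⟨0, b⟩) (hw' : w'.Valid c ⟨0, b'⟩) :
    (w.toTangle hw h.disc).IsSphereIsotopic (w'.toTangle hw' (Equiv.refl _)) := by
  obtain ⟨h1, -, -, -, -, -, -, -, -, -, hs, hr, hd⟩ := id h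
  refine ⟨h.strEquiv, h.regEquiv, ?_, ?_, ?_⟩
  · exact fun i p => Fin.ext (hs i (i.2.trans_eq h1.symm) p p.2)
  · exact fun i j => Fin.ext (hr i (i.2.trans_eq h1.symm) j j.2)
  · exact fun b s => Fin.ext (hd b (Fin.val (n := w.nStr) s) s.2)

end matching

end TangleCode

theorem getD_map_finRange {α : Type*} {n : ℕ} (f : Fin n → α) (i : Fin n) (d : α) :
    ((List.finRange n).map f).getD i d = f i := by
  rw [List.getD_eq_getElem _ _ (by simp)]
  simp

/-- The lists `ss` and `rs` run through all strings and regions without repetition, so positions in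
them give bijections with the numbers used in the tables. -/
theorem Tangle.isRelabelling_encode {ι : Type} [Fintype ι] {c out : Colour}
    (T : Tangle (fun _ : ι => c) out) {m : ℕ} (e : ι ≃ Fin m) (e' : Fin m → ι)
    (he : ∀ i, e' (e i) = i) (ss : List T.Str) (rs : List T.Reg) [DecidableEq T.Str]
    [DecidableEq T.Reg] (hss : ss.Nodup) (hss' : ∀ s, s ∈ ss) (hrs : rs.Nodup)
    (hrs' : ∀ r, r ∈ rs) (h : (encode T.toPreTangle e' ss rs).Valid c out) :
    T.IsRelabelling (Equiv.refl ι)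
      ((encode T.toPreTangle e' ss rs).toTangle (ι := ι) h e) := by
  refine ⟨(List.Nodup.getEquivOfForallMemList ss hss hss').symm,
    (List.Nodup.getEquivOfForallMemList rs hrs hrs').symm, ?_, ?_, ?_, ?_, ?_⟩
  · exact fun p => Fin.ext (getD_map_finRange (fun p => ss.idxOf (T.str none p)) p 0)
  · intro i p
    refine Fin.ext ((congrArg (fun l : List ℕ => l.getD p.val 0) (getD_map_finRange
      (fun i => (List.finRange (2 * c.n)).map fun p => ss.idxOf (T.str (some (e' i)) p))
      (e i) [])).trans ((getD_map_finRange (fun p => ss.idxOf (T.str (some (e' (e i))) p))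
      p 0).trans ?_))
    rw [he i]
    rfl
  · exact fun p => Fin.ext (getD_map_finRange (fun p => rs.idxOf (T.reg none p)) p 0)
  · intro i p
    refine Fin.ext ((congrArg (fun l : List ℕ => l.getD p.val 0) (getD_map_finRange
      (fun i => (List.finRange (2 * c.n + 1)).map fun p => rs.idxOf (T.reg (some (e' i)) p))
      (e i) [])).trans ((getD_map_finRange (fun p => rs.idxOf (T.reg (some (e' (e i))) p))
      p 0).trans ?_))
    rw [he i]
    rfl
  · intro b s
    refine Fin.ext ?_
    have hs : ss.idxOf s < ss.length := List.idxOf_lt_length_iff.2 (hss' s)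
    change (encode T.toPreTangle e' ss rs).side b (ss.idxOf s) = rs.idxOf (T.side b s)
    unfold TangleCode.side encode
    simp only
    rw [List.getD_eq_getElem _ _ (by simpa using hs)]
    cases b <;> simp

/-! ### The action of codes on a planar algebra. -/

namespace PlanarAlgebra

variable (S : PlanarAlgebra.{u})

/-- The action of a tangle that is given by a code. -/
noncomputable def act (w : TangleCode) {c : Colour} (out : Colour) (x : Fin w.arity → S.V c) :
    S.V out :=
  if h : w.Valid c out then S.Z (w.toTangle h (Equiv.refl _)) x else 0

theorem act_of_valid {w : TangleCode} {c out : Colour} (h : w.Valid c out)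
    (x : Fin w.arity → S.V c) : S.act w out x = S.Z (w.toTangle h (Equiv.refl _)) x := dif_pos h

theorem Z_toTangle {ι : Type} [Fintype ι] {w : TangleCode} {c out : Colour} (h : w.Valid c out)
    (e : ι ≃ Fin w.arity) (x : Fin w.arity → S.V c) :
    S.Z (w.toTangle h e) (fun i => x (e i)) = S.act w out x := by
  rw [act_of_valid S h]
  exact S.Z_relabel e (w.toTangle h (Equiv.refl _)) (w.toTangle h e)
    ⟨Equiv.refl _, Equiv.refl _, fun _ => rfl, fun _ _ => rfl, fun _ => rfl, fun _ _ => rfl,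
      fun _ _ => rfl⟩ x

/-- The hypothesis `hcol` and the cast serve the diagrams without input discs: there the colouring
is `Fin.elim0`, which is a constant function only by a proof. -/
theorem act_encode {ι : Type} [Fintype ι] {c out : Colour} {col : ι → Colour}
    (hcol : col = fun _ => c) (T : Tangle col out) {m : ℕ} (e : ι ≃ Fin m) (e' : Fin m → ι)
    (he : ∀ i, e' (e i) = i) (ss : List T.Str) (rs : List T.Reg) [DecidableEq T.Str]
    [DecidableEq T.Reg] (hss : ss.Nodup) (hss' : ∀ s, s ∈ ss) (hrs : rs.Nodup)
    (hrs' : ∀ r, r ∈ rs) (h : (Tangle.encode T.toPreTangle e' ss rs).Valid c out)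
    (x : Fin m → S.V c) :
    S.act (Tangle.encode T.toPreTangle e' ss rs) out x =
      S.Z T (fun i => cast (congrArg S.V (congrFun hcol i).symm) (x (e i))) := by
  subst hcol
  refine (S.Z_toTangle h e x).symm.trans ?_
  exact S.Z_relabel (Equiv.refl ι) T _
    (T.isRelabelling_encode e e' he ss rs hss hss' hrs hrs' h) (fun i => x (e i))

/-- The axiom `Z_comp`, with the input discs of the composite renumbered consecutively; `hxy` says
that the labels are distributed in this order. -/
theorem act_compose {c c' out : Colour} {t w : TangleCode} {us : List TangleCode}
    (ht : t.Valid c' out) (hu : ∀ i : Fin t.arity, (TangleCode.nth us i).Valid c c')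
    (hw : w.Valid c out) (h : TangleCode.Composite c c' out t us w)
    (x : (i : Fin t.arity) → Fin (TangleCode.nth us i).arity → S.V c) (y : Fin w.arity → S.V c)
    (hxy : ∀ i k hk, x i k = y ⟨TangleCode.discOff us i + k, hk⟩) :
    S.act w out y = S.act t out (fun i => S.act (TangleCode.nth us i) c' (x i)) := by
  rw [act_of_valid S ht]
  simp only [act_of_valid S (hu _)]
  rw [← S.Z_toTangle hw (TangleCode.discEquiv us t.arity w.arity h.1 h.2.1)]
  rw [S.Z_comp _ _ _ (h.isComposite ht hu hw)]
  congr 1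
  funext i
  congr 1
  funext k
  exact (hxy i k _).symm

end PlanarAlgebra

namespace BoxTerm

variable (S : PlanarAlgebra.{u}) {c : Colour}

/-- The element that is described by a term. -/
noncomputable def eval (x : ℕ → S.V c) : {out : Colour} → BoxTerm c out → S.V out
  | _, var i => x i
  | _, node out t args => S.act t out fun i => (args i).eval x

end BoxTerm

theorem mem_gapList {L n : ℕ} (r : Gap L n) : r ∈ gapList L n := by
  refine List.mem_filterMap.2
    ⟨r.1, List.mem_product.2 ⟨List.mem_finRange _, List.mem_finRange _⟩, ?_⟩
  rw [dif_pos r.2]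

theorem nodup_gapList (L n : ℕ) : (gapList L n).Nodup := by
  refine List.Nodup.filterMap ?_ ((List.nodup_finRange _).product (List.nodup_finRange _))
  intro a b r ha hb
  simp only [Option.mem_def] at ha hb
  split_ifs at ha hb
  simp only [Option.some.injEq] at ha hb
  rw [← hb] at ha
  exact congrArg Subtype.val ha

theorem mem_sumBoolList {k : ℕ} (s : Fin k ⊕ Bool) : s ∈ sumBoolList k := by
  rcases s with s | s
  · simp [sumBoolList]
  · cases s <;> simp [sumBoolList]

theorem nodup_sumBoolList (k : ℕ) : (sumBoolList k).Nodup := by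
  rw [sumBoolList, List.nodup_append]
  refine ⟨List.Nodup.map Sum.inl_injective (List.nodup_finRange _), by simp, ?_⟩
  intro a ha
  obtain ⟨a, -, rfl⟩ := List.mem_map.1 ha
  simp

theorem mem_optionList {α : Type} {l : List α} (h : ∀ a, a ∈ l) (a : Option α) :
    a ∈ optionList l := by
  rcases a with _ | a
  · simp [optionList]
  · simp [optionList, h a]

theorem nodup_optionList {α : Type} {l : List α} (h : l.Nodup) : (optionList l).Nodup :=
  List.nodup_cons.2 ⟨by simp, h.map (Option.some_injective _)⟩

/-! ### The codes of the basic tangles act like the tangles. -/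

namespace PlanarAlgebra

variable (S : PlanarAlgebra.{u})

theorem act_stack {c : Colour} {m : ℕ} (h : (TangleCode.stack c m).Valid c c)
    (x : Fin m → S.V c) : S.act (TangleCode.stack c m) c x = S.Z (stack c m) x := by
  let _ : DecidableEq (stack c m).Str := inferInstanceAs (DecidableEq (Fin (m + 1) × Fin c.n))
  let _ : DecidableEq (stack c m).Reg := inferInstanceAs (DecidableEq (Gap m c.n))
  exact S.act_encode rfl (stack c m) (Equiv.refl _) id (fun _ => rfl)
    ((List.finRange (m + 1)).product (List.finRange c.n)) (gapList m c.n)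
    ((List.nodup_finRange _).product (List.nodup_finRange _))
    (fun s => List.mem_product.2 ⟨List.mem_finRange _, List.mem_finRange _⟩)
    (nodup_gapList _ _) mem_gapList h x

/-- The unique type with one element and `Fin 1`. -/
def unitEquiv : Unit ≃ Fin 1 where
  toFun _ := 0
  invFun _ := ()
  left_inv _ := rfl
  right_inv _ := Subsingleton.elim _ _

theorem act_trace {c : Colour} (h : (TangleCode.trace c).Valid c ⟨0, c.shaded⟩)
    (x : S.V c) : S.act (TangleCode.trace c) ⟨0, c.shaded⟩ (fun _ => x) = S.tr x := by
  let _ : DecidableEq (traceTangle c).Str := inferInstanceAs (DecidableEq (Fin c.n))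
  let _ : DecidableEq (traceTangle c).Reg := inferInstanceAs (DecidableEq (Fin (c.n + 1)))
  exact S.act_encode rfl (traceTangle c) unitEquiv (fun _ => ()) (fun _ => rfl)
    (List.finRange _) (List.finRange _) (List.nodup_finRange _) List.mem_finRange
    (List.nodup_finRange _) List.mem_finRange h (fun _ => x)

theorem act_incl {c : Colour} (h : (TangleCode.incl c).Valid c ⟨c.n + 1, c.shaded⟩)
    (x : S.V c) : S.act (TangleCode.incl c) ⟨c.n + 1, c.shaded⟩ (fun _ => x) = S.incl x := by
  let _ : DecidableEq (inclTangle c).Str :=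
    inferInstanceAs (DecidableEq (Option (Fin 2 × Fin c.n)))
  let _ : DecidableEq (inclTangle c).Reg := inferInstanceAs (DecidableEq (Option (Gap 1 c.n)))
  exact S.act_encode rfl (inclTangle c) unitEquiv (fun _ => ()) (fun _ => rfl)
    (optionList ((List.finRange 2).product (List.finRange c.n))) (optionList (gapList 1 c.n))
    (nodup_optionList ((List.nodup_finRange _).product (List.nodup_finRange _)))
    (mem_optionList fun s => List.mem_product.2 ⟨List.mem_finRange _, List.mem_finRange _⟩)
    (nodup_optionList (nodup_gapList _ _)) (mem_optionList mem_gapList) h (fun _ => x)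

theorem act_cupCap {c : Colour} {m : ℕ} {b : Bool}
    (h : (TangleCode.cupCap m b).Valid c ⟨m + 2, b⟩) (x : Fin 0 → S.V c) :
    S.act (TangleCode.cupCap m b) ⟨m + 2, b⟩ x = S.Z (cupCap m b) fun i => i.elim0 := by
  let _ : DecidableEq (cupCap m b).Str := inferInstanceAs (DecidableEq (Fin m ⊕ Bool))
  let _ : DecidableEq (cupCap m b).Reg := inferInstanceAs (DecidableEq (Fin (m + 1) ⊕ Bool))
  refine (S.act_encode (funext fun i => i.elim0) (cupCap m b) (Equiv.refl _) (fun i => i.elim0)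
    (fun i => i.elim0) (sumBoolList m) (sumBoolList (m + 1)) (nodup_sumBoolList _)
    mem_sumBoolList (nodup_sumBoolList _) mem_sumBoolList
    h x).trans ?_
  congr 1
  funext i
  exact i.elim0

theorem act_coproduct (h : TangleCode.coproduct.Valid twoBox twoBox) (x : Fin 2 → S.V twoBox) :
    S.act TangleCode.coproduct twoBox x = S.Z coproductTangle x := by
  let _ : DecidableEq coproductTangle.Str := inferInstanceAs (DecidableEq (Fin 6))
  let _ : DecidableEq coproductTangle.Reg := inferInstanceAs (DecidableEq (Fin 5))
  exact S.act_encode rfl coproductTangle (Equiv.refl _) id (fun _ => rfl)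
    (List.finRange _) (List.finRange _) (List.nodup_finRange _) List.mem_finRange
    (List.nodup_finRange _) List.mem_finRange h x

theorem act_contragredient (h : TangleCode.contragredient.Valid twoBox twoBox) (x : S.V twoBox) :
    S.act TangleCode.contragredient twoBox (fun _ => x) = S.contragredient x := by
  let _ : DecidableEq contragredientTangle.Str := inferInstanceAs (DecidableEq (Fin 4))
  let _ : DecidableEq contragredientTangle.Reg := inferInstanceAs (DecidableEq (Fin 4))
  exact S.act_encode rfl contragredientTangle unitEquiv (fun _ => ()) (fun _ => rfl)
    (List.finRange _) (List.finRange _) (List.nodup_finRange _) List.mem_finRange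
    (List.nodup_finRange _) List.mem_finRange h (fun _ => x)

end PlanarAlgebra

namespace BoxTerm

/-! ### Terms with the same code have the same value -/

section eval

variable (S : PlanarAlgebra.{u}) {c : Colour}

/-- Induction on the term: a variable is the identity tangle, and a node is
`PlanarAlgebra.act_compose`. The flag `ok` supplies the validity of all tables and the composite
relation at every node. -/
theorem eval_eq_act {out : Colour} (a : BoxTerm c out) (h : a.code.ok = true) :
    a.code.code.Valid c out ∧ ∀ x : ℕ → S.V c,
      a.eval S x = S.act a.code.code out fun i => x (a.code.vars.getD i 0) := by
  induction a with
  | var i =>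
    have hv : (TangleCode.stack c 1).Valid c c := of_decide_eq_true h
    refine ⟨hv, fun x => ?_⟩
    refine (S.Z_id c (x i)).symm.trans ((S.act_stack hv fun _ => x i).symm.trans ?_)
    refine congrArg _ (funext fun k => ?_)
    obtain rfl : k = (0 : Fin 1) := Subsingleton.elim (α := Fin 1) _ _
    rfl
  | @node c' out t args ih =>
    set ls := List.ofFn fun i => (args i).code with hls
    have hcode : (node out t args).code = LabelledCode.compWith c c' out t ls _ _ _ _ _ :=
      LabelledCode.comp_eq c c' out t ls
    rw [hcode] at h ⊢
    simp only [LabelledCode.compWith, Bool.and_eq_true, decide_eq_true_eq] at h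
    obtain ⟨⟨⟨⟨h1, h2⟩, h3⟩, h4⟩, h5⟩ := h
    have hget : ∀ i : Fin t.arity, ls.getD i default = (args i).code := by
      intro i
      rw [hls, List.getD_eq_getElem _ _ (by simp)]
      simp
    have hnth : ∀ i : Fin t.arity,
        TangleCode.nth (ls.map LabelledCode.code) i = (args i).code.code := by
      intro i
      rw [← hget i, TangleCode.nth]
      exact List.getD_map ls default LabelledCode.code
    have hargs : ∀ i : Fin t.arity, (args i).code.ok = true := by
      intro i
      refine List.all_eq_true.1 h1 _ ?_
      rw [hls, List.mem_ofFn]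
      exact ⟨i, rfl⟩
    refine ⟨h3, fun x => ?_⟩
    have hu : ∀ i : Fin t.arity,
        (TangleCode.nth (ls.map LabelledCode.code) i).Valid c c' := by
      intro i
      rw [hnth i]
      exact (ih i (hargs i)).1
    refine Eq.trans ?_ (S.act_compose h2 hu h3 h4
      (fun i k => x ((args i).code.vars.getD k 0)) _ ?_).symm
    · change S.act t out (fun i => (args i).eval S x) = _
      refine congrArg _ (funext fun i => ?_)
      rw [(ih i (hargs i)).2 x]
      have key : ∀ w : TangleCode, w = (args i).code.code →
          S.act (args i).code.code c' (fun k => x ((args i).code.vars.getD k 0)) =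
            S.act w c' fun k => x ((args i).code.vars.getD k 0) := by
        rintro _ rfl
        rfl
      exact key _ (hnth i)
    · intro i k hk
      refine congrArg x ?_
      have := h5 i i.2 k k.2
      rw [hget i] at this
      exact this.symm

theorem matches_of_same {m sph : Bool} {out out' : Colour} {a : BoxTerm c out}
    {b : BoxTerm c out'} (h : a.same m sph b = true) :
    a.code.ok = true ∧ b.code.ok = true ∧ ∃ P FS FR, ∃ hm : TangleCode.Matches m sph c out
      a.code.code b.code.code P FS FR,
      ∀ i : Fin b.code.code.arity, b.code.vars.getD i 0 = a.code.vars.getD (hm.disc i) 0 := by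
  simp only [same, LabelledCode.same_eq, Bool.and_eq_true, decide_eq_true_eq] at h
  obtain ⟨⟨⟨h1, h2⟩, h3⟩, h4⟩ := h
  exact ⟨h1, h2, _, _, _, h3, fun i => h4 i (i.2.trans_eq h3.1.symm)⟩

/-- The principle behind all identities below: once both terms are collapsed to single tangles by
`eval_eq_act`, a successful comparison of the tables is a relabelling, and `Z_relabel` applies. -/
theorem eval_congr {out : Colour} {a b : BoxTerm c out} (h : a.same false false b = true)
    (x : ℕ → S.V c) : a.eval S x = b.eval S x := by
  obtain ⟨ha, hb, P, FS, FR, hm, hv⟩ := matches_of_same h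
  obtain ⟨ha, ha'⟩ := eval_eq_act S a ha
  obtain ⟨hb, hb'⟩ := eval_eq_act S b hb
  rw [ha', hb', ← S.Z_toTangle ha hm.disc, S.act_of_valid hb]
  simp only [hv]
  exact (S.Z_relabel (Equiv.refl _) _ _ (hm.isRelabelling ha hb)
    fun i => x (a.code.vars.getD (hm.disc i) 0)).symm

end eval

/-- As for `eval_congr`, but the tables are compared after a reflection and `star_Z` takes the place
of `Z_relabel`. -/
theorem star_eval (S : PlanarStarAlgebra.{u}) {c out : Colour} {a b : BoxTerm c out}
    (h : a.same true false b = true) (x : ℕ → S.V c) :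
    S.star (a.eval S.toPlanarAlgebra x) = b.eval S.toPlanarAlgebra fun i => S.star (x i) := by
  obtain ⟨ha, hb, P, FS, FR, hm, hv⟩ := matches_of_same h
  obtain ⟨ha, ha'⟩ := eval_eq_act S.toPlanarAlgebra a ha
  obtain ⟨hb, hb'⟩ := eval_eq_act S.toPlanarAlgebra b hb
  rw [ha', hb', ← S.Z_toTangle ha hm.disc, S.act_of_valid hb]
  simp only [hv]
  exact S.star_Z _ _ (hm.isReflection ha hb) fun i => x (a.code.vars.getD (hm.disc i) 0)

/-- The comparison disregards the outer disc, which may therefore lie in another region, even of the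
other shading; for this reason scalars are compared instead of 0-boxes. -/
theorem eval_eq_smul_one (S : SubfactorPlanarAlgebra.{u}) {c : Colour} {s s' : Bool}
    {a : BoxTerm c ⟨0, s⟩} {b : BoxTerm c ⟨0, s'⟩} (h : a.same false true b = true)
    (x : ℕ → S.V c) (t : ℂ) (ht : a.eval S.toPlanarAlgebra x = t • S.one ⟨0, s⟩) :
    b.eval S.toPlanarAlgebra x = t • S.one ⟨0, s'⟩ := by
  obtain ⟨ha, hb, P, FS, FR, hm, hv⟩ := matches_of_same h
  obtain ⟨ha, ha'⟩ := eval_eq_act S.toPlanarAlgebra a ha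
  obtain ⟨hb, hb'⟩ := eval_eq_act S.toPlanarAlgebra b hb
  rw [ha', ← S.Z_toTangle ha hm.disc] at ht
  rw [hb', S.act_of_valid hb]
  simp only [hv]
  exact S.spherical _ _ (hm.isSphereIsotopic ha hb)
    (fun i => x (a.code.vars.getD (hm.disc i) 0)) t ht

end BoxTerm

/-! ### Validity of the codes of the basic tangles -/

namespace TangleCode

/-- Only boxes with n ≤ 3 and stacks of at most two boxes occur, so that a finite check is enough.
-/
theorem valid_stack {d : Colour} (hd : d.n < 4) {m : ℕ} (hm : m < 3) :
    (stack d m).Valid d d := by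
  obtain ⟨n, b⟩ := d
  exact (by decide +kernel : ∀ m < 3, ∀ n < 4, ∀ b, (stack ⟨n, b⟩ m).Valid ⟨n, b⟩ ⟨n, b⟩)
    m hm n hd b

theorem valid_trace {d : Colour} (hd : d.n < 4) : (trace d).Valid d ⟨0, d.shaded⟩ := by
  obtain ⟨n, b⟩ := d
  exact (by decide +kernel : ∀ n < 4, ∀ b, (trace ⟨n, b⟩).Valid ⟨n, b⟩ ⟨0, b⟩) n hd b

theorem valid_incl {d : Colour} (hd : d.n < 3) : (incl d).Valid d ⟨d.n + 1, d.shaded⟩ := by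
  obtain ⟨n, b⟩ := d
  exact (by decide +kernel : ∀ n < 3, ∀ b, (incl ⟨n, b⟩).Valid ⟨n, b⟩ ⟨n + 1, b⟩) n hd b

theorem valid_cupCap {m : ℕ} (hm : m < 2) (b : Bool) :
    (cupCap m b).Valid ⟨0, false⟩ ⟨m + 2, b⟩ :=
  (by decide +kernel : ∀ m < 2, ∀ b, (cupCap m b).Valid ⟨0, false⟩ ⟨m + 2, b⟩) m hm b

theorem valid_coproduct : coproduct.Valid twoBox twoBox := by decide +kernel

theorem valid_contragredient : contragredient.Valid twoBox twoBox := by decide +kernel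

end TangleCode

/-! ### Auxiliary operations given by tangles. -/

namespace PlanarAlgebra

variable (S : PlanarAlgebra.{u})

/-- The conditional expectation: the last two points on the right of a box are connected. -/
noncomputable def condExp {d : Colour} (x : S.V ⟨d.n + 1, d.shaded⟩) : S.V d :=
  S.act (.partialTrace d) d fun _ => x

/-- A 0-box with shaded boundary is put on the right of a vertical string. -/
noncomputable def rightOfString (x : S.V ⟨0, true⟩) : S.V ⟨1, false⟩ :=
  S.act .rightOfString ⟨1, false⟩ fun _ => x

/-- A 2-box is rotated and put on the right of a vertical string. -/
noncomputable def rotateShift (x : S.V twoBox) : S.V ⟨3, false⟩ :=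
  S.act .rotateShift ⟨3, false⟩ fun _ => x

/-- The multiple `δ e` of the Jones projection. -/
noncomputable def cup (m : ℕ) : S.V ⟨m + 2, false⟩ := S.Z (cupCap m false) fun i => i.elim0

end PlanarAlgebra

/-! ### The values of the operations on terms. -/

namespace BoxTerm

variable (S : PlanarAlgebra.{u}) {c : Colour} (x : ℕ → S.V c)

theorem eval_var (i : ℕ) : (var i : BoxTerm c c).eval S x = x i := rfl

theorem eval_mul {d : Colour} (a b : BoxTerm c d) (hd : d.n < 4) :
    (mul a b).eval S x = S.mul (a.eval S x) (b.eval S x) := by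
  refine (S.act_stack (TangleCode.valid_stack hd (by norm_num)) _).trans ?_
  refine congrArg _ (funext fun i => ?_)
  change Fin 2 at i
  fin_cases i <;> rfl

theorem eval_one {d : Colour} (hd : d.n < 4) : (one d : BoxTerm c d).eval S x = S.one d := by
  refine (S.act_stack (TangleCode.valid_stack hd (by norm_num)) _).trans ?_
  exact congrArg _ (funext fun i => Fin.elim0 i)

theorem eval_tr {d : Colour} (a : BoxTerm c d) (hd : d.n < 4) :
    (tr a).eval S x = S.tr (a.eval S x) :=
  S.act_trace (TangleCode.valid_trace hd) _

theorem eval_incl {d : Colour} (a : BoxTerm c d) (hd : d.n < 3) :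
    (incl a).eval S x = S.incl (a.eval S x) :=
  S.act_incl (TangleCode.valid_incl hd) _

theorem eval_cupCap {m : ℕ} (hm : m < 2) :
    (cupCap m false : BoxTerm c _).eval S x = S.cup m :=
  S.act_cupCap (TangleCode.valid_cupCap hm false) _

theorem eval_coproduct (a b : BoxTerm c twoBox) :
    (coproduct a b).eval S x = S.coproduct (a.eval S x) (b.eval S x) := by
  refine (S.act_coproduct TangleCode.valid_coproduct _).trans ?_
  refine congrArg _ (funext fun i => ?_)
  fin_cases i <;> rfl

theorem eval_contragredient (a : BoxTerm c twoBox) :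
    (contragredient a).eval S x = S.contragredient (a.eval S x) :=
  S.act_contragredient TangleCode.valid_contragredient _

theorem eval_partialTrace {d : Colour} (a : BoxTerm c ⟨d.n + 1, d.shaded⟩) :
    (partialTrace a).eval S x = S.condExp (a.eval S x) := rfl

theorem eval_rightOfString (a : BoxTerm c ⟨0, true⟩) :
    (rightOfString a).eval S x = S.rightOfString (a.eval S x) := rfl

theorem eval_rotateShift (a : BoxTerm c twoBox) :
    (rotateShift a).eval S x = S.rotateShift (a.eval S x) := rfl

end BoxTerm

/-! ### Identities in planar algebras -/

namespace PlanarAlgebra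

/-- The assignment of values to the first variables of a term. -/
def vars {V : Type*} (x y z w : V) : ℕ → V
  | 0 => x
  | 1 => y
  | 2 => z
  | _ => w

end PlanarAlgebra

namespace BoxTerm

open PlanarAlgebra

section identities

variable (S : PlanarAlgebra.{u})

/-- The pattern of all these identities: both sides are written as terms, the kernel verifies for
each small n that the diagrams are isotopic, and the evaluation lemmas translate the result back. -/
theorem _root_.PlanarAlgebra.mul_assoc {n : ℕ} (hn : n < 4) (x y z : S.Box n) :
    S.mul (S.mul x y) z = S.mul x (S.mul y z) := by
  have h : ∀ n < 4, (mul (mul (var 0) (var 1)) (var 2) : BoxTerm ⟨n, false⟩ _).same false false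
      (mul (var 0) (mul (var 1) (var 2))) = true := by decide +kernel
  have := eval_congr S (h n hn) (vars x y z z)
  simpa (disch := exact hn) only [eval_var, vars, eval_mul] using this

theorem _root_.PlanarAlgebra.one_mul {n : ℕ} (hn : n < 4) (x : S.Box n) :
    S.mul (S.one _) x = x := by
  have h : ∀ n < 4, (mul (one _) (var 0) : BoxTerm ⟨n, false⟩ _).same false false (var 0) := by
    decide +kernel
  have := eval_congr S (h n hn) (vars x x x x)
  simpa (disch := exact hn) only [eval_var, vars, eval_mul, eval_one] using this

theorem _root_.PlanarAlgebra.mul_one {n : ℕ} (hn : n < 4) (x : S.Box n) :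
    S.mul x (S.one _) = x := by
  have h : ∀ n < 4, (mul (var 0) (one _) : BoxTerm ⟨n, false⟩ _).same false false (var 0) := by
    decide +kernel
  have := eval_congr S (h n hn) (vars x x x x)
  simpa (disch := exact hn) only [eval_var, vars, eval_mul, eval_one] using this

theorem _root_.PlanarAlgebra.tr_mul_comm {n : ℕ} (hn : n < 4) (x y : S.Box n) :
    S.tr (S.mul x y) = S.tr (S.mul y x) := by
  have h : ∀ n < 4, (tr (mul (var 0) (var 1)) : BoxTerm ⟨n, false⟩ _).same false false
      (tr (mul (var 1) (var 0))) := by decide +kernel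
  have := eval_congr S (h n hn) (vars x y y y)
  simpa (disch := exact hn) only [eval_var, vars, eval_mul, eval_tr] using this

theorem _root_.PlanarAlgebra.incl_mul {n : ℕ} (hn : n < 3) (x y : S.Box n) :
    S.incl (S.mul x y) = S.mul (S.incl x) (S.incl y) := by
  have h : ∀ n < 3, (incl (mul (var 0) (var 1)) : BoxTerm ⟨n, false⟩ _).same false false
      (mul (incl (var 0)) (incl (var 1))) := by decide +kernel
  have := eval_congr S (h n hn) (vars x y y y)
  simpa (disch := first | exact hn | exact hn.trans (by norm_num) | exact Nat.succ_lt_succ hn)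
    only [eval_var, vars, eval_mul, eval_incl] using this

theorem _root_.PlanarAlgebra.incl_one {n : ℕ} (hn : n < 3) :
    (S.incl (S.one ⟨n, false⟩) : S.Box (n + 1)) = S.one ⟨n + 1, false⟩ := by
  have h : ∀ n < 3, (incl (one ⟨n, false⟩) : BoxTerm ⟨0, false⟩ ⟨n + 1, false⟩).same false false
      (one ⟨n + 1, false⟩) := by decide +kernel
  have := eval_congr S (h n hn) (fun _ => 0)
  simpa (disch := first | exact hn | exact hn.trans (by norm_num) | exact Nat.succ_lt_succ hn)
    only [eval_one, eval_incl] using this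

/-- The upper arc of `S.cup n` is detached from `x`. The conditional expectation bends it round to
the lower right point of `x`, and the last factor bends it back; no closed loop arises, hence no
power of δ. This gives S_{n+2} e = S_{n+1} e. -/
theorem _root_.PlanarAlgebra.mul_cup {n : ℕ} (hn : n < 2) (x : S.Box (n + 2)) :
    S.mul x (S.cup n) =
      S.mul (S.incl (S.condExp (d := ⟨n + 1, false⟩) (S.mul x (S.cup n))) : S.Box (n + 2))
        (S.cup n) := by
  have h : ∀ n < 2, (mul (var 0) (cupCap n false) : BoxTerm ⟨n + 2, false⟩ _).same false false
      (mul (incl (partialTrace (d := ⟨n + 1, false⟩) (mul (var 0) (cupCap n false))))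
        (cupCap n false)) := by decide +kernel
  have := eval_congr S (h n hn) (vars x x x x)
  have h2 : n + 2 < 4 := by omega
  have h1 : n + 1 < 3 := by omega
  simpa (disch := first | exact hn | exact h2 | exact h1)
    only [eval_var, vars, eval_mul, eval_incl, eval_cupCap, eval_partialTrace] using this

/-- Between the two diagrams the last two strings of `x` are closed off on both sides, which leaves
an n-box beside a cap and a cup. -/
theorem _root_.PlanarAlgebra.cup_mul_cup {n : ℕ} (hn : n < 2) (x : S.Box (n + 2)) :
    S.mul (S.mul (S.cup n) x) (S.cup n) =
      S.mul (S.incl (S.incl (S.condExp (d := ⟨n, false⟩)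
        (S.condExp (d := ⟨n + 1, false⟩) (S.mul x (S.cup n))))) : S.Box (n + 2)) (S.cup n) := by
  have h : ∀ n < 2, (mul (mul (cupCap n false) (var 0)) (cupCap n false) :
      BoxTerm ⟨n + 2, false⟩ _).same false false
      (mul (incl (incl (partialTrace (d := ⟨n, false⟩) (partialTrace (d := ⟨n + 1, false⟩)
        (mul (var 0) (cupCap n false)))))) (cupCap n false)) := by decide +kernel
  have := eval_congr S (h n hn) (vars x x x x)
  have h2 : n + 2 < 4 := by omega
  have h1 : n + 1 < 3 := by omega
  have h0 : n < 3 := by omega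
  simpa (disch := first | exact hn | exact h2 | exact h1 | exact h0)
    only [eval_var, vars, eval_mul, eval_incl, eval_cupCap, eval_partialTrace] using this

/-- A zigzag is straightened. It follows that multiplication by the Jones projection is injective on
S_{n+1}. -/
theorem _root_.PlanarAlgebra.condExp_mul_cup {n : ℕ} (hn : n < 2) (x : S.Box (n + 1)) :
    S.condExp (d := ⟨n + 1, false⟩) (S.mul (S.incl x) (S.cup n)) = x := by
  have h : ∀ n < 2, (partialTrace (d := ⟨n + 1, false⟩) (mul (incl (var 0)) (cupCap n false)) :
      BoxTerm ⟨n + 1, false⟩ _).same false false (var 0) := by decide +kernel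
  have := eval_congr S (h n hn) (vars x x x x)
  have h2 : n + 2 < 4 := by omega
  have h1 : n + 1 < 3 := by omega
  simpa (disch := first | exact hn | exact h2 | exact h1)
    only [eval_var, vars, eval_mul, eval_incl, eval_cupCap, eval_partialTrace] using this

theorem _root_.PlanarAlgebra.incl_incl_mul_cup {n : ℕ} (hn : n < 2) (x : S.Box n) :
    S.mul (S.incl (S.incl x) : S.Box (n + 2)) (S.cup n) =
      S.mul (S.cup n) (S.incl (S.incl x) : S.Box (n + 2)) := by
  have h : ∀ n < 2, (mul (incl (incl (var 0))) (cupCap n false) :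
      BoxTerm ⟨n, false⟩ _).same false false (mul (cupCap n false) (incl (incl (var 0)))) := by
    decide +kernel
  have := eval_congr S (h n hn) (vars x x x x)
  have h2 : n + 2 < 4 := by omega
  have h1 : n + 1 < 3 := by omega
  have h0 : n < 3 := by omega
  simpa (disch := first | exact hn | exact h2 | exact h1 | exact h0)
    only [eval_var, vars, eval_mul, eval_incl, eval_cupCap] using this

theorem _root_.PlanarAlgebra.cup_zero_mul_cup_one :
    S.mul (S.mul (S.incl (S.cup 0) : S.Box 3) (S.cup 1)) (S.incl (S.cup 0) : S.Box 3) =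
      S.incl (S.cup 0) := by
  have h : (mul (mul (incl (cupCap 0 false)) (cupCap 1 false)) (incl (cupCap 0 false)) :
      BoxTerm ⟨0, false⟩ _).same false false (incl (cupCap 0 false)) := by decide +kernel
  have := eval_congr S h (fun _ => 0)
  simpa (disch := decide) only [eval_mul, eval_incl, eval_cupCap] using this

theorem _root_.PlanarAlgebra.cup_zero_mul_self :
    S.mul (S.cup 0) (S.cup 0) =
      S.mul (S.incl (S.incl (S.tr (S.one ⟨1, false⟩))) : S.Box 2) (S.cup 0) := by
  have h : (mul (cupCap 0 false) (cupCap 0 false) : BoxTerm ⟨0, false⟩ _).same false false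
      (mul (incl (incl (tr (one ⟨1, false⟩)))) (cupCap 0 false)) := by decide +kernel
  have := eval_congr S h (fun _ => 0)
  simpa (disch := decide) only [eval_mul, eval_incl, eval_cupCap, eval_one, eval_tr] using this

/-- The circle that splits off lies to the right of the first string, in a shaded region, in
contrast to `cup_zero_mul_self`. Sphericality is needed to know that its value is again δ. -/
theorem _root_.PlanarAlgebra.cup_one_mul_self :
    S.mul (S.cup 1) (S.cup 1) =
      S.mul (S.incl (S.incl (S.rightOfString (S.tr (S.one ⟨1, true⟩)))) : S.Box 3) (S.cup 1) := by
  have h : (mul (cupCap 1 false) (cupCap 1 false) : BoxTerm ⟨0, false⟩ _).same false false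
      (mul (incl (incl (rightOfString (tr (one ⟨1, true⟩))))) (cupCap 1 false)) := by
    decide +kernel
  have := eval_congr S h (fun _ => 0)
  simpa (disch := decide) only [eval_mul, eval_incl, eval_cupCap, eval_one, eval_tr,
    eval_rightOfString] using this

theorem _root_.PlanarAlgebra.rightOfString_one : S.rightOfString (S.one _) = S.one _ := by
  have h : (rightOfString (one ⟨0, true⟩) : BoxTerm ⟨0, false⟩ _).same false false
      (one ⟨1, false⟩) := by decide +kernel
  have := eval_congr S h (fun _ => 0)
  simpa (disch := decide) only [eval_one, eval_rightOfString] using this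

end identities

/-! ### Compatibility with the involution. -/

section star

variable (S : PlanarStarAlgebra.{u})

theorem _root_.PlanarStarAlgebra.star_mul {n : ℕ} (hn : n < 4) (x y : S.Box n) :
    S.star (S.mul x y) = S.mul (S.star y) (S.star x) := by
  have h : ∀ n < 4, (mul (var 0) (var 1) : BoxTerm ⟨n, false⟩ _).same true false
      (mul (var 1) (var 0)) := by decide +kernel
  have := star_eval S (h n hn) (vars x y y y)
  simpa (disch := exact hn) only [eval_var, vars, eval_mul] using this

theorem _root_.PlanarStarAlgebra.star_incl {n : ℕ} (hn : n < 3) (x : S.Box n) :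
    S.star (S.incl x) = S.incl (S.star x) := by
  have h : ∀ n < 3, (incl (var 0) : BoxTerm ⟨n, false⟩ _).same true false
      (incl (var 0)) := by decide +kernel
  have := star_eval S (h n hn) (vars x x x x)
  simpa (disch := exact hn) only [eval_var, vars, eval_incl] using this

theorem _root_.PlanarStarAlgebra.star_cup {n : ℕ} (hn : n < 2) :
    S.star (S.cup n) = S.cup n := by
  have h : ∀ n < 2, (cupCap n false : BoxTerm ⟨0, false⟩ _).same true false
      (cupCap n false) := by decide +kernel
  have := star_eval S (h n hn) (fun _ => 0)
  simpa (disch := exact hn) only [eval_cupCap] using this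

theorem _root_.PlanarStarAlgebra.star_coproduct (x y : S.V twoBox) :
    S.star (S.coproduct x y) = S.coproduct (S.star x) (S.star y) := by
  have h : (coproduct (var 0) (var 1) : BoxTerm twoBox _).same true false
      (coproduct (var 0) (var 1)) := by decide +kernel
  have := star_eval S h (vars x y y y)
  simpa only [eval_var, vars, eval_coproduct] using this

theorem _root_.PlanarStarAlgebra.star_contragredient (x : S.V twoBox) :
    S.star (S.contragredient x) = S.contragredient (S.star x) := by
  have h : (contragredient (var 0) : BoxTerm twoBox _).same true false
      (contragredient (var 0)) := by decide +kernel
  have := star_eval S h (vars x x x x)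
  simpa only [eval_var, vars, eval_contragredient] using this

/-- The reflection reverses the direction in which the 2-box is turned; the two positions differ by
a half turn, whence the contragredient. -/
theorem _root_.PlanarStarAlgebra.star_rotateShift (x : S.V twoBox) :
    S.star (S.rotateShift x) = S.rotateShift (S.contragredient (S.star x)) := by
  have h : (rotateShift (var 0) : BoxTerm twoBox _).same true false
      (rotateShift (contragredient (var 0))) := by decide +kernel
  have := star_eval S h (vars x x x x)
  simpa only [eval_var, vars, eval_contragredient, eval_rotateShift] using this

end star

/-! ### Identities that use sphericality. -/

section spherical

variable (S : SubfactorPlanarAlgebra.{u})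

theorem _root_.SubfactorPlanarAlgebra.tr_one_shaded (t : ℂ)
    (ht : S.tr (S.one ⟨1, false⟩) = t • S.one ⟨0, false⟩) :
    S.tr (S.one ⟨1, true⟩) = t • S.one ⟨0, true⟩ := by
  have h : (tr (one ⟨1, false⟩) : BoxTerm ⟨0, false⟩ ⟨0, false⟩).same false true
      (tr (one ⟨1, true⟩) : BoxTerm ⟨0, false⟩ ⟨0, true⟩) := by decide +kernel
  have := eval_eq_smul_one S h (fun _ => 0) t (by
    simpa (disch := decide) only [eval_one, eval_tr] using ht)
  simpa (disch := decide) only [eval_one, eval_tr] using this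

/-- The picture behind the theorem. On the sphere both closed diagrams are the same arrangement of
four boxes. The outer region of the 3-box diagram, to the left of `P` and `Q`, is the region between
the two factors of the coproduct in the other one; since `P` is rotated by a half turn there, its
left side faces `Q`. -/
theorem _root_.SubfactorPlanarAlgebra.tr_rotateShift_mul (P Q a b : S.V twoBox) (t : ℂ)
    (ht : S.tr (S.mul (S.mul (S.mul (S.rotateShift (S.contragredient a)) (S.incl Q : S.Box 3))
      (S.rotateShift b)) (S.incl P : S.Box 3)) = t • S.one ⟨0, false⟩) :
    S.tr (S.mul (S.mul a (S.coproduct (S.contragredient P) Q)) b) = t • S.one ⟨0, false⟩ := by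
  have h : (tr (mul (mul (mul (rotateShift (contragredient (var 2))) (incl (var 1)))
      (rotateShift (var 3))) (incl (var 0))) : BoxTerm twoBox ⟨0, false⟩).same false true
      (tr (mul (mul (var 2) (coproduct (contragredient (var 0)) (var 1))) (var 3)) :
        BoxTerm twoBox ⟨0, false⟩) := by decide +kernel
  have := eval_eq_smul_one S h (vars P Q a b) t (by
    simpa (disch := decide) only [eval_var, vars, eval_mul, eval_tr, eval_contragredient,
      eval_rotateShift, eval_incl] using ht)
  simpa (disch := decide) only [eval_var, vars, eval_mul, eval_tr, eval_contragredient,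
    eval_rotateShift, eval_coproduct] using this

end spherical

end BoxTerm

/-! ### Finite-dimensional star algebras with a faithful trace -/

namespace TracialAlgebra

variable {A : Type*} [Ring A] [Algebra ℂ A] [StarRing A] [StarModule ℂ A]

/-- A faithful positive trace. -/
structure IsFaithfulTrace (τ : A →ₗ[ℂ] ℂ) : Prop where
  comm : ∀ x y, τ (x * y) = τ (y * x)
  pos : ∀ x, x ≠ 0 → ∃ t : ℝ, 0 < t ∧ τ (star x * x) = t

/-- (Orthogonal) projections. -/
def IsProj (p : A) : Prop := star p = p ∧ p * p = p

/-- Minimal projections. -/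
def IsMinProj (p : A) : Prop := IsProj p ∧ p ≠ 0 ∧ ∀ x, ∃ t : ℂ, p * x * p = t • p

/-- Equivalence of projections. -/
def Equivalent (p q : A) : Prop := ∃ v, star v * v = p ∧ v * star v = q

/-- The space of all `q x p`. -/
def corner (q p : A) : Submodule ℂ A := Submodule.span ℂ {z | ∃ x, z = q * x * p}

omit [StarRing A] [StarModule ℂ A] in
-- The set of all q x p is already a subspace, so the span adds nothing.
theorem mem_corner_iff' {q p z : A} : z ∈ corner q p ↔ ∃ x, z = q * x * p := by
  constructor
  · intro h
    refine Submodule.span_induction (fun z hz => hz) ⟨0, by simp⟩ ?_ ?_ h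
    · rintro _ _ - - ⟨x, rfl⟩ ⟨y, rfl⟩
      exact ⟨x + y, by rw [mul_add, add_mul]⟩
    · rintro t _ - ⟨x, rfl⟩
      exact ⟨t • x, by rw [mul_smul_comm, smul_mul_assoc]⟩
  · exact fun h => Submodule.subset_span h

omit [StarModule ℂ A] in
theorem mem_corner_iff {q p z : A} (hq : IsProj q) (hp : IsProj p) :
    z ∈ corner q p ↔ q * z = z ∧ z * p = z := by
  rw [mem_corner_iff']
  constructor
  · rintro ⟨x, rfl⟩
    constructor
    · rw [← mul_assoc, ← mul_assoc, hq.2]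
    · rw [mul_assoc, hp.2]
  · rintro ⟨h1, h2⟩
    exact ⟨z, by rw [h1, h2]⟩

omit [Algebra ℂ A] [StarModule ℂ A] in
theorem IsProj.sub {p r : A} (hp : IsProj p) (hr : IsProj r) (h : p * r = r) :
    IsProj (p - r) := by
  have h' : r * p = r := by
    have := congrArg star h
    rwa [star_mul, hp.1, hr.1] at this
  refine ⟨by rw [star_sub, hp.1, hr.1], ?_⟩
  rw [mul_sub, sub_mul, sub_mul, hp.2, hr.2, h, h']
  abel

variable {τ : A →ₗ[ℂ] ℂ}

omit [StarModule ℂ A] in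
theorem IsFaithfulTrace.eq_zero (hτ : IsFaithfulTrace τ) {x : A} (h : star x * x = 0) : x = 0 := by
  by_contra hx
  obtain ⟨t, ht, h'⟩ := hτ.pos x hx
  rw [h, map_zero] at h'
  exact ht.ne (by exact_mod_cast h')

omit [StarModule ℂ A] in
theorem IsFaithfulTrace.eq_zero' (hτ : IsFaithfulTrace τ) {x : A} (h : x * star x = 0) : x = 0 := by
  have : star x = 0 := hτ.eq_zero (by rwa [star_star])
  rw [← star_star x, this, star_zero]

omit [StarModule ℂ A] in
theorem IsFaithfulTrace.pos_proj (hτ : IsFaithfulTrace τ) {p : A} (hp : IsProj p) (h : p ≠ 0) :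
    ∃ t : ℝ, 0 < t ∧ τ p = t := by
  have := hτ.pos p h
  rwa [hp.1, hp.2] at this

omit [StarRing A] [StarModule ℂ A] in
theorem aeval_mul_of_mul_eq_smul {x b : A} {a : ℂ} (h : x * b = a • b) (k : Polynomial ℂ) :
    Polynomial.aeval x k * b = k.eval a • b := by
  induction k using Polynomial.induction_on' with
  | add p q hp hq => rw [map_add, add_mul, hp, hq, Polynomial.eval_add, add_smul]
  | monomial n t =>
    have hn : x ^ n * b = a ^ n • b := by
      induction n with
      | zero => simp
      | succ n ih => rw [pow_succ, mul_assoc, h, mul_smul_comm, ih, smul_smul, pow_succ, mul_comm]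
    rw [Polynomial.aeval_monomial, Polynomial.eval_monomial, mul_assoc, hn, mul_smul_comm,
      Algebra.algebraMap_eq_smul_one, smul_mul_assoc, one_mul, smul_smul, mul_comm]

theorem exists_star_aeval {x : A} (hx : star x = x) (g : Polynomial ℂ) :
    ∃ g' : Polynomial ℂ, star (Polynomial.aeval x g) = Polynomial.aeval x g' := by
  induction g using Polynomial.induction_on' with
  | add p q hp hq =>
    obtain ⟨p', hp⟩ := hp
    obtain ⟨q', hq⟩ := hq
    exact ⟨p' + q', by rw [map_add, star_add, hp, hq, map_add]⟩
  | monomial n t =>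
    refine ⟨Polynomial.monomial n (star t), ?_⟩
    rw [Polynomial.aeval_monomial, Polynomial.aeval_monomial, star_mul, star_pow, hx,
      ← algebraMap_star_comm, Algebra.commutes]

/-- A self-adjoint element has an eigenprojection. -/
theorem exists_eigenprojection [FiniteDimensional ℂ A] (hτ : IsFaithfulTrace τ) {p x : A}
    (hp : IsProj p) (hp0 : p ≠ 0) (hx : star x = x) (hpx : p * x = x) :
    ∃ (q : A) (a : ℝ), IsProj q ∧ q ≠ 0 ∧ p * q = q ∧ x * q = (a : ℂ) • q := by
  have hxp : x * p = x := by
    have := congrArg star hpx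
    rwa [star_mul, hp.1, hx] at this
  have hcomm : ∀ g : Polynomial ℂ, Commute (Polynomial.aeval x g) p := by
    intro g
    induction g using Polynomial.induction_on' with
    | add g h hg hh =>
      rw [map_add]
      exact hg.add_left hh
    | monomial n t =>
      rw [Polynomial.aeval_monomial]
      exact (Algebra.commute_algebraMap_left _ _).mul_left (Commute.pow_left (hxp.trans hpx.symm) n)
  -- The range of `f` is the space of all g(x) p. It is nonzero, finite-dimensional and stable under
  -- multiplication by `x`, so it contains an eigenvector.
  let f : Polynomial ℂ →ₗ[ℂ] A :=
    (LinearMap.mulRight ℂ p).comp (Polynomial.aeval x).toLinearMap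
  have hf : ∀ g, f g = Polynomial.aeval x g * p := fun g => rfl
  have hfx : ∀ g, x * f g = f (Polynomial.X * g) := by
    intro g
    rw [hf, hf, map_mul, Polynomial.aeval_X, mul_assoc]
  let L : Module.End ℂ (LinearMap.range f) :=
    (LinearMap.mulLeft ℂ x).restrict (by
      rintro _ ⟨g, rfl⟩
      exact ⟨Polynomial.X * g, (hfx g).symm⟩)
  have : Nontrivial (LinearMap.range f) :=
    ⟨⟨⟨p, 1, by simp [hf]⟩, 0, fun h => hp0 (congrArg Subtype.val h)⟩⟩
  obtain ⟨a, ha⟩ := Module.End.exists_eigenvalue L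
  obtain ⟨⟨_, g, rfl⟩, hz⟩ := ha.exists_hasEigenvector
  have hz1 : x * f g = a • f g := congrArg Subtype.val hz.apply_eq_smul
  have hz0 : f g ≠ 0 := fun h => hz.2 (Subtype.ext h)
  obtain ⟨g', hg'⟩ := exists_star_aeval hx g
  have hstar : star (f g) = Polynomial.aeval x g' * p := by
    rw [hf, star_mul, hg', hp.1, (hcomm g').eq]
  -- By faithfulness `b` is nonzero, and it is still an eigenvector because polynomials in `x`
  -- commute. It is self-adjoint and satisfies b² = c b, so c⁻¹ b is the required projection; no
  -- functional calculus is needed.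
  set b := star (f g) * f g with hb
  have hb0 : b ≠ 0 := fun h => hz0 (hτ.eq_zero h)
  have hbs : star b = b := by rw [hb, star_mul, star_star]
  have hbg : b = Polynomial.aeval x (g' * g) * p := by
    rw [hb, hstar, hf, map_mul, mul_assoc, ← mul_assoc p, ← (hcomm g).eq, mul_assoc, hp.2,
      mul_assoc]
  have hxb : x * b = a • b := by
    have hx' : x * star (f g) = star (f g) * x := by
      have h1 : Commute x (Polynomial.aeval x g') := by
        have := congrArg (Polynomial.aeval x) (mul_comm Polynomial.X g')
        rwa [map_mul, map_mul, Polynomial.aeval_X] at this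
      rw [hstar]
      exact h1.mul_right (hxp.trans hpx.symm)
    rw [hb, ← mul_assoc, hx', mul_assoc, hz1, mul_smul_comm]
  have hpb : p * b = b := by
    rw [hbg, ← mul_assoc, ← (hcomm _).eq, mul_assoc, hp.2]
  have hreal : ∀ {t : ℂ} {y : A}, y ≠ 0 → star y = y → star (t • y) = t • y →
      (t.re : ℂ) = t := by
    intro t y hy0 hy h
    rw [star_smul, hy] at h
    exact Complex.conj_eq_iff_re.1 (smul_left_injective ℂ hy0 h)
  have ha' : (a.re : ℂ) = a := by
    refine hreal hb0 hbs ?_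
    rw [← hxb, star_mul, hbs, hx, hbg, ← mul_assoc]
    have h1 : Polynomial.aeval x (g' * g) * x = x * Polynomial.aeval x (g' * g) := by
      have := congrArg (Polynomial.aeval x) (mul_comm (g' * g) Polynomial.X)
      rwa [map_mul _ _ Polynomial.X, map_mul _ Polynomial.X, Polynomial.aeval_X] at this
    rw [mul_assoc, hpx, h1, mul_assoc, (hcomm _).eq, ← mul_assoc, hxp]
  -- A polynomial in `x` acts on an eigenvector as its value at the eigenvalue, which gives b² = c
  -- b.
  set c := (g' * g).eval a with hc
  have hbb : b * b = c • b := by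
    calc b * b = Polynomial.aeval x (g' * g) * p * b := by rw [← hbg]
      _ = c • b := by rw [mul_assoc, hpb, aeval_mul_of_mul_eq_smul hxb]
  have hc0 : c ≠ 0 := by
    intro h
    rw [h, zero_smul] at hbb
    exact hb0 (hτ.eq_zero (by rwa [hbs]))
  have hc' : (c.re : ℂ) = c := by
    refine hreal hb0 hbs ?_
    rw [← hbb, star_mul, hbs]
  have hcs : star c⁻¹ = c⁻¹ := by
    rw [← hc']
    simp
  refine ⟨c⁻¹ • b, a.re, ⟨?_, ?_⟩, smul_ne_zero (inv_ne_zero hc0) hb0, ?_, ?_⟩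
  · rw [star_smul, hbs, hcs]
  · rw [smul_mul_assoc, mul_smul_comm, hbb, smul_smul c⁻¹ c, inv_mul_cancel₀ hc0, one_smul]
  · rw [mul_smul_comm, hpb]
  · rw [mul_smul_comm, hxb, ha', smul_comm]

omit [StarModule ℂ A] in
-- The dimension of the corner is the induction measure for minimal projections and for the spectral
-- theorem. It drops because `p` lies in its own corner but not in that of `q`.
theorem finrank_corner_lt [FiniteDimensional ℂ A] {p q : A} (hp : IsProj p) (hq : IsProj q)
    (h : p * q = q) (hne : q ≠ p) :
    Module.finrank ℂ (corner q q) < Module.finrank ℂ (corner p p) := by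
  have h' : q * p = q := by
    have := congrArg star h
    rwa [star_mul, hp.1, hq.1] at this
  refine Submodule.finrank_lt_finrank_of_lt (lt_of_le_of_ne ?_ ?_)
  · intro z hz
    rw [mem_corner_iff hq hq] at hz
    rw [mem_corner_iff hp hp, ← hz.1, ← mul_assoc, h, hz.1]
    refine ⟨rfl, ?_⟩
    rw [← hz.2, mul_assoc, h']
  · intro heq
    have hpm : p ∈ corner q q := by
      rw [heq, mem_corner_iff hp hp]
      exact ⟨hp.2, hp.2⟩
    rw [mem_corner_iff hq hq] at hpm
    exact hne (h'.symm.trans hpm.1)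

/-- Every nonzero projection dominates a minimal projection. -/
theorem exists_isMinProj [FiniteDimensional ℂ A] (hτ : IsFaithfulTrace τ) {p : A}
    (hp : IsProj p) (hp0 : p ≠ 0) : ∃ q, IsMinProj q ∧ p * q = q := by
  induction hn : Module.finrank ℂ (corner p p) using Nat.strong_induction_on generalizing p with
  | _ n ih =>
    by_cases hmin : ∀ x, ∃ t : ℂ, p * x * p = t • p
    · exact ⟨p, ⟨hp, hp0, hmin⟩, hp.2⟩
    -- A self-adjoint element of the corner that is not a multiple of `p` has an eigenprojection
    -- strictly below `p`, to which the induction hypothesis applies.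
    have step : ∀ y : A, star y = y → p * y = y → (∀ t : ℂ, y ≠ t • p) →
        ∃ q, IsMinProj q ∧ p * q = q := by
      intro y hy hpy hyt
      obtain ⟨r, a, hr, hr0, hpr, hyr⟩ := exists_eigenprojection hτ hp hp0 hy hpy
      have hrp : r ≠ p := by
        rintro rfl
        refine hyt a ?_
        rw [← hyr]
        have := congrArg star hpy
        rw [star_mul, hy, hr.1] at this
        exact this.symm
      obtain ⟨q, hq, hrq⟩ := ih _ (hn ▸ finrank_corner_lt hp hr hpr hrp) hr hr0 rfl
      exact ⟨q, hq, by rw [← hrq, ← mul_assoc, hpr]⟩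
    push Not at hmin
    obtain ⟨x, hx⟩ := hmin
    set y := p * x * p with hy
    have hpy : p * y = y := by rw [hy, ← mul_assoc, ← mul_assoc, hp.2]
    have hyp : y * p = y := by rw [hy, mul_assoc, hp.2]
    have hpys : p * star y = star y := by
      have := congrArg star hyp
      rwa [star_mul, hp.1] at this
    -- If `y` is not a multiple of `p`, then its real part or its imaginary part is not.
    by_cases h1 : ∃ t : ℂ, y + star y = t • p
    · obtain ⟨t, ht⟩ := h1
      refine step (Complex.I • (y - star y)) ?_ ?_ ?_
      · rw [star_smul, star_sub, star_star]
        simp only [Complex.star_def, Complex.conj_I, neg_smul, smul_sub]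
        abel
      · rw [mul_smul_comm, mul_sub, hpy, hpys]
      · intro s hs
        have hs' : y - star y = (-Complex.I * s) • p := by
          rw [mul_smul, ← hs, smul_smul]
          simp
        refine hx ((2 : ℂ)⁻¹ * (t + -Complex.I * s)) ?_
        rw [mul_smul, add_smul, ← ht, ← hs']
        have : y + star y + (y - star y) = (2 : ℂ) • y := by
          rw [two_smul]
          abel
        rw [this, smul_smul]
        norm_num
    · push Not at h1
      refine step (y + star y) ?_ ?_ h1
      · rw [star_add, star_star, add_comm]
      · rw [mul_add, hpy, hpys]

/-- The spectral theorem. -/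
theorem exists_spectral [FiniteDimensional ℂ A] (hτ : IsFaithfulTrace τ) {p x : A}
    (hp : IsProj p) (hx : star x = x) (hpx : p * x = x) :
    ∃ (ι : Type) (_ : Fintype ι) (R : ι → A) (l : ι → ℝ), (∀ i, IsMinProj (R i)) ∧
      (∀ i j, i ≠ j → R i * R j = 0) ∧ ∑ i, R i = p ∧ x = ∑ i, (l i : ℂ) • R i := by
  classical
  induction hn : Module.finrank ℂ (corner p p) using Nat.strong_induction_on generalizing p x with
  | _ n ih =>
    by_cases hp0 : p = 0
    · refine ⟨Empty, inferInstance, Empty.elim, Empty.elim, fun i => i.elim, fun i => i.elim,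
        by simp [hp0], ?_⟩
      rw [← hpx, hp0]
      simp
    -- A minimal projection `r` below an eigenprojection is split off; `x - a r` then lives in the
    -- smaller corner of `p - r`.
    obtain ⟨q, a, hq, hq0, hpq, hxq⟩ := exists_eigenprojection hτ hp hp0 hx hpx
    obtain ⟨r, hr, hqr⟩ := exists_isMinProj hτ hq hq0
    have hpr : p * r = r := by rw [← hqr, ← mul_assoc, hpq]
    have hrp : r * p = r := by
      have := congrArg star hpr
      rwa [star_mul, hp.1, hr.1.1] at this
    have hxr : x * r = (a : ℂ) • r := by rw [← hqr, ← mul_assoc, hxq, smul_mul_assoc]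
    have hrx : r * x = (a : ℂ) • r := by
      have := congrArg star hxr
      rw [star_mul, star_smul, hx, hr.1.1] at this
      simpa using this
    have hs := hp.sub hr.1 hpr
    have hlt : Module.finrank ℂ (corner (p - r) (p - r)) < Module.finrank ℂ (corner p p) := by
      refine finrank_corner_lt hp hs ?_ ?_
      · rw [mul_sub, hp.2, hpr]
      · intro h
        exact hr.2.1 (sub_eq_self.1 h)
    obtain ⟨ι, _, R, l, h1, h2, h3, h4⟩ := ih _ (hn ▸ hlt) (p := p - r) (x := x - (a : ℂ) • r) hs
      (by rw [star_sub, star_smul, hx, hr.1.1]; simp)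
      (by
        rw [mul_sub, sub_mul, sub_mul, hpx, hrx, mul_smul_comm, mul_smul_comm, hpr, hr.1.2]
        abel) rfl
    have hR : ∀ i, R i * (p - r) = R i := by
      intro i
      rw [← h3, Finset.mul_sum, Finset.sum_eq_single i (fun j _ hj => h2 i j hj.symm) (by simp),
        (h1 i).1.2]
    have hRr : ∀ i, R i * r = 0 := by
      intro i
      rw [← hR i, mul_assoc, sub_mul, hpr, hr.1.2, sub_self, mul_zero]
    have hrR : ∀ i, r * R i = 0 := by
      intro i
      have := congrArg star (hRr i)
      rwa [star_mul, hr.1.1, (h1 i).1.1, star_zero] at this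
    -- The index `none` stands for the projection that was split off.
    refine ⟨Option ι, inferInstance, fun i => i.elim r R, fun i => i.elim a l, ?_, ?_, ?_, ?_⟩
    · rintro (_ | i)
      · exact hr
      · exact h1 i
    · rintro (_ | i) (_ | j) hij
      · exact absurd rfl hij
      · exact hrR j
      · exact hRr i
      · exact h2 i j fun h => hij (congrArg some h)
    · rw [Fintype.sum_option]
      simp only [Option.elim_none, Option.elim_some, h3]
      abel
    · rw [Fintype.sum_option]
      simp only [Option.elim_none, Option.elim_some, ← h4]
      abel

end TracialAlgebra

/-! ### Equivalence of projections and dimensions of corners. -/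

namespace TracialAlgebra

variable {A : Type*} [Ring A] [Algebra ℂ A] [StarRing A] [StarModule ℂ A] {τ : A →ₗ[ℂ] ℂ}

omit [StarModule ℂ A] in
-- Expanding gives (v - vp)* (v - vp) = 0, and the trace is faithful.
theorem Equivalent.mul_eq (hτ : IsFaithfulTrace τ) {p v : A} (hp : IsProj p) (h : star v * v = p) :
    v * p = v := by
  have : v - v * p = 0 := by
    refine hτ.eq_zero ?_
    rw [star_sub, star_mul, hp.1, sub_mul, mul_sub, mul_sub, ← mul_assoc (star v), h, hp.2,
      mul_assoc p, h, mul_assoc p, ← mul_assoc (star v), h, hp.2, hp.2]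
    simp
  exact (sub_eq_zero.1 this).symm

omit [Algebra ℂ A] [StarModule ℂ A] in
theorem Equivalent.refl {p : A} (hp : IsProj p) : Equivalent p p :=
  ⟨p, by rw [hp.1, hp.2], by rw [hp.1, hp.2]⟩

omit [Algebra ℂ A] [StarModule ℂ A] in
theorem Equivalent.symm {p q : A} (h : Equivalent p q) : Equivalent q p := by
  obtain ⟨v, h1, h2⟩ := h
  exact ⟨star v, by rw [star_star, h2], by rw [star_star, h1]⟩

omit [StarModule ℂ A] in
theorem Equivalent.trans (hτ : IsFaithfulTrace τ) {p q r : A} (hq : IsProj q)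
    (h : Equivalent p q) (h' : Equivalent q r) : Equivalent p r := by
  obtain ⟨v, h1, h2⟩ := h
  obtain ⟨w, h3, h4⟩ := h'
  have hw := Equivalent.mul_eq hτ hq h3
  have hv : q * v = v := by
    have := Equivalent.mul_eq (v := star v) hτ hq (by rw [star_star, h2])
    have := congrArg star this
    rwa [star_mul, star_star, hq.1] at this
  refine ⟨w * v, ?_, ?_⟩
  · rw [star_mul, mul_assoc, ← mul_assoc (star w), h3, hv, h1]
  · rw [star_mul, mul_assoc, ← mul_assoc v, h2, ← mul_assoc, hw, h4]

omit [StarModule ℂ A] in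
-- Right multiplication by v* carries one corner into the other, and multiplication by v undoes it.
theorem finrank_corner_le_of_equivalent (hτ : IsFaithfulTrace τ) [FiniteDimensional ℂ A]
    {p p' : A} (q : A) (hp : IsProj p) (hp' : IsProj p') (h : Equivalent p p') :
    Module.finrank ℂ (corner q p) ≤ Module.finrank ℂ (corner q p') := by
  obtain ⟨v, h1, h2⟩ := h
  have hv := Equivalent.mul_eq hτ hp h1
  have hv' : star v * p' = star v := Equivalent.mul_eq (v := star v) hτ hp' (by rw [star_star, h2])
  refine LinearMap.finrank_le_finrank_of_injective
    (f := (LinearMap.mulRight ℂ (star v)).restrict (p := corner q p) (q := corner q p') ?_) ?_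
  · intro z hz
    rw [mem_corner_iff'] at hz ⊢
    obtain ⟨x, rfl⟩ := hz
    refine ⟨x * p * star v, ?_⟩
    simp only [LinearMap.mulRight_apply, mul_assoc, hv']
  · rintro ⟨z, hz⟩ ⟨z', hz'⟩ h
    have h' : z * star v = z' * star v := congrArg Subtype.val h
    have key : ∀ z ∈ corner q p, z * star v * v = z := by
      intro z hz
      obtain ⟨x, rfl⟩ := mem_corner_iff'.1 hz
      rw [mul_assoc, h1, mul_assoc, hp.2]
    refine Subtype.ext ?_
    change z = z'
    rw [← key z hz, h', key z' hz']

omit [StarModule ℂ A] in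
theorem finrank_corner_congr_right (hτ : IsFaithfulTrace τ) [FiniteDimensional ℂ A] {p p' : A}
    (q : A) (hp : IsProj p) (hp' : IsProj p') (h : Equivalent p p') :
    Module.finrank ℂ (corner q p) = Module.finrank ℂ (corner q p') :=
  le_antisymm (finrank_corner_le_of_equivalent hτ q hp hp' h)
    (finrank_corner_le_of_equivalent hτ q hp' hp h.symm)

theorem finrank_corner_comm {p q : A} (hp : IsProj p) (hq : IsProj q) :
    Module.finrank ℂ (corner q p) = Module.finrank ℂ (corner p q) := by
  have key : ∀ {p q : A}, IsProj p → IsProj q → ∀ z ∈ corner q p, star z ∈ corner p q := by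
    intro p q hp hq z hz
    obtain ⟨x, rfl⟩ := mem_corner_iff'.1 hz
    rw [mem_corner_iff']
    exact ⟨star x, by rw [star_mul, star_mul, hp.1, hq.1, mul_assoc]⟩
  let e : corner q p ≃+ corner p q :=
    { toFun := fun z => ⟨star z.1, key hp hq z.1 z.2⟩
      invFun := fun z => ⟨star z.1, key hq hp z.1 z.2⟩
      left_inv := fun z => Subtype.ext (star_star _)
      right_inv := fun z => Subtype.ext (star_star _)
      map_add' := fun z w => Subtype.ext (star_add _ _) }
  -- The involution is only conjugate linear, so the ranks are compared along the automorphism of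
  -- complex conjugation.
  have := rank_eq_of_equiv_equiv (starRingEnd ℂ : ℂ → ℂ) e
    (Function.Involutive.bijective Complex.conj_conj)
    (fun r z => Subtype.ext (star_smul _ _))
  exact congrArg Cardinal.toNat this

omit [StarModule ℂ A] in
theorem finrank_corner_congr_left [StarModule ℂ A] (hτ : IsFaithfulTrace τ)
    [FiniteDimensional ℂ A] {q q' p : A} (hp : IsProj p) (hq : IsProj q) (hq' : IsProj q')
    (h : Equivalent q q') :
    Module.finrank ℂ (corner q p) = Module.finrank ℂ (corner q' p) := by
  rw [finrank_corner_comm hp hq, finrank_corner_congr_right hτ p hq hq' h,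
    finrank_corner_comm hq' hp]

/-- By minimality z*z = t f and zz* = s g. Here t > 0, and t = s follows from evaluating z z* z z*
in two ways; rescaling z by t^(-1/2) gives a partial isometry. -/
theorem IsMinProj.equivalent_of_ne_zero (hτ : IsFaithfulTrace τ) {f g z : A} (hf : IsMinProj f)
    (hg : IsMinProj g) (hz : z ∈ corner g f) (hz0 : z ≠ 0) : Equivalent f g := by
  rw [mem_corner_iff hg.1 hf.1] at hz
  have hzs : f * star z = star z := by
    have := congrArg star hz.2
    rwa [star_mul, hf.1.1] at this
  have hzs' : star z * g = star z := by
    have := congrArg star hz.1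
    rwa [star_mul, hg.1.1] at this
  obtain ⟨t, ht⟩ := hf.2.2 (star z * z)
  rw [← mul_assoc, hzs, mul_assoc, hz.2] at ht
  obtain ⟨s, hs⟩ := hg.2.2 (z * star z)
  rw [← mul_assoc, hz.1, mul_assoc, hzs'] at hs
  obtain ⟨a, ha, hta⟩ := hτ.pos z hz0
  obtain ⟨b, hb, htb⟩ := hτ.pos_proj hf.1 hf.2.1
  rw [ht, map_smul, htb, smul_eq_mul] at hta
  have hb0 : (b : ℂ) ≠ 0 := by exact_mod_cast hb.ne'
  have hta' : t = ((a / b : ℝ) : ℂ) := by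
    push_cast
    rw [eq_div_iff hb0, hta]
  have hab : 0 < a / b := div_pos ha hb
  -- Here t = a / b = τ(z*z) / τ(f), so this is t^(-1/2).
  set r : ℝ := (Real.sqrt (a / b))⁻¹ with hr
  have hr2 : (r : ℂ) * r * t = 1 := by
    rw [hta', hr]
    norm_cast
    rw [← mul_inv, Real.mul_self_sqrt hab.le, inv_mul_cancel₀ hab.ne']
  have hr0 : (r : ℂ) ≠ 0 := fun h => by simp [h] at hr2
  have hsr : star ((r : ℂ) • z) = (r : ℂ) • star z := by simp
  refine ⟨(r : ℂ) • z, ?_, ?_⟩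
  · rw [hsr, smul_mul_smul_comm, ht, smul_smul, hr2, one_smul]
  · rw [hsr, smul_mul_smul_comm, hs, smul_smul]
    have hs1 : s * s = t * s := by
      have : (s * s) • g = (t * s) • g := by
        calc (s * s) • g = (s • g) * (s • g) := by rw [smul_mul_smul_comm, hg.1.2]
          _ = (t * s) • g := by
            rw [← hs, mul_assoc, ← mul_assoc (star z), ht, smul_mul_assoc, hzs, mul_smul_comm, hs,
              smul_smul]
      exact smul_left_injective ℂ hg.2.1 this
    have hs0 : s ≠ 0 := by
      intro h
      rw [h, zero_smul] at hs
      exact hz0 (hτ.eq_zero' hs)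
    rw [mul_right_cancel₀ hs0 hs1, hr2, one_smul]

omit [StarModule ℂ A] in
-- Every z in the corner equals (z v*) v, and z v* is a multiple of g by minimality; so v spans the
-- corner.
theorem finrank_corner_eq_one (hτ : IsFaithfulTrace τ) {f g : A} (hf : IsMinProj f)
    (hg : IsMinProj g) (h : Equivalent f g) : Module.finrank ℂ (corner g f) = 1 := by
  obtain ⟨v, h1, h2⟩ := h
  have hv := Equivalent.mul_eq hτ hf.1 h1
  have hv' : star v * g = star v := Equivalent.mul_eq (v := star v) hτ hg.1 (by rw [star_star, h2])
  have hgv : g * v = v := by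
    have := congrArg star hv'
    rwa [star_mul, star_star, hg.1.1] at this
  have hv0 : v ≠ 0 := by
    rintro rfl
    rw [mul_zero] at h1
    exact hf.2.1 h1.symm
  have : corner g f = Submodule.span ℂ {v} := by
    refine le_antisymm ?_ ?_
    · intro z hz
      rw [mem_corner_iff hg.1 hf.1] at hz
      obtain ⟨t, ht⟩ := hg.2.2 (z * star v)
      rw [← mul_assoc, hz.1, mul_assoc, hv'] at ht
      rw [Submodule.mem_span_singleton]
      refine ⟨t, ?_⟩
      rw [← hgv, ← smul_mul_assoc, ← ht, mul_assoc, h1, hz.2]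
    · rw [Submodule.span_singleton_le_iff_mem, mem_corner_iff hg.1 hf.1]
      exact ⟨hgv, hv⟩
  rw [this, finrank_span_singleton hv0]

open Classical in
-- Schur's lemma for minimal projections.
theorem finrank_corner_of_isMinProj (hτ : IsFaithfulTrace τ) {f g : A} (hf : IsMinProj f)
    (hg : IsMinProj g) :
    Module.finrank ℂ (corner g f) = if Equivalent f g then 1 else 0 := by
  split_ifs with h
  · exact finrank_corner_eq_one hτ hf hg h
  · have : corner g f = ⊥ := by
      rw [eq_bot_iff]
      intro z hz
      by_contra hz0
      exact h (hf.equivalent_of_ne_zero hτ hg hz hz0)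
    rw [this, finrank_bot]

omit [StarRing A] [StarModule ℂ A] in
/-- The corner of two sums of orthogonal idempotents is the direct sum of the corners. -/
theorem finrank_corner_sum [FiniteDimensional ℂ A] {J K : Type} [Fintype J] [Fintype K]
    [DecidableEq J] [DecidableEq K] (q : J → A) (p : K → A)
    (hq : ∀ i j, q i * q j = if i = j then q i else 0)
    (hp : ∀ i j, p i * p j = if i = j then p i else 0) :
    Module.finrank ℂ (corner (∑ j, q j) (∑ k, p k)) =
      ∑ j, ∑ k, Module.finrank ℂ (corner (q j) (p k)) := by
  have hq2 : ∀ i, (∑ j, q j) * q i = q i := by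
    intro i
    rw [Finset.sum_mul]
    simp [hq]
  have hp1 : ∀ i, p i * ∑ j, p j = p i := by
    intro i
    rw [Finset.mul_sum]
    simp [hp]
  have hqq : (∑ j, q j) * ∑ j, q j = ∑ j, q j := by
    rw [Finset.mul_sum]
    simp_rw [hq2]
  have hpp : (∑ j, p j) * ∑ j, p j = ∑ j, p j := by
    rw [Finset.sum_mul]
    simp_rw [hp1]
  have key : ∀ w, ∑ x : J × K, q x.1 * w * p x.2 = (∑ j, q j) * w * ∑ k, p k := by
    intro w
    rw [Fintype.sum_prod_type]
    simp_rw [← Finset.mul_sum]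
    rw [Finset.sum_mul, Finset.sum_mul]
  let e : corner (∑ j, q j) (∑ k, p k) ≃ₗ[ℂ] ((x : J × K) → corner (q x.1) (p x.2)) :=
    { toFun := fun z x => ⟨q x.1 * z.1 * p x.2, mem_corner_iff'.2 ⟨_, rfl⟩⟩
      invFun := fun y => ⟨∑ x, (y x).1, by
        refine Submodule.sum_mem _ fun x _ => ?_
        obtain ⟨z, hz⟩ := mem_corner_iff'.1 (y x).2
        rw [mem_corner_iff', hz]
        refine ⟨q x.1 * z * p x.2, ?_⟩
        rw [← mul_assoc, ← mul_assoc, hq2, mul_assoc _ (p x.2), hp1]⟩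
      map_add' := fun z w => by
        funext x
        exact Subtype.ext (by simp [mul_add, add_mul])
      map_smul' := fun t z => by
        funext x
        exact Subtype.ext (by simp)
      left_inv := by
        rintro ⟨z, hz⟩
        obtain ⟨y, rfl⟩ := mem_corner_iff'.1 hz
        refine Subtype.ext ?_
        change ∑ x : J × K, q x.1 * _ * p x.2 = _
        rw [key, ← mul_assoc, ← mul_assoc, hqq, mul_assoc, hpp]
      right_inv := by
        intro y
        funext x
        refine Subtype.ext ?_
        change q x.1 * (∑ x', (y x').1) * p x.2 = _
        rw [Finset.mul_sum, Finset.sum_mul, Finset.sum_eq_single x]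
        · obtain ⟨z, hz⟩ := mem_corner_iff'.1 (y x).2
          have h1 := hq x.1 x.1
          have h2 := hp x.2 x.2
          rw [if_pos rfl] at h1 h2
          rw [hz, mul_assoc, mul_assoc, mul_assoc, h2, ← mul_assoc, h1, mul_assoc]
        · intro x' _ hx'
          obtain ⟨z, hz⟩ := mem_corner_iff'.1 (y x').2
          rw [hz]
          by_cases h : x.1 = x'.1
          · have h2 : x'.2 ≠ x.2 := fun h2 => hx' (Prod.ext h.symm h2)
            rw [mul_assoc, mul_assoc, hp, if_neg h2, mul_zero, mul_zero]
          · rw [← mul_assoc, ← mul_assoc, hq, if_neg h, zero_mul, zero_mul, zero_mul]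
        · simp }
  rw [e.finrank_eq, Module.finrank_pi_fintype, Fintype.sum_prod_type]

/-- Every projection is a sum of orthogonal minimal projections. -/
theorem exists_sum_isMinProj [FiniteDimensional ℂ A] (hτ : IsFaithfulTrace τ) {p : A}
    (hp : IsProj p) : ∃ (K : Type) (_ : Fintype K) (_ : DecidableEq K) (R : K → A),
      (∀ i, IsMinProj (R i)) ∧ (∀ i j, R i * R j = if i = j then R i else 0) ∧ ∑ i, R i = p := by
  classical
  obtain ⟨K, _, R, -, h1, h2, h3, -⟩ := exists_spectral hτ hp hp.1 hp.2
  refine ⟨K, inferInstance, inferInstance, R, h1, ?_, h3⟩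
  intro i j
  split_ifs with h
  · rw [← h, (h1 i).1.2]
  · exact h2 i j h

/-- Let q and p be sums of minimal projections Q_j and P_k. By Schur's lemma dim(qAp) is the number
of pairs (j, k) with Q_j equivalent to P_k, and grouping the pairs by their common class gives the
left-hand side. It is stated with a type of triples because a path is such a triple. -/
theorem finrank_corner_eq_sum_card [FiniteDimensional ℂ A] (hτ : IsFaithfulTrace τ) {I : Type*}
    (F : I → A) (hF : ∀ i, IsMinProj (F i)) (h : ∀ f, IsMinProj f → ∃! i, Equivalent f (F i))
    {q p : A} (hq : IsProj q) (hp : IsProj p) :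
    Nat.card ((i : I) × Fin (Module.finrank ℂ (corner q (F i))) ×
      Fin (Module.finrank ℂ (corner (F i) p))) = Module.finrank ℂ (corner q p) := by
  classical
  obtain ⟨J, _, _, Q, hQ1, hQ2, rfl⟩ := exists_sum_isMinProj hτ hq
  obtain ⟨K, _, _, P, hP1, hP2, rfl⟩ := exists_sum_isMinProj hτ hp
  choose cls hcls hcls' using h
  have hiff : ∀ f (hf : IsMinProj f) i, Equivalent f (F i) ↔ cls f hf = i :=
    fun f hf i => ⟨fun h => (hcls' f hf i h).symm, fun h => h ▸ hcls f hf⟩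
  have hiff' : ∀ f (hf : IsMinProj f) g (hg : IsMinProj g),
      Equivalent f g ↔ cls g hg = cls f hf := by
    intro f hf g hg
    constructor
    · intro h
      exact (hiff g hg _).1 (h.symm.trans hτ hf.1 (hcls f hf))
    · intro h
      exact (hcls f hf).trans hτ (hF _).1 (h ▸ (hcls g hg).symm)
  have hone : ∀ f : A, IsMinProj f → ∀ i j : Unit,
      (fun _ : Unit => f) i * (fun _ : Unit => f) j = if i = j then (fun _ : Unit => f) i else 0 :=
    fun f hf i j => by simp [hf.1.2]
  have e1 : ∀ i, Module.finrank ℂ (corner (∑ j, Q j) (F i)) =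
      Fintype.card {j // cls (Q j) (hQ1 j) = i} := by
    intro i
    have := finrank_corner_sum Q (fun _ : Unit => F i) hQ2 (hone _ (hF i))
    rw [Fintype.sum_unique (fun _ : Unit => F i)] at this
    simp only [Finset.univ_unique, Finset.sum_singleton] at this
    rw [this, Fintype.card_subtype, Finset.card_filter]
    refine Finset.sum_congr rfl fun j _ => ?_
    rw [finrank_corner_of_isMinProj hτ (hF i) (hQ1 j)]
    exact if_congr (Iff.trans ⟨Equivalent.symm, Equivalent.symm⟩ (hiff _ _ _)) rfl rfl
  have e2 : ∀ i, Module.finrank ℂ (corner (F i) (∑ k, P k)) =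
      Fintype.card {k // cls (P k) (hP1 k) = i} := by
    intro i
    have := finrank_corner_sum (fun _ : Unit => F i) P (hone _ (hF i)) hP2
    rw [Fintype.sum_unique (fun _ : Unit => F i)] at this
    simp only [Finset.univ_unique, Finset.sum_singleton] at this
    rw [this, Fintype.card_subtype, Finset.card_filter]
    refine Finset.sum_congr rfl fun k _ => ?_
    rw [finrank_corner_of_isMinProj hτ (hP1 k) (hF i)]
    exact if_congr (hiff _ _ _) rfl rfl
  -- Each factor is the number of summands of the class `i`, so a triple is a pair of summands with
  -- the same class.
  have e : ((i : I) × Fin (Module.finrank ℂ (corner (∑ j, Q j) (F i))) ×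
      Fin (Module.finrank ℂ (corner (F i) (∑ k, P k)))) ≃
      {x : J × K // cls (Q x.1) (hQ1 x.1) = cls (P x.2) (hP1 x.2)} :=
    (Equiv.sigmaCongrRight fun i => Equiv.prodCongr
      ((finCongr (e1 i)).trans (Fintype.equivFin _).symm)
      ((finCongr (e2 i)).trans (Fintype.equivFin _).symm)).trans
    { toFun := fun y => ⟨(y.2.1.1, y.2.2.1), y.2.1.2.trans y.2.2.2.symm⟩
      invFun := fun x => ⟨cls (P x.1.2) (hP1 x.1.2), ⟨x.1.1, x.2⟩, ⟨x.1.2, rfl⟩⟩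
      left_inv := by
        rintro ⟨i, ⟨j, hj⟩, ⟨k, rfl⟩⟩
        rfl
      right_inv := fun x => rfl }
  rw [Nat.card_congr e, finrank_corner_sum Q P hQ2 hP2, Nat.card_eq_fintype_card,
    Fintype.card_subtype, Finset.card_filter, Fintype.sum_prod_type]
  refine Finset.sum_congr rfl fun j _ => Finset.sum_congr rfl fun k _ => ?_
  rw [finrank_corner_of_isMinProj hτ (hP1 k) (hQ1 j)]
  exact if_congr (hiff' _ _ _ _).symm rfl rfl

/-- A positive element is a positive combination of orthogonal minimal projections. -/
theorem exists_positive_decomposition [FiniteDimensional ℂ A] (hτ : IsFaithfulTrace τ) {x : A}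
    (hx : star x = x) (hpos : ∀ a, ∃ t : ℝ, 0 ≤ t ∧ τ (star a * x * a) = t) :
    ∃ (k : ℕ) (R : Fin k → A) (C : Fin k → ℝ), (∀ i, IsMinProj (R i)) ∧ (∀ i, 0 < C i) ∧
      (∀ i j, i ≠ j → R i * R j = 0) ∧ x = ∑ i, (C i : ℂ) • R i := by
  classical
  obtain ⟨K, _, R, l, h1, h2, -, h4⟩ := exists_spectral hτ (p := 1) ⟨star_one A, one_mul 1⟩ hx
    (one_mul x)
  -- Testing positivity on `R i` gives l_i τ(R_i) ≥ 0.
  have hl : ∀ i, 0 ≤ l i := by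
    intro i
    obtain ⟨t, ht, htr⟩ := hpos (R i)
    obtain ⟨s, hs, hsr⟩ := hτ.pos_proj (h1 i).1 (h1 i).2.1
    have hxR : x * R i = (l i : ℂ) • R i := by
      rw [h4, Finset.sum_mul, Finset.sum_eq_single i]
      · rw [smul_mul_assoc, (h1 i).1.2]
      · intro j _ hj
        rw [smul_mul_assoc, h2 j i hj, smul_zero]
      · simp
    rw [mul_assoc, hxR, (h1 i).1.1, mul_smul_comm, (h1 i).1.2, map_smul, hsr, smul_eq_mul] at htr
    have : l i * s = t := by exact_mod_cast htr
    by_contra hneg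
    push Not at hneg
    nlinarith
  -- The kernel of `x` is discarded, so that all coefficients become strictly positive.
  let e := (Fintype.equivFin {i // l i ≠ 0}).symm
  refine ⟨_, fun i => R (e i).1, fun i => l (e i).1, fun i => h1 _, fun i => ?_, fun i j hij => ?_,
    ?_⟩
  · exact lt_of_le_of_ne (hl _) (e i).2.symm
  · exact h2 _ _ fun h => hij (e.injective (Subtype.ext h))
  · rw [e.sum_comp (fun i : {i // l i ≠ 0} => (l i.1 : ℂ) • R i.1), h4]
    rw [← Finset.sum_filter_add_sum_filter_not Finset.univ (fun i => l i ≠ 0)]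
    rw [Finset.sum_eq_zero (s := Finset.univ.filter fun i => ¬ l i ≠ 0), add_zero]
    · exact Finset.sum_subtype _ (by simp) _
    · intro i hi
      simp only [ne_eq, not_not, Finset.mem_filter, Finset.mem_univ, true_and] at hi
      simp [hi]

omit [StarModule ℂ A] in
-- Pairwise orthogonal elements of nonzero norm for the form τ(x* y) are linearly independent:
-- pairing a relation with X_i isolates its i-th coefficient.
theorem le_finrank_of_orthogonal [FiniteDimensional ℂ A] {k : ℕ} (W : Submodule ℂ A)
    (X : Fin k → A) (hX : ∀ i, X i ∈ W) (h0 : ∀ i j, i ≠ j → τ (star (X i) * X j) = 0)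
    (h1 : ∀ i, τ (star (X i) * X i) ≠ 0) : k ≤ Module.finrank ℂ W := by
  have hlin : LinearIndependent ℂ fun i => (⟨X i, hX i⟩ : W) := by
    refine LinearIndependent.of_comp W.subtype ?_
    rw [Fintype.linearIndependent_iff]
    intro c hc i
    have := congrArg (fun y => τ (star (X i) * y)) hc
    simp only [Function.comp_apply, Submodule.subtype_apply, Finset.mul_sum, map_sum,
      mul_smul_comm, map_smul, mul_zero, map_zero] at this
    rw [Finset.sum_eq_single i] at this
    · exact (mul_eq_zero.1 this).resolve_right (h1 i)
    · intro j _ hj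
      rw [h0 i j hj.symm, smul_zero]
    · simp
  simpa using hlin.fintype_card_le_finrank

end TracialAlgebra

/-! ### Minimal projections and corners in a tower with a Jones projection. -/

namespace TracialAlgebra

variable {A B C : Type*} [Ring A] [Algebra ℂ A] [StarRing A] [StarModule ℂ A]
  [Ring B] [Algebra ℂ B] [StarRing B] [StarModule ℂ B]
  [Ring C] [Algebra ℂ C] [StarRing C] [StarModule ℂ C]
  {τ : A →ₗ[ℂ] ℂ} {σ : B →ₗ[ℂ] ℂ} {ρ : C →ₗ[ℂ] ℂ}
  {i : A →⋆ₐ[ℂ] B} {j : B →⋆ₐ[ℂ] C} {e : C}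

omit [StarModule ℂ A] [StarModule ℂ B] in
theorem IsProj.map {p : A} (hp : IsProj p) (f : A →⋆ₐ[ℂ] B) : IsProj (f p) :=
  ⟨by rw [← map_star, hp.1], by rw [← map_mul, hp.2]⟩

omit [StarModule ℂ A] [StarModule ℂ B] in
theorem Equivalent.map {p q : A} (h : Equivalent p q) (f : A →⋆ₐ[ℂ] B) :
    Equivalent (f p) (f q) := by
  obtain ⟨v, rfl, rfl⟩ := h
  exact ⟨f v, by rw [← map_star, ← map_mul], by rw [← map_star, ← map_mul]⟩

/-- The projection `e` behaves like the Jones projection for the inclusions `i` and `j`. -/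
structure IsJonesProjection (i : A →⋆ₐ[ℂ] B) (j : B →⋆ₐ[ℂ] C) (e : C) : Prop where
  proj : IsProj e
  comm : ∀ a, j (i a) * e = e * j (i a)
  exists_mul : ∀ x, ∃ b, x * e = j b * e
  exists_compress : ∀ x, ∃ a, e * x * e = j (i a) * e
  eq_zero : ∀ b, j b * e = 0 → b = 0
  injective : ∀ a, i a = 0 → a = 0

namespace IsJonesProjection

omit [StarModule ℂ A] [StarModule ℂ B] [StarModule ℂ C] in
theorem isProj (h : IsJonesProjection i j e) {g : A} (hg : IsProj g) : IsProj (j (i g) * e) := by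
  have hg' := (hg.map i).map j
  constructor
  · rw [star_mul, hg'.1, h.proj.1, h.comm]
  · rw [mul_assoc, ← mul_assoc e, ← h.comm, mul_assoc _ e, h.proj.2, ← mul_assoc, hg'.2]

omit [StarModule ℂ A] [StarModule ℂ B] [StarModule ℂ C] in
-- The Jones projection commutes with `A`, so `exists_compress` may be applied between `g` and `g'`.
theorem compress_mul (h : IsJonesProjection i j e) (g g' : A) (x : C) :
    ∃ a, (j (i g) * e) * x * (j (i g') * e) = j (i (g * a * g')) * e := by
  obtain ⟨a, ha⟩ := h.exists_compress x
  refine ⟨a, ?_⟩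
  calc (j (i g) * e) * x * (j (i g') * e) = j (i g) * (e * x * e) * j (i g') := by
        rw [h.comm g']
        simp only [mul_assoc]
    _ = j (i (g * a * g')) * e := by
        rw [ha, mul_assoc, mul_assoc, ← h.comm g']
        simp only [map_mul, mul_assoc]

omit [StarModule ℂ A] [StarModule ℂ B] [StarModule ℂ C] in
theorem isMinProj (h : IsJonesProjection i j e) {g : A} (hg : IsMinProj g) :
    IsMinProj (j (i g) * e) := by
  refine ⟨h.isProj hg.1, fun h0 => hg.2.1 (h.injective _ (h.eq_zero _ h0)), fun x => ?_⟩
  obtain ⟨a, ha⟩ := h.compress_mul g g x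
  obtain ⟨t, ht⟩ := hg.2.2 a
  exact ⟨t, by rw [ha, ht, map_smul, map_smul, smul_mul_assoc]⟩

omit [StarModule ℂ B] [StarModule ℂ C] in
-- A partial isometry between g e and g' e has the form (g' a g) e by `compress_mul`. Then g' a g is
-- a nonzero element of the corner, and this suffices for minimal projections. Conversely a partial
-- isometry in `A` is multiplied by e.
theorem equivalent_iff (h : IsJonesProjection i j e) (hτ : IsFaithfulTrace τ)
    (hρ : IsFaithfulTrace ρ) {g g' : A} (hg : IsMinProj g) (hg' : IsMinProj g') :
    Equivalent (j (i g) * e) (j (i g') * e) ↔ Equivalent g g' := by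
  constructor
  · rintro ⟨v, h1, h2⟩
    have hv := Equivalent.mul_eq hρ (h.isProj hg.1) h1
    have hv' : (j (i g') * e) * v = v := by rw [← h2, mul_assoc, h1, hv]
    have hv0 : v ≠ 0 := by
      rintro rfl
      rw [mul_zero] at h1
      exact (h.isMinProj hg).2.1 h1.symm
    obtain ⟨a, ha⟩ := h.compress_mul g' g v
    rw [hv', hv] at ha
    refine hg.equivalent_of_ne_zero hτ hg' (mem_corner_iff'.2 ⟨a, rfl⟩) fun h0 => hv0 ?_
    rw [ha, h0, map_zero, map_zero, zero_mul]
  · rintro ⟨v, h1, h2⟩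
    have hs : star (j (i v) * e) = j (i (star v)) * e := by
      rw [star_mul, h.proj.1, ← map_star, ← map_star, h.comm]
    have hm : ∀ a b : A, (j (i a) * e) * (j (i b) * e) = j (i (a * b)) * e := by
      intro a b
      rw [h.comm b, mul_assoc, ← mul_assoc e, h.proj.2, ← h.comm, map_mul, map_mul, mul_assoc]
    exact ⟨j (i v) * e, by rw [hs, hm, h1], by rw [hs, hm, h2]⟩

omit [StarModule ℂ B] in
-- If f x e is nonzero, decompose 1 in `A` into minimal projections g_k. Then some f x (g_k e) is
-- nonzero, and it joins two minimal projections.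
theorem eq_zero_or_exists_equivalent (h : IsJonesProjection i j e) [FiniteDimensional ℂ A]
    (hτ : IsFaithfulTrace τ) (hρ : IsFaithfulTrace ρ) {f : C} (hf : IsMinProj f) :
    (∀ x, f * x * e = 0) ∨ ∃ g : A, IsMinProj g ∧ Equivalent f (j (i g) * e) := by
  by_cases hx : ∀ x, f * x * e = 0
  · exact .inl hx
  push Not at hx
  obtain ⟨x, hx⟩ := hx
  obtain ⟨K, _, _, R, hR, -, hsum⟩ := exists_sum_isMinProj hτ (p := (1 : A))
    ⟨star_one A, one_mul 1⟩
  have : ∃ k, f * x * (j (i (R k)) * e) ≠ 0 := by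
    by_contra! h0
    refine hx ?_
    calc f * x * e = f * x * (j (i (∑ k, R k)) * e) := by rw [hsum, map_one, map_one, one_mul]
      _ = 0 := by
        rw [map_sum, map_sum, Finset.sum_mul, Finset.mul_sum]
        exact Finset.sum_eq_zero fun k _ => h0 k
  obtain ⟨k, hk⟩ := this
  exact .inr ⟨R k, hR k, ((h.isMinProj (hR k)).equivalent_of_ne_zero hρ hf
    (mem_corner_iff'.2 ⟨x, rfl⟩) hk).symm⟩

omit [StarModule ℂ A] [StarModule ℂ B] [StarModule ℂ C] in
-- A partial isometry from f to g e has an adjoint in f C e, which is zero. The two alternatives of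
-- `eq_zero_or_exists_equivalent` therefore exclude each other.
theorem not_equivalent (h : IsJonesProjection i j e) (hρ : IsFaithfulTrace ρ) {f : C}
    (hf : IsMinProj f) (hfe : ∀ x, f * x * e = 0) {g : A} (hg : IsProj g) :
    ¬ Equivalent f (j (i g) * e) := by
  rintro ⟨v, h1, h2⟩
  have hv : star v * (j (i g) * e) = star v :=
    Equivalent.mul_eq (v := star v) hρ (h.isProj hg) (by rw [star_star, h2])
  have hv' : f * star v = star v := by
    have := congrArg star (Equivalent.mul_eq hρ hf.1 h1)
    rwa [star_mul, hf.1.1] at this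
  have : star v = 0 := by
    rw [← hv, ← hv', h.comm, ← mul_assoc, hfe, zero_mul]
  rw [this, zero_mul] at h1
  exact hf.2.1 h1.symm

omit [StarModule ℂ B] in
/-- If the families `G` and `N` represent the minimal projections of `A` and the minimal
projections of `C` that are orthogonal to `e`, then `G * e` and `N` together represent all minimal
projections of `C`. -/
theorem existsUnique_equivalent (h : IsJonesProjection i j e) [FiniteDimensional ℂ A]
    (hτ : IsFaithfulTrace τ) (hρ : IsFaithfulTrace ρ) {I J : Type*} (G : I → A) (N : J → C)
    (hG : ∀ k, IsMinProj (G k)) (hN : ∀ k, IsMinProj (N k) ∧ ∀ x, N k * x * e = 0)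
    (hG' : ∀ g, IsMinProj g → ∃! k, Equivalent g (G k))
    (hN' : ∀ f, IsMinProj f → (∀ x, f * x * e = 0) → ∃! k, Equivalent f (N k)) {f : C}
    (hf : IsMinProj f) :
    ∃! k : I ⊕ J, Equivalent f (Sum.elim (fun k => j (i (G k)) * e) N k) := by
  rcases h.eq_zero_or_exists_equivalent hτ hρ hf with hfe | ⟨g, hg, hfg⟩
  · obtain ⟨k, hk, hk'⟩ := hN' f hf hfe
    refine ⟨.inr k, hk, ?_⟩
    rintro (l | l) hl
    · exact absurd hl (h.not_equivalent hρ hf hfe (hG l).1)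
    · rw [hk' l hl]
  · obtain ⟨k, hk, hk'⟩ := hG' g hg
    refine ⟨.inl k, hfg.trans hρ (h.isProj hg.1) ((h.equivalent_iff hτ hρ hg (hG k)).2 hk), ?_⟩
    rintro (l | l) hl
    · rw [hk' l ((h.equivalent_iff hτ hρ hg (hG l)).1 (hfg.symm.trans hρ hf.1 hl))]
    · exact absurd (hl.symm.trans hρ hf.1 hfg) (h.not_equivalent hρ (hN l).1 (hN l).2 hg.1)

omit [StarModule ℂ A] [StarModule ℂ B] [StarModule ℂ C] in
-- The map b ↦ b e is injective on `B`, and C e = B e makes it onto the larger corner. This is the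
-- Frobenius reciprocity that reflects the edges of the principal graph.
theorem finrank_corner (h : IsJonesProjection i j e) {q : B} {g : A} :
    Module.finrank ℂ (corner (j q) (j (i g) * e)) = Module.finrank ℂ (corner q (i g)) := by
  let φ : corner q (i g) →ₗ[ℂ] corner (j q) (j (i g) * e) :=
    ((LinearMap.mulRight ℂ e).comp j.toAlgHom.toLinearMap).restrict (by
      intro z hz
      obtain ⟨x, rfl⟩ := mem_corner_iff'.1 hz
      rw [mem_corner_iff']
      refine ⟨j x, ?_⟩
      change j (q * x * i g) * e = _
      rw [map_mul, map_mul, mul_assoc])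
  have hφ : Function.Bijective φ := by
    constructor
    · rw [injective_iff_map_eq_zero]
      rintro ⟨z, hz⟩ h0
      exact Subtype.ext (h.eq_zero z (congrArg Subtype.val h0))
    · rintro ⟨z, hz⟩
      obtain ⟨x, rfl⟩ := mem_corner_iff'.1 hz
      obtain ⟨b, hb⟩ := h.exists_mul x
      refine ⟨⟨q * b * i g, mem_corner_iff'.2 ⟨b, rfl⟩⟩, Subtype.ext ?_⟩
      calc j (q * b * i g) * e = j q * (j b * e) * j (i g) := by
            rw [map_mul, map_mul, mul_assoc, h.comm]
            simp only [mul_assoc]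
        _ = j q * x * (j (i g) * e) := by
            rw [← hb, h.comm]
            simp only [mul_assoc]
  exact (LinearEquiv.ofBijective φ hφ).finrank_eq.symm

end IsJonesProjection

end TracialAlgebra

/-! ### Linearity of the operations. -/

namespace PlanarAlgebra

variable (S : PlanarAlgebra.{u})

theorem isLinearMap_Z {c out : Colour} (T : Tangle (fun _ : Unit => c) out) :
    IsLinearMap ℂ fun x : S.V c => S.Z T fun _ => x := by
  have h : ∀ x w : S.V c, Function.update (fun _ : Unit => x) () w = fun _ => w := by
    intro x w
    funext
    rfl
  constructor
  · intro x y
    have := (S.Z T).map_update_add (fun _ => x) () x y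
    rwa [h, h, h] at this
  · intro t x
    have := (S.Z T).map_update_smul (fun _ => x) () t x
    rwa [h, h] at this

theorem mul_add {c : Colour} (x y z : S.V c) : S.mul x (y + z) = S.mul x y + S.mul x z := by
  have h : ∀ w, Function.update (![x, y] : Fin 2 → S.V c) 1 w = ![x, w] := by
    intro w
    funext k
    fin_cases k <;> rfl
  have := (S.Z (stack c 2)).map_update_add (![x, y] : Fin 2 → S.V c) 1 y z
  rwa [h, h, h] at this

theorem add_mul {c : Colour} (x y z : S.V c) : S.mul (x + y) z = S.mul x z + S.mul y z := by
  have h : ∀ w, Function.update (![x, z] : Fin 2 → S.V c) 0 w = ![w, z] := by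
    intro w
    funext k
    fin_cases k <;> rfl
  have := (S.Z (stack c 2)).map_update_add (![x, z] : Fin 2 → S.V c) 0 x y
  rwa [h, h, h] at this

theorem mul_smul {c : Colour} (t : ℂ) (x y : S.V c) : S.mul x (t • y) = t • S.mul x y := by
  have h : ∀ w, Function.update (![x, y] : Fin 2 → S.V c) 1 w = ![x, w] := by
    intro w
    funext k
    fin_cases k <;> rfl
  have := (S.Z (stack c 2)).map_update_smul (![x, y] : Fin 2 → S.V c) 1 t y
  rwa [h, h] at this

theorem smul_mul {c : Colour} (t : ℂ) (x y : S.V c) : S.mul (t • x) y = t • S.mul x y := by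
  have h : ∀ w, Function.update (![x, y] : Fin 2 → S.V c) 0 w = ![w, y] := by
    intro w
    funext k
    fin_cases k <;> rfl
  have := (S.Z (stack c 2)).map_update_smul (![x, y] : Fin 2 → S.V c) 0 t x
  rwa [h, h] at this

theorem mul_zero {c : Colour} (x : S.V c) : S.mul x 0 = 0 := by
  rw [← zero_smul ℂ (0 : S.V c), S.mul_smul, zero_smul, zero_smul]

theorem zero_mul {c : Colour} (x : S.V c) : S.mul 0 x = 0 := by
  rw [← zero_smul ℂ (0 : S.V c), S.smul_mul, zero_smul, zero_smul]

theorem condExp_zero {d : Colour} : S.condExp (0 : S.V ⟨d.n + 1, d.shaded⟩) = 0 := by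
  unfold condExp act
  split_ifs with h
  · exact MultilinearMap.map_coord_zero _ (⟨0, Nat.one_pos⟩ : Fin 1) rfl
  · rfl

theorem rightOfString_smul (t : ℂ) (x : S.V ⟨0, true⟩) :
    S.rightOfString (t • x) = t • S.rightOfString x := by
  unfold rightOfString act
  split_ifs with h
  · have := MultilinearMap.map_smul_univ (S.Z (TangleCode.rightOfString.toTangle h (Equiv.refl _)))
      (fun _ => t) (fun _ => x)
    refine this.trans (congrArg (· • _) ?_)
    exact (Finset.prod_const t).trans (pow_one t)
  · rw [smul_zero]

end PlanarAlgebra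

/-! ### The boxes with n ≤ 3 as tracial *-algebras. -/

namespace SubfactorPlanarAlgebra

variable (S : SubfactorPlanarAlgebra.{u})

/-- The empty diagram is the unit of S_0, so S_0 would be zero, against `finrank_zero`. -/
theorem one_zero_ne_zero : S.one ⟨0, false⟩ ≠ 0 := by
  intro h
  have h0 : ∀ x : S.Box 0, x = 0 := by
    intro x
    rw [← S.one_mul (by norm_num) x, h, ← zero_smul ℂ (0 : S.Box 0), S.smul_mul,
      zero_smul, zero_smul]
  have := S.finrank_zero false
  have hsub : Subsingleton (S.Box 0) := ⟨fun x y => (h0 x).trans (h0 y).symm⟩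
  rw [Module.finrank_zero_of_subsingleton] at this
  exact zero_ne_one this

theorem eq_scalar_smul (x : S.Box 0) : x = S.scalar x • S.one ⟨0, false⟩ := by
  have : ∃ t : ℂ, x = t • S.one ⟨0, false⟩ := by
    obtain ⟨t, ht⟩ := (finrank_eq_one_iff_of_nonzero' _ S.one_zero_ne_zero).1
      (S.finrank_zero false) x
    exact ⟨t, ht.symm⟩
  unfold PlanarAlgebra.scalar
  rw [dif_pos this]
  exact this.choose_spec

theorem scalar_eq {x : S.Box 0} {t : ℂ} (h : x = t • S.one ⟨0, false⟩) : S.scalar x = t := by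
  refine smul_left_injective ℂ S.one_zero_ne_zero ?_
  change S.scalar x • _ = t • _
  rw [← h, ← S.eq_scalar_smul]

/-- The `*`-algebra of `n`-boxes. -/
def BoxAlgebra (n : ℕ) (_ : n < 4) : Type u := S.Box n

namespace BoxAlgebra

variable {S} {n : ℕ} {hn : n < 4}

noncomputable instance : AddCommGroup (S.BoxAlgebra n hn) :=
  inferInstanceAs (AddCommGroup (S.Box n))

noncomputable instance : Module ℂ (S.BoxAlgebra n hn) := inferInstanceAs (Module ℂ (S.Box n))

instance : FiniteDimensional ℂ (S.BoxAlgebra n hn) := S.finiteDimensional ⟨n, false⟩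

noncomputable instance : Ring (S.BoxAlgebra n hn) where
  __ := (inferInstance : AddCommGroup (S.BoxAlgebra n hn))
  mul x y := S.mul x y
  one := S.one ⟨n, false⟩
  left_distrib := S.mul_add
  right_distrib := S.add_mul
  zero_mul := S.zero_mul
  mul_zero := S.mul_zero
  mul_assoc := S.mul_assoc hn
  one_mul := S.one_mul hn
  mul_one := S.mul_one hn

noncomputable instance : Algebra ℂ (S.BoxAlgebra n hn) :=
  Algebra.ofModule S.smul_mul S.mul_smul

noncomputable instance : StarRing (S.BoxAlgebra n hn) where
  star x := S.star (c := ⟨n, false⟩) x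
  star_involutive x := S.star_star x
  star_mul x y := S.star_mul hn x y
  star_add x y := S.star_add x y

instance : StarModule ℂ (S.BoxAlgebra n hn) := ⟨fun t x => S.star_smul t x⟩

variable (S n hn) in
/-- The Markov trace. -/
noncomputable def trace : S.BoxAlgebra n hn →ₗ[ℂ] ℂ where
  toFun x := S.scalar (S.tr (c := ⟨n, false⟩) x)
  map_add' x y := by
    refine S.scalar_eq ?_
    rw [add_smul, ← S.eq_scalar_smul, ← S.eq_scalar_smul]
    exact (S.isLinearMap_Z (traceTangle ⟨n, false⟩)).map_add x y
  map_smul' t x := by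
    refine S.scalar_eq ?_
    rw [smul_assoc, ← S.eq_scalar_smul]
    exact (S.isLinearMap_Z (traceTangle ⟨n, false⟩)).map_smul t x

theorem tr_eq (x : S.BoxAlgebra n hn) :
    S.tr (c := ⟨n, false⟩) x = trace S n hn x • S.one ⟨0, false⟩ := S.eq_scalar_smul _

theorem isFaithfulTrace : TracialAlgebra.IsFaithfulTrace (trace S n hn) where
  comm x y := congrArg S.scalar (S.tr_mul_comm hn x y)
  pos x hx := by
    obtain ⟨t, ht, h⟩ := S.tr_pos (c := ⟨n, false⟩) x hx
    exact ⟨t, ht, S.scalar_eq h⟩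

variable (S) in
/-- The inclusion that adds a string on the right. -/
noncomputable def inclLinear (n : ℕ) (hn : n < 3) :
    S.BoxAlgebra n (hn.trans (by norm_num)) →ₗ[ℂ] S.BoxAlgebra (n + 1) (Nat.succ_lt_succ hn) where
  toFun x := S.incl (c := ⟨n, false⟩) x
  map_add' := (S.isLinearMap_Z (inclTangle ⟨n, false⟩)).map_add
  map_smul' := (S.isLinearMap_Z (inclTangle ⟨n, false⟩)).map_smul

variable (S) in
/-- The inclusion that adds a string on the right, as a homomorphism. -/
noncomputable def incl (n : ℕ) (hn : n < 3) :
    S.BoxAlgebra n (hn.trans (by norm_num)) →⋆ₐ[ℂ] S.BoxAlgebra (n + 1) (Nat.succ_lt_succ hn) where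
  __ := AlgHom.ofLinearMap (inclLinear S n hn) (S.incl_one hn) (S.incl_mul hn)
  map_star' x := (S.star_incl hn x).symm

end BoxAlgebra

end SubfactorPlanarAlgebra

/-! ### The Jones projections in the algebras of boxes. -/

namespace SubfactorPlanarAlgebra

variable (S : SubfactorPlanarAlgebra.{u})

open TracialAlgebra

theorem incl_zero {c : Colour} : S.incl (0 : S.V c) = 0 := (S.isLinearMap_Z (inclTangle c)).map_zero

theorem incl_smul {c : Colour} (t : ℂ) (x : S.V c) : S.incl (t • x) = t • S.incl x :=
  (S.isLinearMap_Z (inclTangle c)).map_smul t x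

/-- A nonzero 2-box excludes the degenerate case 1 = 0 in S_1, in which δ would vanish and the Jones
projections would be meaningless. -/
theorem one_ne_zero_of_ne_zero {P : S.Box 2} (hP : P ≠ 0) : S.one ⟨1, false⟩ ≠ 0 := by
  intro h
  refine hP ?_
  have h1 : S.one ⟨2, false⟩ = 0 := by
    rw [← S.incl_one (n := 1) (by norm_num), h, S.incl_zero]
  rw [← S.one_mul (n := 2) (by norm_num) P, h1, S.zero_mul]

theorem exists_delta_eq (h : S.one ⟨1, false⟩ ≠ 0) :
    ∃ t : ℝ, 0 < t ∧ S.delta = t ∧ S.tr (S.one ⟨1, false⟩) = (t : ℂ) • S.one ⟨0, false⟩ := by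
  obtain ⟨t, ht, h'⟩ := S.tr_pos (S.one ⟨1, false⟩) h
  have hs : S.star (S.one ⟨1, false⟩) = S.one ⟨1, false⟩ :=
    star_one (S.BoxAlgebra 1 (by norm_num))
  rw [hs, S.one_mul (n := 1) (by norm_num)] at h'
  exact ⟨t, ht, S.scalar_eq h', h'⟩

theorem cup_mul_self (h : S.one ⟨1, false⟩ ≠ 0) {n : ℕ} (hn : n < 2) :
    S.mul (S.cup n) (S.cup n) = S.delta • S.cup n := by
  obtain ⟨t, -, ht, htr⟩ := S.exists_delta_eq h
  obtain rfl | rfl : n = 0 ∨ n = 1 := by omega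
  · rw [S.cup_zero_mul_self, htr, S.incl_smul, S.incl_smul, S.incl_one (n := 0) (by norm_num),
      S.incl_one (n := 1) (by norm_num), S.smul_mul, S.one_mul (n := 2) (by norm_num), ht]
  · rw [S.cup_one_mul_self, S.tr_one_shaded _ htr, S.rightOfString_smul, S.rightOfString_one,
      S.incl_smul, S.incl_smul, S.incl_one (n := 1) (by norm_num),
      S.incl_one (n := 2) (by norm_num), S.smul_mul, S.one_mul (n := 3) (by norm_num), ht]

namespace BoxAlgebra

variable {S} in
/-- A box as an element of the algebra of boxes. -/
def of {n : ℕ} (hn : n < 4) (x : S.Box n) : S.BoxAlgebra n hn := x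

/-- The diagrammatic identities for the cup-cap diagram, divided by powers of δ. -/
theorem isJonesProjection (h : S.one ⟨1, false⟩ ≠ 0) {n : ℕ} (hn : n < 2) :
    IsJonesProjection (incl S n (by omega)) (incl S (n + 1) (by omega))
      (S.jones n : S.BoxAlgebra (n + 2) (by omega)) := by
  obtain ⟨t, ht0, ht, -⟩ := S.exists_delta_eq h
  have hδ : S.delta ≠ 0 := by
    rw [ht]
    exact_mod_cast ht0.ne'
  have hδs : star S.delta⁻¹ = S.delta⁻¹ := by
    rw [ht]
    simp
  have hn2 : n + 2 < 4 := by omega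
  have hn1 : n + 1 < 4 := by omega
  let c : S.BoxAlgebra (n + 2) hn2 := S.cup n
  have he : (S.jones n : S.BoxAlgebra (n + 2) hn2) = S.delta⁻¹ • c := rfl
  have hcc : c * c = S.delta • c := S.cup_mul_self h hn
  have hcs : star c = c := S.star_cup hn
  -- The depth is quantified anew, because the injectivity of the inclusion of S_1 uses the diagram
  -- one level lower.
  have hinj : ∀ {n : ℕ} (hn : n < 2) (b : S.BoxAlgebra (n + 1) (by omega)),
      S.mul (S.incl (c := ⟨n + 1, false⟩) b) (S.cup n) = 0 → b = 0 := by
    intro n hn b hb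
    have := S.condExp_mul_cup hn b
    rw [hb, S.condExp_zero] at this
    exact this.symm
  constructor
  · constructor
    · rw [he, star_smul, hδs, hcs]
    · rw [he, smul_mul_smul_comm, hcc, smul_smul, mul_assoc, inv_mul_cancel₀ hδ, _root_.mul_one]
  · intro a
    rw [he, mul_smul_comm, smul_mul_assoc]
    exact congrArg (S.delta⁻¹ • ·) (S.incl_incl_mul_cup hn a)
  · intro x
    refine ⟨S.condExp (d := ⟨n + 1, false⟩) (S.mul x (S.cup n)), ?_⟩
    rw [he, mul_smul_comm, mul_smul_comm]
    exact congrArg (S.delta⁻¹ • ·) (S.mul_cup hn x)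
  · intro x
    let a : S.BoxAlgebra n (by omega) :=
      S.condExp (d := ⟨n, false⟩) (S.condExp (d := ⟨n + 1, false⟩) (S.mul x (S.cup n)))
    -- Two factors δ⁻¹ stand on the left, and only one of them is used up by the Jones projection on
    -- the right.
    refine ⟨S.delta⁻¹ • a, ?_⟩
    rw [he, map_smul, map_smul, smul_mul_assoc, smul_mul_assoc, mul_smul_comm, smul_mul_assoc,
      mul_smul_comm]
    exact congrArg (fun y => S.delta⁻¹ • S.delta⁻¹ • y) (S.cup_mul_cup hn x)
  · intro b hb
    rw [he, mul_smul_comm] at hb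
    exact hinj hn b ((smul_eq_zero.1 hb).resolve_left (inv_ne_zero hδ))
  · intro a ha
    -- The inclusion of S_0 is injective because S_0 is spanned by 1 and 1 ≠ 0 in S_1; the inclusion
    -- of S_1 is injective by the zigzag identity.
    obtain rfl | rfl : n = 0 ∨ n = 1 := by omega
    · have ha' := S.eq_scalar_smul a
      have h1 : S.incl (c := ⟨0, false⟩) a = 0 := ha
      rw [ha', S.incl_smul, S.incl_one (n := 0) (by norm_num)] at h1
      rw [(smul_eq_zero.1 h1).resolve_right h, zero_smul] at ha'
      exact ha'
    · refine hinj (n := 0) (by norm_num) a ?_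
      have h1 : S.incl (c := ⟨1, false⟩) a = 0 := ha
      rw [h1, S.zero_mul]

end BoxAlgebra

/-! ### The rank inequality. -/

section rank

variable {P Q : S.Box 2} (hP : S.IsProjection P) (hQ : S.IsProjection Q)

/-- The map that carries a 2-box `R` to the element `Q R' P` of `Q S₃ P`, where `R'` is the rotated
2-box. -/
noncomputable def toCorner (P Q R : S.Box 2) : S.BoxAlgebra 3 (by norm_num) :=
  BoxAlgebra.incl S 2 (by norm_num) Q * BoxAlgebra.of _ (S.rotateShift R) *
    BoxAlgebra.incl S 2 (by norm_num) P

include hP hQ in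
-- The sphere identity `tr_rotateShift_mul` with a = R* and b = R'. On the 3-box side it has one `P`
-- and one `Q`; idempotence and the trace property double them, so that the form of the corner
-- appears.
theorem trace_toCorner (R R' : S.BoxAlgebra 2 (of_decide_eq_true rfl)) :
    BoxAlgebra.trace S 2 _ (star R *
      BoxAlgebra.of _ (S.coproduct (S.contragredient P) Q) * R') =
    BoxAlgebra.trace S 3 (by norm_num) (star (S.toCorner P Q R) * S.toCorner P Q R') := by
  have hP' : IsProj (A := S.BoxAlgebra 2 (by norm_num)) P := hP
  have hQ' : IsProj (A := S.BoxAlgebra 2 (by norm_num)) Q := hQ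
  have hp := hP'.map (BoxAlgebra.incl S 2 (by norm_num))
  have hq := hQ'.map (BoxAlgebra.incl S 2 (by norm_num))
  unfold toCorner
  set p := BoxAlgebra.incl S 2 (by norm_num) P with hpd
  set q := BoxAlgebra.incl S 2 (by norm_num) Q with hqd
  let g : S.BoxAlgebra 3 (by norm_num) := S.rotateShift (S.contragredient (S.star R))
  let g' : S.BoxAlgebra 3 (by norm_num) := S.rotateShift R'
  have hg : star (BoxAlgebra.of (n := 3) (by norm_num) (S.rotateShift R)) = g :=
    S.star_rotateShift R
  have h1 : BoxAlgebra.trace S 3 (by norm_num) (g * q * g' * p) =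
      BoxAlgebra.trace S 3 (by norm_num)
        (star (q * BoxAlgebra.of (n := 3) _ (S.rotateShift R) * p) * (q * g' * p)) := by
    rw [star_mul, star_mul, hg, hp.1, hq.1]
    calc _ = BoxAlgebra.trace S 3 (by norm_num) ((g * q * g' * p) * p) := by
          rw [mul_assoc _ p p, hp.2]
      _ = BoxAlgebra.trace S 3 (by norm_num) (p * (g * (q * q) * g' * p)) := by
          rw [BoxAlgebra.isFaithfulTrace.comm, hq.2]
      _ = _ := by simp only [mul_assoc]
  refine Eq.trans ?_ h1
  exact S.scalar_eq (S.tr_rotateShift_mul P Q (S.star R) R' _ (BoxAlgebra.tr_eq (g * q * g' * p)))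

include hP hQ in
-- By `trace_toCorner` the positivity of the coproduct becomes the positivity of the trace of y* y
-- with y in Q S_3 P.
theorem exists_hasRank : ∃ k, S.HasRank (S.coproduct (S.contragredient P) Q) k := by
  refine exists_positive_decomposition (A := S.BoxAlgebra 2 (by norm_num))
    BoxAlgebra.isFaithfulTrace
    (x := BoxAlgebra.of (n := 2) (by norm_num) (S.coproduct (S.contragredient P) Q)) ?_ ?_
  · have : S.star (S.coproduct (S.contragredient P) Q) = S.coproduct (S.contragredient P) Q := by
      rw [S.star_coproduct, S.star_contragredient, hP.1, hQ.1]
    exact this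
  · intro a
    rw [S.trace_toCorner hP hQ]
    by_cases h : S.toCorner P Q a = 0
    · exact ⟨0, le_rfl, by rw [h, mul_zero, map_zero, Complex.ofReal_zero]⟩
    · obtain ⟨t, ht, h'⟩ := BoxAlgebra.isFaithfulTrace.pos _ h
      exact ⟨t, ht.le, h'⟩

include hP hQ in
theorem le_finrank_of_hasRank {k : ℕ} (h : S.HasRank (S.coproduct (S.contragredient P) Q) k) :
    k ≤ Module.finrank ℂ (S.corner (S.incl Q : S.Box 3) (S.incl P : S.Box 3)) := by
  obtain ⟨R, C, hR, hC, hRR, hX⟩ := h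
  let R' : Fin k → S.BoxAlgebra 2 (by norm_num) := R
  have hR' : ∀ i, IsMinProj (R' i) := hR
  have hRR' : ∀ i j, i ≠ j → R' i * R' j = 0 := hRR
  have hX' : BoxAlgebra.of (n := 2) (by norm_num) (S.coproduct (S.contragredient P) Q) =
      ∑ i, (C i : ℂ) • R' i := hX
  -- The images of the R_i in the corner have the Gram matrix with entries C_j tr(R_i R_j), which is
  -- diagonal with positive diagonal.
  have key : ∀ i j, BoxAlgebra.trace S 3 (by norm_num)
      (star (S.toCorner P Q (R' i)) * S.toCorner P Q (R' j)) =
      C j * BoxAlgebra.trace S 2 (by norm_num) (R' i * R' j) := by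
    intro i j
    rw [← S.trace_toCorner hP hQ, hX', (hR' i).1.1, mul_assoc, Finset.sum_mul,
      Finset.sum_eq_single j]
    · rw [smul_mul_assoc, (hR' j).1.2, mul_smul_comm, map_smul, smul_eq_mul]
    · intro l _ hl
      rw [smul_mul_assoc, hRR' l j hl, smul_zero]
    · simp
  refine le_finrank_of_orthogonal (A := S.BoxAlgebra 3 (by norm_num))
    (τ := BoxAlgebra.trace S 3 (by norm_num)) _ (fun i => S.toCorner P Q (R' i))
    (fun i => mem_corner_iff'.2 ⟨_, rfl⟩) ?_ ?_
  · intro i j hij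
    rw [key, hRR' i j hij, map_zero, mul_zero]
  · intro i
    obtain ⟨t, ht, h'⟩ := BoxAlgebra.isFaithfulTrace.pos_proj (hR' i).1 (hR' i).2.1
    rw [key, (hR' i).1.2, h']
    exact_mod_cast (mul_pos (hC i) ht).ne'

end rank

end SubfactorPlanarAlgebra

/-! ### New projections and the vertices of the principal graph. -/

namespace SubfactorPlanarAlgebra

variable (S : SubfactorPlanarAlgebra.{u})

open TracialAlgebra

namespace BoxAlgebra

variable {S}

/-- Pairing p with the element x e (x e)* of the ideal gives the squared norm of p x e, so
orthogonality forces p x e = 0. Conversely (y e z)* p = z* (p y e)*. -/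
theorem mul_jones_eq_zero_iff {n : ℕ} (hn : n + 2 < 4) {p : S.BoxAlgebra (n + 2) hn}
    (hp : IsProj p) :
    (∀ x ∈ S.jonesIdeal (n + 2), S.tr (S.mul (S.star x) p) = 0) ↔
      ∀ x, p * x * of hn (S.jones n) = 0 := by
  have htr : ∀ x : S.BoxAlgebra (n + 2) hn, S.tr (S.mul (S.star x) p) = 0 ↔
      trace S _ hn (star x * p) = 0 := by
    intro x
    have h1 : S.tr (S.mul (S.star x) p) = trace S _ hn (star x * p) • S.one ⟨0, false⟩ :=
      tr_eq (star x * p)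
    rw [h1, smul_eq_zero, or_iff_left S.one_zero_ne_zero]
  set e := of hn (S.jones n) with he
  constructor
  · intro h x
    by_contra hx
    obtain ⟨t, ht, h'⟩ := isFaithfulTrace.pos _ hx
    have h0 := (htr (x * e * (star e * star x))).1
      (h _ (Submodule.subset_span ⟨x, star e * star x, rfl⟩))
    rw [star_mul, star_mul, star_mul, star_star, star_star] at h0
    have h1 : star (p * x * e) * (p * x * e) = (star e * star x * p) * (x * e) := by
      rw [star_mul, star_mul, hp.1]
      calc _ = star e * star x * (p * p) * (x * e) := by simp only [mul_assoc]
        _ = _ := by rw [hp.2]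
    rw [h1, isFaithfulTrace.comm] at h'
    rw [← mul_assoc, ← mul_assoc] at h'
    rw [← mul_assoc] at h0
    have : (t : ℂ) = 0 := h'.symm.trans h0
    exact ht.ne' (by exact_mod_cast this)
  · intro h x hx
    refine (htr x).2 ?_
    refine Submodule.span_induction (p := fun x _ => trace S _ hn
      (star (of hn x) * p) = 0) ?_ ?_ ?_ ?_ hx
    · rintro _ ⟨y, z, rfl⟩
      have h1 : star (of hn (S.mul (S.mul y (S.jones n)) z)) * p =
          star (of hn z) * star (p * (of hn y) * e) := by
        have : of hn (S.mul (S.mul y (S.jones n)) z) =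
          of hn y * e * of hn z := rfl
        rw [this, star_mul, star_mul, star_mul, star_mul, hp.1]
        simp only [mul_assoc]
      rw [h1, h, star_zero, mul_zero, map_zero]
    · have : star (0 : S.BoxAlgebra (n + 2) hn) * p = 0 := by rw [star_zero, zero_mul]
      exact (congrArg _ this).trans (map_zero _)
    · intro y z _ _ hy hz
      have : star (of hn y + of hn z) * p = star (of hn y) * p + star (of hn z) * p := by
        rw [star_add, add_mul]
      refine (congrArg _ this).trans ?_
      rw [map_add]
      exact (congrArg₂ _ hy hz).trans (add_zero 0)
    · intro t y _ hy
      have : star (t • of hn y) * p = star t • (star (of hn y) * p) := by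
        rw [star_smul, smul_mul_assoc]
      refine (congrArg _ this).trans ?_
      rw [map_smul]
      exact (congrArg _ hy).trans (smul_zero _)

/-- A new projection as an element of the algebra of boxes. -/
def ofNew {n : ℕ} (hn : n < 4) (p : S.NewProjection n) : S.BoxAlgebra n hn := p.1

theorem isMinProj_ofNew {n : ℕ} (hn : n < 4) (p : S.NewProjection n) : IsMinProj (ofNew hn p) :=
  p.2.1

/-- Equivalence of projections is already an equivalence relation, so the quotient identifies
nothing further. -/
theorem mk_eq_mk_iff {n : ℕ} (hn : n < 4) (p q : S.NewProjection n) :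
    (Quot.mk _ p : S.DepthVertex n) = Quot.mk _ q ↔ Equivalent (ofNew hn p) (ofNew hn q) := by
  constructor
  · intro h
    replace h := Quot.eqvGen_exact h
    induction h with
    | rel _ _ h => exact h
    | refl x => exact .refl (isMinProj_ofNew hn x).1
    | symm _ _ _ ih => exact ih.symm
    | trans _ y _ _ _ ih1 ih2 => exact ih1.trans isFaithfulTrace (isMinProj_ofNew hn y).1 ih2
  · exact fun h => Quot.sound h

theorem equivalent_out {n : ℕ} (hn : n < 4) (p : S.NewProjection n) :
    Equivalent (ofNew hn p) (ofNew hn (Quot.out (Quot.mk _ p : S.DepthVertex n))) :=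
  (mk_eq_mk_iff hn _ _).1 (Quot.out_eq _).symm

theorem existsUnique_out {n : ℕ} (hn : n < 4) (p : S.NewProjection n) :
    ∃! k : S.DepthVertex n, Equivalent (ofNew hn p) (ofNew hn (Quot.out k)) :=
  ⟨Quot.mk _ p, equivalent_out hn p, fun k hk => by
    rw [← Quot.out_eq k]
    exact ((mk_eq_mk_iff hn _ _).2 hk).symm⟩

end BoxAlgebra

end SubfactorPlanarAlgebra

/-! ### Edges and represented vertices. -/

namespace PlanarStarAlgebra

variable {S : PlanarStarAlgebra.{u}}

/-- An edge with the opposite direction of travel. -/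
def Edge.symm {v w : S.Vertex} : S.Edge v w → S.Edge w v
  | .up a b k => .down a b k
  | .down a b k => .up a b k

theorem Edge.symm_symm {v w : S.Vertex} (e : S.Edge v w) : e.symm.symm = e := by
  cases e <;> rfl

/-- Reversal of edges. -/
def edgeComm (v w : S.Vertex) : S.Edge v w ≃ S.Edge w v :=
  ⟨Edge.symm, Edge.symm, Edge.symm_symm, Edge.symm_symm⟩

theorem Edge.depth {v w : S.Vertex} (e : S.Edge v w) : v.1 + 1 = w.1 ∨ w.1 + 1 = v.1 := by
  cases e
  · exact .inl rfl
  · exact .inr rfl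

theorem bijective_up {n : ℕ} (a : S.DepthVertex n) (b : S.DepthVertex (n + 1)) :
    Function.Bijective (Edge.up a b) := by
  constructor
  · intro k l h
    cases h
    rfl
  · intro e
    cases e with
    | up _ _ k => exact ⟨k, rfl⟩

/-- The edges that increase the depth. -/
noncomputable def edgeUpEquiv {n : ℕ} (a : S.DepthVertex n) (b : S.DepthVertex (n + 1)) :
    S.Edge ⟨n, a⟩ ⟨n + 1, b⟩ ≃ Fin (S.edgeCount a b) :=
  (Equiv.ofBijective _ (bijective_up a b)).symm

/-- The constructor `old` only concerns boxes in S_{n+2}. -/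
theorem represents_zero {q : S.Box 0} {v : S.Vertex} (h : S.Represents q v) :
    ∃ p : S.NewProjection 0, p.1 = q ∧ v = ⟨0, Quot.mk _ p⟩ := by
  cases h with
  | new p => exact ⟨p, rfl, rfl⟩

theorem represents_two {P : S.Box 2} {v : S.Vertex} (h : S.Represents P v) :
    (∃ p : S.NewProjection 2, p.1 = P ∧ v = ⟨2, Quot.mk _ p⟩) ∨
      ∃ q : S.NewProjection 0, v = ⟨0, Quot.mk _ q⟩ ∧
        S.MvN P (S.mul (S.incl (S.incl q.1) : S.Box 2) (S.jones 0)) := by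
  cases h with
  | new p => exact .inl ⟨p, rfl, rfl⟩
  | old q v p h hp =>
    obtain ⟨q, rfl, rfl⟩ := represents_zero h
    exact .inr ⟨q, rfl, hp⟩

end PlanarStarAlgebra

/-! ### Paths of length 2 and the dimension of the corner. -/

namespace SubfactorPlanarAlgebra

variable (S : SubfactorPlanarAlgebra.{u})

open TracialAlgebra BoxAlgebra

/-- The Jones ideal is zero in depths 0 and 1, so every minimal projection there is new. -/
theorem exists_newProjection {n : ℕ} (hn : n < 2) {g : S.Box n} (hg : S.IsMinimalProjection g) :
    ∃ p : S.NewProjection n, p.1 = g := by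
  refine ⟨⟨g, hg, fun x hx => ?_⟩, rfl⟩
  have hx0 : x = 0 := by
    obtain rfl | rfl : n = 0 ∨ n = 1 := by omega
    · exact (Submodule.mem_bot ℂ).1 hx
    · exact (Submodule.mem_bot ℂ).1 hx
  have hs : S.star (0 : S.Box n) = 0 := star_zero (S.BoxAlgebra n (by omega))
  rw [hx0, hs, S.zero_mul]
  exact (S.isLinearMap_Z (traceTangle ⟨n, false⟩)).map_zero

variable {S}

/-- Boxes that are orthogonal to the second Jones projection are orthogonal to the first one. -/
theorem mul_incl_jones_eq_zero (h1 : S.one ⟨1, false⟩ ≠ 0)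
    {f : S.BoxAlgebra 3 (of_decide_eq_true rfl)}
    (hf : ∀ x, f * x * of _ (S.jones 1) = 0) (x : S.BoxAlgebra 3 (of_decide_eq_true rfl)) :
    f * x * BoxAlgebra.incl S 2 (by norm_num) (of _ (S.jones 0)) = 0 := by
  obtain ⟨t, ht0, ht, -⟩ := S.exists_delta_eq h1
  have hδ : S.delta ≠ 0 := by
    rw [ht]
    exact_mod_cast ht0.ne'
  let c : S.BoxAlgebra 3 (by norm_num) := S.cup 1
  let d : S.BoxAlgebra 2 (by norm_num) := S.cup 0
  have hc : of _ (S.jones 1) = S.delta⁻¹ • c := rfl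
  have hd : of _ (S.jones 0) = S.delta⁻¹ • d := rfl
  have hdc : BoxAlgebra.incl S 2 (by norm_num) d * c * BoxAlgebra.incl S 2 (by norm_num) d =
      BoxAlgebra.incl S 2 (by norm_num) d := S.cup_zero_mul_cup_one
  have hf' : ∀ y, f * y * c = 0 := by
    intro y
    have := hf y
    rw [hc, mul_smul_comm] at this
    exact (smul_eq_zero.1 this).resolve_left (inv_ne_zero hδ)
  -- The relation d = d c d for the two cup-cap diagrams inserts the second one, which `f`
  -- annihilates.
  rw [hd, map_smul, mul_smul_comm, ← hdc, ← mul_assoc, ← mul_assoc, mul_assoc f, hf', zero_mul,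
    smul_zero]

variable (S) in
/-- Representatives of the equivalence classes of minimal projections in the algebra of 3-boxes. -/
noncomputable def minProjThree :
    S.DepthVertex 1 ⊕ S.DepthVertex 3 → S.BoxAlgebra 3 (by norm_num) :=
  Sum.elim (fun k => BoxAlgebra.incl S 2 (by norm_num) (BoxAlgebra.incl S 1 (by norm_num)
    (ofNew _ k.out)) * of _ (S.jones 1)) (fun k => ofNew _ k.out)

variable (S) in
/-- The vertices of depth 1 and 3. -/
def oddVertex : S.DepthVertex 1 ⊕ S.DepthVertex 3 → S.Vertex :=
  Sum.elim (fun k => ⟨1, k⟩) (fun k => ⟨3, k⟩)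

theorem oddVertex_injective : Function.Injective S.oddVertex := by
  rintro (k | k) (l | l) h
  · cases h
    rfl
  · exact absurd (congrArg Sigma.fst h) (by decide : (1 : ℕ) ≠ 3)
  · exact absurd (congrArg Sigma.fst h) (by decide : (3 : ℕ) ≠ 1)
  · cases h
    rfl

theorem exists_oddVertex {z : S.Vertex} (h : z.1 = 1 ∨ z.1 = 3) : ∃ k, S.oddVertex k = z := by
  obtain ⟨n, z⟩ := z
  simp only at h
  rcases h with rfl | rfl
  · exact ⟨.inl z, rfl⟩
  · exact ⟨.inr z, rfl⟩

theorem ofNew_mul_jones (p : S.NewProjection 3) (x : S.BoxAlgebra 3 (by norm_num)) :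
    ofNew _ p * x * of _ (S.jones 1) = 0 :=
  (mul_jones_eq_zero_iff (n := 1) (by norm_num) (isMinProj_ofNew _ p).1).1 p.2.2 x

theorem isMinProj_minProjThree (h1 : S.one ⟨1, false⟩ ≠ 0) (k) : IsMinProj (S.minProjThree k) := by
  rcases k with k | k
  · exact (isJonesProjection S h1 (n := 1) (by norm_num)).isMinProj (isMinProj_ofNew _ _)
  · exact isMinProj_ofNew _ _

/-- The tower S_1 ⊂ S_2 ⊂ S_3 with its Jones projection: the classes of S_1 are the vertices of
depth 1, and those orthogonal to the Jones projection are the vertices of depth 3. -/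
theorem existsUnique_minProjThree (h1 : S.one ⟨1, false⟩ ≠ 0) {f : S.BoxAlgebra 3 (by norm_num)}
    (hf : IsMinProj f) : ∃! k, Equivalent f (S.minProjThree k) := by
  refine (isJonesProjection S h1 (n := 1) (by norm_num)).existsUnique_equivalent
    isFaithfulTrace isFaithfulTrace (fun k : S.DepthVertex 1 => ofNew _ k.out)
    (fun k : S.DepthVertex 3 => ofNew _ k.out) (fun k => isMinProj_ofNew _ _)
    (fun k => ⟨isMinProj_ofNew _ _, ofNew_mul_jones _⟩) ?_ ?_ hf
  · intro g hg
    obtain ⟨p, rfl⟩ := S.exists_newProjection (n := 1) (by norm_num) hg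
    exact existsUnique_out _ p
  · intro f hf hfe
    exact existsUnique_out (n := 3) (by norm_num)
      ⟨f, hf, (mul_jones_eq_zero_iff (n := 1) (by norm_num) hf.1).2 hfe⟩

theorem finrank_corner_minProjThree (h1 : S.one ⟨1, false⟩ ≠ 0)
    {P : S.BoxAlgebra 2 (by norm_num)} (hP : IsProj P) (k : S.DepthVertex 1) :
    Module.finrank ℂ (TracialAlgebra.corner (S.minProjThree (.inl k))
        (BoxAlgebra.incl S 2 (by norm_num) P)) =
      Module.finrank ℂ (TracialAlgebra.corner P
        (BoxAlgebra.incl S 1 (by norm_num) (ofNew _ k.out))) := by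
  rw [finrank_corner_comm (hP.map _) (isMinProj_minProjThree h1 _).1]
  exact (isJonesProjection S h1 (n := 1) (by norm_num)).finrank_corner

/-- The edges from the vertex of a minimal projection `P` of the algebra of 2-boxes to a vertex of
depth 1 or 3. -/
theorem nonempty_edge_equiv {P : S.BoxAlgebra 2 (by norm_num)} (hP : IsMinProj P) {v : S.Vertex}
    (hv : S.Represents P v) (k : S.DepthVertex 1 ⊕ S.DepthVertex 3) :
    Nonempty (S.Edge v (S.oddVertex k) ≃ Fin (Module.finrank ℂ
      (TracialAlgebra.corner (S.minProjThree k) (BoxAlgebra.incl S 2 (by norm_num) P)))) := by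
  have h1 : S.one ⟨1, false⟩ ≠ 0 := S.one_ne_zero_of_ne_zero hP.2.1
  rcases PlanarStarAlgebra.represents_two hv with ⟨p, rfl, rfl⟩ | ⟨q, rfl, hq⟩
  · have hout := isMinProj_ofNew (n := 2) (by norm_num)
      (Quot.out (Quot.mk _ p : S.DepthVertex 2))
    -- Edges are counted with the chosen representative of the class; corners do not change under
    -- equivalence.
    have he := equivalent_out (n := 2) (by norm_num) p
    rcases k with k | k
    · rw [finrank_corner_minProjThree h1 hP.1]
      refine ⟨(PlanarStarAlgebra.edgeComm _ _).trans ((PlanarStarAlgebra.edgeUpEquiv _ _).trans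
        (finCongr ?_))⟩
      exact (finrank_corner_congr_left isFaithfulTrace
        ((isMinProj_ofNew (n := 1) (by norm_num) k.out).1.map (BoxAlgebra.incl S 1 (by norm_num)))
        hP.1 hout.1 he).symm
    · refine ⟨(PlanarStarAlgebra.edgeUpEquiv _ _).trans (finCongr ?_)⟩
      exact (finrank_corner_congr_right isFaithfulTrace (S.minProjThree (.inr k))
        (hP.1.map (BoxAlgebra.incl S 2 (by norm_num))) (hout.1.map _) (he.map _)).symm
  · have hJ := isJonesProjection S h1 (n := 0) (by norm_num)
    have hq1 := isMinProj_ofNew (n := 0) (by norm_num) q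
    have hout := isMinProj_ofNew (n := 0) (by norm_num)
      (Quot.out (Quot.mk _ q : S.DepthVertex 0))
    have he := equivalent_out (n := 0) (by norm_num) q
    have hq' : Equivalent P (BoxAlgebra.incl S 1 (by norm_num) (BoxAlgebra.incl S 0 (by norm_num)
      (ofNew _ q)) * of _ (S.jones 0)) := hq
    rcases k with k | k
    · rw [finrank_corner_minProjThree h1 hP.1]
      refine ⟨(PlanarStarAlgebra.edgeUpEquiv _ _).trans (finCongr ?_)⟩
      have hz := (isMinProj_ofNew (n := 1) (by norm_num) k.out).1
      have hz' := hz.map (BoxAlgebra.incl S 1 (by norm_num))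
      -- `P` is replaced by q e_1, and the reciprocity for S_0 ⊂ S_1 ⊂ S_2 brings the corner down to
      -- S_1, where it defines the edges at depth 0.
      rw [finrank_corner_congr_left isFaithfulTrace hz' hP.1 (hJ.isProj hq1.1) hq',
        finrank_corner_comm hz' (hJ.isProj hq1.1), hJ.finrank_corner]
      exact (finrank_corner_congr_right isFaithfulTrace (ofNew (n := 1) (by norm_num) k.out)
        (hq1.1.map (BoxAlgebra.incl S 0 (by norm_num))) (hout.1.map _) (he.map _)).symm
    · have hproj : IsProj (BoxAlgebra.incl S 1 (by norm_num) (BoxAlgebra.incl S 0 (by norm_num)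
          (ofNew _ q)) * of _ (S.jones 0)) := hJ.isProj hq1.1
      -- A new projection of depth 3 annihilates e_1 as well, in accordance with the absence of
      -- edges between the depths 0 and 3.
      have h0 : TracialAlgebra.corner (S.minProjThree (.inr k)) (BoxAlgebra.incl S 2 (by norm_num)
          (BoxAlgebra.incl S 1 (by norm_num) (BoxAlgebra.incl S 0 (by norm_num) (ofNew _ q)) *
            of _ (S.jones 0))) = ⊥ := by
        rw [eq_bot_iff]
        intro z hz
        obtain ⟨x, rfl⟩ := mem_corner_iff'.1 hz
        rw [map_mul, ← mul_assoc, mul_assoc _ x]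
        exact mul_incl_jones_eq_zero h1 (ofNew_mul_jones k.out) _
      rw [finrank_corner_congr_right isFaithfulTrace _ (hP.1.map _)
        (hproj.map (BoxAlgebra.incl S 2 (by norm_num))) (hq'.map _), h0, finrank_bot]
      have : IsEmpty (S.Edge ⟨0, Quot.mk _ q⟩ (S.oddVertex (.inr k))) :=
        ⟨fun e => by
          rcases e.depth with h | h
          · exact absurd h (by decide : 0 + 1 ≠ 3)
          · exact absurd h (by decide : 3 + 1 ≠ 0)⟩
      exact ⟨Equiv.equivOfIsEmpty _ _⟩

theorem depth_of_edge {P : S.Box 2} {v z : S.Vertex} (hv : S.Represents P v) (e : S.Edge v z) :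
    z.1 = 1 ∨ z.1 = 3 := by
  have := e.depth
  rcases PlanarStarAlgebra.represents_two hv with ⟨p, -, rfl⟩ | ⟨q, rfl, -⟩
  · simp only at this
    omega
  · simp only at this
    omega

/-- A minimal projection of S_2 is either annihilated by e_1, and hence new, or equivalent to g e_1
with g minimal in S_0. -/
theorem exists_represents {P : S.BoxAlgebra 2 (by norm_num)} (hP : IsMinProj P) :
    ∃ v, S.Represents P v := by
  have h1 : S.one ⟨1, false⟩ ≠ 0 := S.one_ne_zero_of_ne_zero hP.2.1
  rcases (isJonesProjection S h1 (n := 0) (by norm_num)).eq_zero_or_exists_equivalent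
    isFaithfulTrace isFaithfulTrace hP with h | ⟨g, hg, h⟩
  · exact ⟨_, .new ⟨P, hP, (mul_jones_eq_zero_iff (n := 0) (by norm_num) hP.1).2 h⟩⟩
  · obtain ⟨q, rfl⟩ := S.exists_newProjection (n := 0) (by norm_num) hg
    exact ⟨_, .old q.1 _ P (.new q) h⟩

/-- The classes of minimal projections of S_3 are the possible middle vertices, and the two corner
dimensions for such a class are the numbers of edges to `w` and to `v`. -/
theorem finrank_corner_eq_pathCountTwo {P Q : S.BoxAlgebra 2 (by norm_num)} (hP : IsMinProj P)
    (hQ : IsMinProj Q) {v w : S.Vertex} (hv : S.Represents P v) (hw : S.Represents Q w) :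
    Module.finrank ℂ (TracialAlgebra.corner (BoxAlgebra.incl S 2 (by norm_num) Q)
      (BoxAlgebra.incl S 2 (by norm_num) P)) = S.pathCountTwo v w := by
  have h1 : S.one ⟨1, false⟩ ≠ 0 := S.one_ne_zero_of_ne_zero hP.2.1
  rw [← finrank_corner_eq_sum_card isFaithfulTrace S.minProjThree (isMinProj_minProjThree h1)
    (fun f hf => existsUnique_minProjThree h1 hf) (hQ.1.map _) (hP.1.map _)]
  refine Nat.card_congr ?_
  have e1 := fun k => Classical.choice (nonempty_edge_equiv hP hv k)
  have e2 := fun k => Classical.choice (nonempty_edge_equiv hQ hw k)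
  -- The triples list the factor of `Q` before that of `P`, whereas a path starts at `v`; hence the
  -- exchange of the factors and the reversal of the second edge.
  refine (Equiv.sigmaCongrRight (β₂ := fun k => S.Edge v (S.oddVertex k) × S.Edge (S.oddVertex k) w)
    fun k => (Equiv.prodComm _ _).trans (Equiv.prodCongr (e1 k).symm
      ((finCongr (finrank_corner_comm ((isMinProj_minProjThree h1 k).1) (hQ.1.map _))).trans
        ((e2 k).symm.trans (PlanarStarAlgebra.edgeComm _ _))))).trans ?_
  -- No path is lost, because every neighbour of `v` has depth 1 or 3.
  refine Equiv.ofBijective (Sigma.map S.oddVertex fun _ => id) ⟨?_, ?_⟩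
  · exact oddVertex_injective.sigma_map fun _ => Function.injective_id
  · rintro ⟨z, x, y⟩
    obtain ⟨k, rfl⟩ := exists_oddVertex (depth_of_edge hv x)
    exact ⟨⟨k, x, y⟩, rfl⟩

end SubfactorPlanarAlgebra

theorem lemma4p2 (S : SubfactorPlanarAlgebra.{u}) (P Q : S.Box 2)
    (hP : S.IsProjection P) (hQ : S.IsProjection Q) :
    ((∃ k, S.HasRank (S.coproduct (S.contragredient P) Q) k) ∧
      ∀ k, S.HasRank (S.coproduct (S.contragredient P) Q) k →
        k ≤ Module.finrank ℂ (S.corner (S.incl Q : S.Box 3) (S.incl P : S.Box 3))) ∧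
    (S.IsMinimalProjection P → S.IsMinimalProjection Q →
      (∃ v, S.Represents P v) ∧ (∃ w, S.Represents Q w) ∧
      ∀ v w, S.Represents P v → S.Represents Q w →
        Module.finrank ℂ (S.corner (S.incl Q : S.Box 3) (S.incl P : S.Box 3)) =
          S.pathCountTwo v w ∧
        ∀ k, S.HasRank (S.coproduct (S.contragredient P) Q) k → k ≤ S.pathCountTwo v w) := by
  refine ⟨⟨S.exists_hasRank hP hQ, fun k => S.le_finrank_of_hasRank hP hQ⟩, fun hP' hQ' =>
    ⟨SubfactorPlanarAlgebra.exists_represents hP', SubfactorPlanarAlgebra.exists_represents hQ',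
      fun v w hv hw => ?_⟩⟩
  have h := SubfactorPlanarAlgebra.finrank_corner_eq_pathCountTwo hP' hQ' hv hw
  exact ⟨h, fun k hk => (S.le_finrank_of_hasRank hP hQ hk).trans_eq h⟩
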